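/- Let $n\ge 1$, let $Z$ be a standard normal random vector in $\mathbf R^n$ (law $\gamma$, density $q(x)=(2\pi)^{-n/2}e^{-|x|^2/2}$), and let $\Delta(t)=t-\log(1+t)$ for $t>-1$. For a random vector $X$ in $\mathbf R^n$ with law $\mu$ and smooth density $p$ put $$D(X|Z)=\int p\log\frac pq\,dx,\qquad I(X|Z)=\int\Big|\frac{\nabla p}{p}-\frac{\nabla q}{q}\Big|^2p\,dx,\qquad I(X)=\int\frac{|\nabla p|^2}{p}\,dx$$ (in the last two integrals, zeros of $p$ do not contribute) and $$W_2(X,Z)=\inf_\pi\Big(\iint|x-z|^2\,d\pi(x,z)\Big)^{1/2},$$ the infimum being over all probability measures $\pi$ on $\mathbf R^n\times\mathbf R^n$ with marginals $\mu$ and $\gamma$. Theorem 1.1. For any random vector $X$ in $\mathbf R^n$ with a smooth density such that $I(X|Z)$ is finite, the quantities $D(X|Z)$, $I(X)$ and $W_2(X,Z)$ are finite, the arguments of $\Delta$ below are greater than $-1$, and $$I(X|Z)-2D(X|Z)\ \ge\ n\,\Delta\Big(\frac{I(X)}{n}-1\Big).$$ Moreover, $$I(X|Z)-2D(X|Z)\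 \ge\ \big(\sqrt{I(X|Z)}-W_2(X,Z)\big)^2+n\,\Delta\Big(\frac{W_2(X,Z)}{\sqrt{I(X|Z)}}\Big(\frac{I(X)}{n}-1\Big)\Big),$$ where $W_2(X,Z)/\sqrt{I(X|Z)}$ is read as $0$ if $I(X|Z)=0$. -/

import Mathlib

noncomputable section

namespace GaussLSI

/-- The density of the standard Gaussian measure on `ℝⁿ` with respect to Lebesgue measure. -/
def gaussDensity (n : ℕ) (x : EuclideanSpace ℝ (Fin n)) : ℝ :=
  ((2 * Real.pi) ^ ((n : ℝ) / 2))⁻¹ * Real.exp (-‖x‖ ^ 2 / 2)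

/-- The Fisher information `∫ |∇p|² / p dx` of a density `p`, with values in `[0, ∞]`.
At a zero of a nonnegative differentiable `p` also `∇p` vanishes; the integrand is `0` there. -/
def fisherInfo {n : ℕ} (p : EuclideanSpace ℝ (Fin n) → ℝ) : ENNReal :=
  ∫⁻ x, ENNReal.ofReal (‖gradient p x‖ ^ 2 / p x)

/-- The relative Fisher information `∫ |∇p/p - ∇q/q|² p dx` of densities `p` and `q`,
with values in `[0, ∞]`. Zeros of `p` do not contribute. -/
def relFisherInfo {n : ℕ} (p q : EuclideanSpace ℝ (Fin n) → ℝ) : ENNReal :=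
  ∫⁻ x, ENNReal.ofReal
    (‖(p x)⁻¹ • gradient p x - (q x)⁻¹ • gradient q x‖ ^ 2 * p x)

/-- The quadratic Kantorovich distance of two probability measures on `ℝⁿ`: the infimum of
`(∫∫ |x - z|² dπ(x, z))^{1/2}` over all measures `π` with marginals `μ` and `ν`. -/
def W2 {n : ℕ} (μ ν : MeasureTheory.Measure (EuclideanSpace ℝ (Fin n))) : ENNReal :=
  ⨅ π ∈ {π : MeasureTheory.Measure (EuclideanSpace ℝ (Fin n) × EuclideanSpace ℝ (Fin n)) |
      π.fst = μ ∧ π.snd = ν},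
    (∫⁻ z, ENNReal.ofReal (‖z.1 - z.2‖ ^ 2) ∂π) ^ (1 / 2 : ℝ)

/-- The function `Δ(t) = t - log (1 + t)`, meaningful for `t > -1`. -/
def Δ (t : ℝ) : ℝ := t - Real.log (1 + t)

/-- `gaussDensity n` is indeed the density of Mathlib's standard Gaussian measure. -/
theorem stdGaussian_eq_withDensity (n : ℕ) :
    ProbabilityTheory.stdGaussian (EuclideanSpace ℝ (Fin n)) =
      MeasureTheory.volume.withDensity (fun x => ENNReal.ofReal (gaussDensity n x)) := by
  have hpos : 0 < (2 * Real.pi) ^ ((n : ℝ) / 2) := by positivity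
  have hcont : Continuous (gaussDensity n) := by
    unfold gaussDensity; fun_prop
  have hnn : ∀ x, 0 ≤ gaussDensity n x := fun x => by unfold gaussDensity; positivity
  have hint : MeasureTheory.Integrable (gaussDensity n) := by
    have h := (GaussianFourier.integrable_cexp_neg_mul_sq_norm_add
      (V := EuclideanSpace ℝ (Fin n)) (b := (1 / 2 : ℂ)) (by norm_num) 0 0).norm
    refine (h.const_mul ((2 * Real.pi) ^ ((n : ℝ) / 2))⁻¹).congr
      (Filter.Eventually.of_forall fun x => ?_)
    simp only [gaussDensity, Complex.norm_exp]
    congr 2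
    have : (-(1 / 2 : ℂ) * (‖x‖ : ℂ) ^ 2 + 0 * ((inner ℝ 0 x : ℝ) : ℂ)) =
        ((-‖x‖ ^ 2 / 2 : ℝ) : ℂ) := by
      push_cast; ring
    rw [this, Complex.ofReal_re]
  have : MeasureTheory.IsFiniteMeasure (MeasureTheory.volume.withDensity
      (fun x => ENNReal.ofReal (gaussDensity n x))) :=
    MeasureTheory.isFiniteMeasure_withDensity_ofReal hint.2
  refine MeasureTheory.Measure.ext_of_charFun (funext fun t => ?_)
  rw [ProbabilityTheory.charFun_stdGaussian, MeasureTheory.charFun_apply,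
    integral_withDensity_eq_integral_toReal_smul (by fun_prop) (by simp)]
  have key := GaussianFourier.integral_cexp_neg_mul_sq_norm_add
    (V := EuclideanSpace ℝ (Fin n)) (b := (1 / 2 : ℂ)) (by norm_num) Complex.I t
  have hpw : (Real.pi / (1 / 2 : ℂ)) ^ ((Module.finrank ℝ (EuclideanSpace ℝ (Fin n)) : ℂ) / 2) =
      (((2 * Real.pi) ^ ((n : ℝ) / 2) : ℝ) : ℂ) := by
    rw [Complex.ofReal_cpow (by positivity)]
    push_cast
    rw [finrank_euclideanSpace_fin]
    congr 1
    ring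
  rw [hpw] at key
  calc Complex.exp (-‖t‖ ^ 2 / 2)
      = ((((2 * Real.pi) ^ ((n : ℝ) / 2))⁻¹ : ℝ) : ℂ) *
        ∫ v : EuclideanSpace ℝ (Fin n),
          Complex.exp (-(1 / 2 : ℂ) * (‖v‖ : ℂ) ^ 2 + Complex.I * ((inner ℝ t v : ℝ) : ℂ)) := by
        rw [key, ← mul_assoc, ← Complex.ofReal_mul, inv_mul_cancel₀ hpos.ne', Complex.ofReal_one,
          one_mul, Complex.I_sq]
        congr 1
        ring
    _ = _ := by
        rw [← MeasureTheory.integral_const_mul]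
        refine MeasureTheory.integral_congr_ae (Filter.Eventually.of_forall fun x => ?_)
        simp only [ENNReal.toReal_ofReal (hnn x), Complex.real_smul]
        rw [gaussDensity, Complex.ofReal_mul, mul_assoc, Complex.ofReal_exp, ← Complex.exp_add,
          real_inner_comm]
        congr 2
        push_cast
        ring

end GaussLSI

end

open MeasureTheory ProbabilityTheory Filter Topology InformationTheory
open scoped RealInnerProductSpace

set_option linter.unusedSectionVars false

namespace GaussLSI

/-! ### Scaled Gaussians: additivity of variance and moments. -/

section GaussianConvolution

variable {E : Type*} [NormedAddCommGroup E] [InnerProductSpace ℝ E] [FiniteDimensional ℝ E]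
  [MeasurableSpace E] [BorelSpace E]

/-! Write J for the Fisher information of p, a for its second moment, I for the relative Fisher
information, D for the relative entropy and W for the transport distance. Integrating ∇p · x by
parts gives I = J - 2n + a, while 2D = 2∫ p log p + n log 2π + a, so a cancels in I - 2D. Finiteness
of I alone forces a and J to be finite (`integrable_second_moment`).

The first inequality is the Gaussian logarithmic Sobolev inequality sharpened by scaling: dilations
turn it into a Euclidean inequality with a free parameter v (`euclidean_lsi`), and the optimal v =
n/J produces the term nΔ(J/n - 1).

For the second, couple X with Z and add the same independent noise σG to both. The relative entropy
of X splits into that of X + σG relative to Z + σG, plus the average entropy of the conditional laws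
given the noisy variable. The log-sum inequality bounds the first part by E|X - Z|²/(2σ²). The
second is bounded by the Euclidean inequality applied to the conditional laws of X, whose scores are
∇p/p + (y - x)/σ². Both bounds are combined for each value y and then integrated
(`entropy_le_of_coupling`). With u = σ²/(1 + σ²), the best v and nearly optimal couplings, this
becomes `klDiv_le_W2`: 2D ≤ W²(1/u - 1) + u(a - n) + n log(1 + u(J/n - 1)) for 0 < u < 1. Since u(a
- n) = uI - u(J - n), the choice u = W/√I is exactly the refined inequality.

Talagrand's inequality W² ≤ 2D and the logarithmic Sobolev inequality 2D ≤ I give W ≤ √I. If W = √I,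
the claim is the first inequality; if W = 0, letting u tend to 0 gives D = 0.

The logarithmic Sobolev inequality itself is obtained by cutting the heat flow into many short steps
(`HasTameGradient.entropy_le`), followed by truncation (`integral_klFun_le`). Talagrand's inequality
is obtained by induction on the dimension, using the chain rule for entropy and monotone transport
on one-dimensional fibres (`lintegral_sq_sub_gaussTransport_le`). -/

lemma stdGaussian_map_sqrt_smul_conv {a b : ℝ} (ha : 0 ≤ a) (hb : 0 ≤ b) :
    ((stdGaussian E).map (fun x => √a • x)) ∗ ((stdGaussian E).map (fun x => √b • x)) =
      (stdGaussian E).map (fun x => √(a + b) • x) := by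
  have : IsProbabilityMeasure ((stdGaussian E).map (fun x => √a • x)) :=
    Measure.isProbabilityMeasure_map (by fun_prop)
  have : IsProbabilityMeasure ((stdGaussian E).map (fun x => √b • x)) :=
    Measure.isProbabilityMeasure_map (by fun_prop)
  have : IsProbabilityMeasure ((stdGaussian E).map (fun x => √(a + b) • x)) :=
    Measure.isProbabilityMeasure_map (by fun_prop)
  refine Measure.ext_of_charFun (funext fun t => ?_)
  rw [charFun_conv, charFun_map_smul, charFun_map_smul, charFun_map_smul, charFun_stdGaussian,
    charFun_stdGaussian, charFun_stdGaussian, ← Complex.exp_add]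
  simp only [norm_smul, Real.norm_eq_abs, abs_of_nonneg (Real.sqrt_nonneg _)]
  congr 1
  have h1 : (√a) ^ 2 = a := Real.sq_sqrt ha
  have h2 : (√b) ^ 2 = b := Real.sq_sqrt hb
  have h3 : (√(a + b)) ^ 2 = a + b := Real.sq_sqrt (add_nonneg ha hb)
  have : -(√a * ‖t‖) ^ 2 / 2 + -(√b * ‖t‖) ^ 2 / 2 = -(√(a + b) * ‖t‖) ^ 2 / 2 := by
    rw [mul_pow, mul_pow, mul_pow, h1, h2, h3]; ring
  exact_mod_cast this

/-- Independent Gaussian increments add their variances; this becomes the semigroup law `heat_heat`.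
-/
lemma integral_stdGaussian_add {a b : ℝ} (ha : 0 ≤ a) (hb : 0 ≤ b) {f : E → ℝ} {C : ℝ}
    (hf : Continuous f) (hC : ∀ x, |f x| ≤ C) (x : E) :
    ∫ z, ∫ w, f (x + √a • z + √b • w) ∂(stdGaussian E) ∂(stdGaussian E) =
      ∫ z, f (x + √(a + b) • z) ∂(stdGaussian E) := by
  have hc : Continuous fun y => f (x + y) := by fun_prop
  have e := integral_map (μ := stdGaussian E) (φ := fun z : E => √(a + b) • z)
    (f := fun y => f (x + y)) (by fun_prop) hc.aestronglyMeasurable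
  rw [← e, ← stdGaussian_map_sqrt_smul_conv ha hb]
  have : IsProbabilityMeasure ((stdGaussian E).map (fun x => √a • x)) :=
    Measure.isProbabilityMeasure_map (by fun_prop)
  have : IsProbabilityMeasure ((stdGaussian E).map (fun x => √b • x)) :=
    Measure.isProbabilityMeasure_map (by fun_prop)
  rw [integral_conv (Integrable.of_bound hc.aestronglyMeasurable C
    (ae_of_all _ fun y => by simpa using hC _))]
  rw [integral_map (by fun_prop)]
  · refine integral_congr_ae (ae_of_all _ fun z => ?_)
    simp only
    rw [integral_map (by fun_prop)]
    · simp only [add_assoc]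
    · exact Continuous.aestronglyMeasurable (by fun_prop)
  · refine (StronglyMeasurable.integral_prod_right (f := fun y w : E => f (x + (y + w)))
      ?_).aestronglyMeasurable
    exact Continuous.stronglyMeasurable (by fun_prop)

lemma integrable_norm_pow_stdGaussian (k : ℕ) :
    Integrable (fun z : E => ‖z‖ ^ k) (stdGaussian E) := by
  have := (IsGaussian.memLp_id (stdGaussian E) k (by simp)).integrable_norm_pow'
  simpa using this

lemma integral_inner_sq_stdGaussian (v : E) :
    ∫ z, ⟪v, z⟫ ^ 2 ∂(stdGaussian E) = ‖v‖ ^ 2 := by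
  have h := variance_dual_stdGaussian (E := E) (innerSL ℝ v)
  rw [variance_of_integral_eq_zero (by fun_prop) (integral_strongDual_stdGaussian _)] at h
  simpa using h

end GaussianConvolution

/-! ### Taylor bounds for the entropy function. -/

section LocalEntropy

/-- Multiply the third-order Taylor bound of log at 1 by t. The quadratic coefficient 1/2 is exact,
which is what yields the sharp constant in the logarithmic Sobolev inequality; the higher terms only
need to be of order three. -/
lemma mul_log_sub_add_one_le {t : ℝ} (ht : 0 < t) :
    t * Real.log t - t + 1 ≤ (t - 1) ^ 2 / 2 - (t - 1) ^ 3 / 6 + (t - 1) ^ 4 / 3 := by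
  have key : Real.log t ≤ (t - 1) - (t - 1) ^ 2 / 2 + (t - 1) ^ 3 / 3 := by
    let g : ℝ → ℝ := fun t => (t - 1) - (t - 1) ^ 2 / 2 + (t - 1) ^ 3 / 3 - Real.log t
    have hd : ∀ x : ℝ, 0 < x → HasDerivAt g ((x - 1) ^ 3 / x) x := by
      intro x hx
      have := ((((hasDerivAt_id x).sub_const 1).sub
        ((((hasDerivAt_id x).sub_const 1).pow 2).div_const 2)).add
        ((((hasDerivAt_id x).sub_const 1).pow 3).div_const 3)).sub (Real.hasDerivAt_log hx.ne')
      refine this.congr_deriv ?_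
      simp only [id]
      field_simp
      push_cast
      ring
    have h1 : g 1 = 0 := by simp [g]
    suffices 0 ≤ g t by simp only [g] at this; linarith
    rw [← h1]
    rcases le_total t 1 with h | h
    · refine antitoneOn_of_deriv_nonpos (D := Set.Ioc 0 1) (convex_Ioc 0 1) ?_ ?_ ?_ ⟨ht, h⟩
        ⟨one_pos, le_rfl⟩ h
      · exact fun x hx => (hd x hx.1).continuousAt.continuousWithinAt
      · intro x hx
        rw [interior_Ioc] at hx
        exact (hd x hx.1).differentiableAt.differentiableWithinAt
      · intro x hx
        rw [interior_Ioc] at hx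
        rw [(hd x hx.1).deriv]
        refine div_nonpos_of_nonpos_of_nonneg ?_ hx.1.le
        exact (Odd.pow_nonpos (by decide) (by linarith [hx.2]))
    · refine monotoneOn_of_deriv_nonneg (D := Set.Ici 1) (convex_Ici 1) ?_ ?_ ?_ Set.self_mem_Ici
        h h
      · exact fun x hx => (hd x (lt_of_lt_of_le one_pos hx)).continuousAt.continuousWithinAt
      · intro x hx
        rw [interior_Ici] at hx
        exact (hd x (lt_trans one_pos hx)).differentiableAt.differentiableWithinAt
      · intro x hx
        rw [interior_Ici] at hx
        rw [(hd x (lt_trans one_pos hx)).deriv]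
        exact div_nonneg (pow_nonneg (by linarith [Set.mem_Ioi.1 hx]) 3)
          (by linarith [Set.mem_Ioi.1 hx])
  have := mul_le_mul_of_nonneg_left key ht.le
  nlinarith

/-- The previous bound at t = b/a, multiplied by a. The lower bound ε on a and the bound C on |b -
a| absorb the quartic term into the cubic one. -/
lemma mul_log_div_sub_add_le {ε C a b : ℝ} (hε : 0 < ε) (ha : ε ≤ a) (hb : ε ≤ b) (hC : |b - a| ≤ C) :
    b * Real.log (b / a) - b + a ≤
      (b - a) ^ 2 / (2 * a) + (1 / (6 * ε ^ 2) + C / (3 * ε ^ 3)) * |b - a| ^ 3 := by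
  have ha0 : 0 < a := hε.trans_le ha
  have hb0 : 0 < b := hε.trans_le hb
  have h := mul_le_mul_of_nonneg_left (mul_log_sub_add_one_le (div_pos hb0 ha0)) ha0.le
  have e1 : a * (b / a * Real.log (b / a) - b / a + 1) = b * Real.log (b / a) - b + a := by
    field_simp
  have e2 : a * ((b / a - 1) ^ 2 / 2 - (b / a - 1) ^ 3 / 6 + (b / a - 1) ^ 4 / 3) =
      (b - a) ^ 2 / (2 * a) + (-(b - a) ^ 3 / (6 * a ^ 2) + (b - a) ^ 4 / (3 * a ^ 3)) := by
    field_simp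
    ring
  rw [e1, e2] at h
  refine h.trans (by
    gcongr
    rw [add_mul]
    gcongr ?_ + ?_
    · rw [div_mul_eq_mul_div, one_mul]
      have : -(b - a) ^ 3 ≤ |b - a| ^ 3 := by
        rw [← abs_pow]; exact neg_le_abs _
      gcongr
    · rw [div_mul_eq_mul_div]
      have : (b - a) ^ 4 = |b - a| * |b - a| ^ 3 := by
        rw [← pow_succ', Even.pow_abs (by decide)]
      have h0 : 0 ≤ C := (abs_nonneg _).trans hC
      rw [this]
      gcongr)

/-- Here d stands for an increment of f along √h z, g for the directional derivative and N for |z|.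
Since d = √h g + O(h), every contribution beyond h g² carries a factor h^{3/2}, and h ≤ 1 lowers the
larger powers to that one. -/
lemma sq_and_cube_le_of_expansion {h C L N g d : ℝ} (h0 : 0 ≤ h) (h1 : h ≤ 1) (hC : 0 ≤ C)
    (hN : 0 ≤ N) (hLN : 0 ≤ L * N ^ 2) (hg : |g| ≤ C * N)
    (hd : |d - √h * g| ≤ L * (h * N ^ 2)) :
    d ^ 2 ≤ h * g ^ 2 + h * √h * (2 * C * L * N ^ 3 + L ^ 2 * N ^ 4) ∧
    |d| ^ 3 ≤ h * √h *
      (C ^ 3 * N ^ 3 + 3 * C ^ 2 * L * N ^ 4 + 3 * C * L ^ 2 * N ^ 5 + L ^ 3 * N ^ 6) := by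
  obtain ⟨r, hr⟩ : ∃ r, r = d - √h * g := ⟨_, rfl⟩
  rw [← hr] at hd
  obtain rfl : d = √h * g + r := by rw [hr]; ring
  clear hr
  obtain ⟨s, hs⟩ : ∃ s, s = √h := ⟨_, rfl⟩
  have hs0 : 0 ≤ s := hs ▸ Real.sqrt_nonneg h
  have hs1 : s ≤ 1 := hs ▸ Real.sqrt_le_one.2 h1
  obtain rfl : h = s * s := by rw [hs, Real.mul_self_sqrt h0]
  rw [← hs]
  obtain ⟨q, hq⟩ : ∃ q, q = L * N ^ 2 := ⟨_, rfl⟩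
  rw [← hq] at hLN
  have hd' : |r| ≤ s * s * q := by rw [hq]; linarith
  have hCN : 0 ≤ C * N := mul_nonneg hC hN
  constructor
  · have h2 : g * r ≤ (C * N) * (s * s * q) :=
      (le_abs_self _).trans ((abs_mul g r).le.trans (mul_le_mul hg hd' (abs_nonneg _) hCN))
    have h3 : r ^ 2 ≤ (s * s * q) ^ 2 := by rw [← sq_abs]; gcongr
    have h4 : (s * s * q) ^ 2 ≤ s * s * s * q ^ 2 := by
      have : s * (s * s * s * q ^ 2) ≤ 1 * (s * s * s * q ^ 2) := by gcongr
      linarith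
    have h5 : s * (g * r) ≤ s * ((C * N) * (s * s * q)) := by gcongr
    calc (s * g + r) ^ 2 = s * s * g ^ 2 + 2 * (s * (g * r)) + r ^ 2 := by ring
      _ ≤ s * s * g ^ 2 + 2 * (s * ((C * N) * (s * s * q))) + s * s * s * q ^ 2 := by linarith
      _ = _ := by rw [hq]; ring
  · have h6 : |s * g + r| ≤ s * (C * N + q) := by
      refine (abs_add_le _ _).trans ?_
      rw [abs_mul, abs_of_nonneg hs0, mul_add]
      refine add_le_add (mul_le_mul_of_nonneg_left hg hs0) (hd'.trans ?_)
      have : s * (s * q) ≤ 1 * (s * q) := by gcongr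
      linarith
    calc |s * g + r| ^ 3 ≤ (s * (C * N + q)) ^ 3 := by gcongr
      _ = _ := by rw [hq]; ring

end LocalEntropy

/-! ### The heat semigroup and a logarithmic Sobolev inequality for short times. -/

section Interpolation

variable {E : Type*} [NormedAddCommGroup E] [InnerProductSpace ℝ E] [FiniteDimensional ℝ E]
  [MeasurableSpace E] [BorelSpace E]

/-- `f` takes values in `[ε, C]` and `G` is a bounded gradient of `f`, with a uniform quadratic
bound for the error of the first-order expansion. -/
structure HasTameGradient (f : E → ℝ) (G : E → E) (ε C L : ℝ) : Prop where
  cont : Continuous f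
  cont_grad : Continuous G
  lower : ∀ x, ε ≤ f x
  upper : ∀ x, f x ≤ C
  grad_le : ∀ x, ‖G x‖ ≤ C
  expansion : ∀ x w, |f (x + w) - f x - ⟪G x, w⟫| ≤ L * ‖w‖ ^ 2

/-- The heat semigroup at variance `t`. -/
noncomputable def heat {F : Type*} [NormedAddCommGroup F] [NormedSpace ℝ F] (t : ℝ) (f : E → F) (x : E) : F :=
  ∫ z, f (x + √t • z) ∂(stdGaussian E)

lemma continuous_heat {F : Type*} [NormedAddCommGroup F] [NormedSpace ℝ F]
    [SecondCountableTopology F] {f : E → F}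
    {C : ℝ} (hf : Continuous f) (hC : ∀ x, ‖f x‖ ≤ C) (t : ℝ) : Continuous (heat t f) := by
  refine continuous_of_dominated (bound := fun _ => C) (fun x => ?_) (fun x => ?_)
    (integrable_const C) (ae_of_all _ fun z => by fun_prop)
  · exact Continuous.aestronglyMeasurable (by fun_prop)
  · exact ae_of_all _ fun z => hC _

lemma integrable_shift {F : Type*} [NormedAddCommGroup F] [NormedSpace ℝ F]
    [SecondCountableTopology F] {f : E → F}
    {C : ℝ} (hf : Continuous f) (hC : ∀ x, ‖f x‖ ≤ C) (x : E) (t : ℝ) :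
    Integrable (fun z => f (x + √t • z)) (stdGaussian E) :=
  Integrable.of_bound (Continuous.aestronglyMeasurable (by fun_prop)) C (ae_of_all _ fun z => hC _)

namespace HasTameGradient

variable {f : E → ℝ} {G : E → E} {ε C L : ℝ}

lemma abs_le (h : HasTameGradient f G ε C L) (hε : 0 < ε) (x : E) : ‖f x‖ ≤ C := by
  rw [Real.norm_eq_abs, abs_of_nonneg (hε.le.trans (h.lower x))]
  exact h.upper x

/-- All the conditions survive averaging over translates with the same constants. Hence one error
constant serves every step of the interpolation. -/
protected lemma heat (h : HasTameGradient f G ε C L) (hε : 0 < ε) (t : ℝ) :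
    HasTameGradient (heat t f) (heat t G) ε C L where
  cont := continuous_heat h.cont (h.abs_le hε) t
  cont_grad := continuous_heat h.cont_grad h.grad_le t
  lower x := by
    have := integral_mono (integrable_const ε) (integrable_shift h.cont (h.abs_le hε) x t)
      (fun z => h.lower (x + √t • z))
    simpa [heat] using this
  upper x := by
    have := integral_mono (integrable_shift h.cont (h.abs_le hε) x t) (integrable_const C)
      (fun z => h.upper (x + √t • z))
    simpa [heat] using this
  grad_le x := by
    have := norm_integral_le_of_norm_le_const (μ := stdGaussian E)
      (f := fun z => G (x + √t • z)) (C := C) (ae_of_all _ fun z => h.grad_le _)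
    simpa [heat] using this
  expansion x w := by
    have i1 := integrable_shift h.cont (h.abs_le hε) (x + w) t
    have i2 := integrable_shift h.cont (h.abs_le hε) x t
    have i3 := integrable_shift h.cont_grad h.grad_le x t
    have e : heat t f (x + w) - heat t f x - ⟪heat t G x, w⟫ =
        ∫ z, (f (x + w + √t • z) - f (x + √t • z) - ⟪G (x + √t • z), w⟫) ∂(stdGaussian E) := by
      rw [integral_sub (by exact i1.sub i2) (i3.inner_const w), integral_sub i1 i2]
      congr 1
      simp only [heat]
      rw [real_inner_comm, ← integral_inner i3]
      simp only [real_inner_comm]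
    rw [e]
    have := norm_integral_le_of_norm_le_const (μ := stdGaussian E)
      (f := fun z => f (x + w + √t • z) - f (x + √t • z) - ⟪G (x + √t • z), w⟫)
      (C := L * ‖w‖ ^ 2) (ae_of_all _ fun z => by
        have := h.expansion (x + √t • z) w
        rwa [show x + √t • z + w = x + w + √t • z by abel] at this)
    simpa using this

lemma continuous_fisher (h : HasTameGradient f G ε C L) (hε : 0 < ε) :
    Continuous fun x => ‖G x‖ ^ 2 / f x :=
  (h.cont_grad.norm.pow 2).div h.cont fun x => (hε.trans_le (h.lower x)).ne'

lemma fisher_le (h : HasTameGradient f G ε C L) (hε : 0 < ε) (x : E) :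
    |‖G x‖ ^ 2 / f x| ≤ C ^ 2 / ε := by
  rw [abs_of_nonneg (div_nonneg (sq_nonneg _) (hε.le.trans (h.lower x)))]
  have := h.grad_le x
  have := h.lower x
  gcongr

/-- Joint convexity of `|G|²/f`. -/
lemma fisher_heat_le (h : HasTameGradient f G ε C L) (hε : 0 < ε) (t : ℝ) (x : E) :
    ‖heat t G x‖ ^ 2 / heat t f x ≤ heat t (fun y => ‖G y‖ ^ 2 / f y) x := by
  have i2 := integrable_shift h.cont (h.abs_le hε) x t
  have i3 := integrable_shift h.cont_grad h.grad_le x t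
  have i4 := integrable_shift (h.continuous_fisher hε) (h.fisher_le hε) x t
  have hpos : 0 < heat t f x := hε.trans_le ((h.heat hε t).lower x)
  -- |G|²/f is the supremum over c of the affine functions 2⟨c, G⟩ - |c|² f. This c is optimal for
  -- the averaged pair, so averaging the affine bound gives the claim.
  set c : E := (heat t f x)⁻¹ • heat t G x with hc
  have key : ∀ z : E, 2 * ⟪c, G (x + √t • z)⟫ - ‖c‖ ^ 2 * f (x + √t • z) ≤
      ‖G (x + √t • z)‖ ^ 2 / f (x + √t • z) := by
    intro z
    have hf : 0 < f (x + √t • z) := hε.trans_le (h.lower _)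
    rw [le_div_iff₀ hf]
    have := sq_nonneg ‖G (x + √t • z) - f (x + √t • z) • c‖
    have e := norm_sub_sq_real (G (x + √t • z)) (f (x + √t • z) • c)
    rw [norm_smul, real_inner_smul_right, real_inner_comm, Real.norm_eq_abs, mul_pow, sq_abs] at e
    nlinarith [sq_nonneg ‖G (x + √t • z) - f (x + √t • z) • c‖]
  have := integral_mono ((((i3.const_inner c).const_mul 2)).sub (i2.const_mul (‖c‖ ^ 2))) i4 key
  rw [integral_sub' ((i3.const_inner c).const_mul 2) (i2.const_mul _), integral_const_mul,
    integral_const_mul, integral_inner i3] at this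
  refine le_trans (le_of_eq ?_) this
  change _ = 2 * ⟪c, heat t G x⟫ - ‖c‖ ^ 2 * heat t f x
  rw [hc, norm_smul, real_inner_smul_left, real_inner_self_eq_norm_sq, mul_pow, Real.norm_eq_abs,
    sq_abs]
  field_simp
  ring

end HasTameGradient

/-- Small-variance logarithmic Sobolev inequality with an error term that is uniform over tame
functions. -/
lemma exists_local_entropy_le {ε C L : ℝ} (hε : 0 < ε) :
    ∃ K : ℝ, ∀ (f : E → ℝ) (G : E → E), HasTameGradient f G ε C L → ∀ h : ℝ, 0 ≤ h → h ≤ 1 →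
      ∀ m : E, heat h (fun x => f x * Real.log (f x)) m - heat h f m * Real.log (heat h f m) ≤
        h / 2 * (‖G m‖ ^ 2 / f m) + K * (h * √h) := by
  let M : ℝ := 1 / (6 * ε ^ 2) + C / (3 * ε ^ 3)
  -- An integrable polynomial envelope of the errors, with f(m) replaced by its lower bound ε so
  -- that it does not depend on f or m.
  let R : E → ℝ := fun z => (2 * C * L * ‖z‖ ^ 3 + L ^ 2 * ‖z‖ ^ 4) / (2 * ε) +
    M * (C ^ 3 * ‖z‖ ^ 3 + 3 * C ^ 2 * L * ‖z‖ ^ 4 + 3 * C * L ^ 2 * ‖z‖ ^ 5 + L ^ 3 * ‖z‖ ^ 6)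
  have hR : Integrable R (stdGaussian E) := by
    have i := fun k => integrable_norm_pow_stdGaussian (E := E) k
    exact ((((i 3).const_mul _).add ((i 4).const_mul _)).div_const _).add
      ((((((i 3).const_mul _).add ((i 4).const_mul _)).add ((i 5).const_mul _)).add
        ((i 6).const_mul _)).const_mul _)
  refine ⟨∫ z, R z ∂(stdGaussian E), fun f G hf h h0 h1' m => ?_⟩
  have hs0 : 0 ≤ √h := Real.sqrt_nonneg h
  have hs1 : √h ≤ 1 := Real.sqrt_le_one.2 h1'
  have hss : √h * √h = h := Real.mul_self_sqrt h0
  have hC0 : 0 ≤ C := (norm_nonneg _).trans (hf.grad_le m)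
  set a := f m with ha
  have ha0 : ε ≤ a := hf.lower m
  have hapos : 0 < a := hε.trans_le ha0
  -- L may be negative when E is trivial, so only products of L with powers of the norm have a known
  -- sign.
  have hL0 : ∀ z : E, 0 ≤ L * ‖z‖ ^ 2 := fun z => (abs_nonneg _).trans (hf.expansion 0 z)
  have hL1 : ∀ z : E, 0 ≤ L * ‖z‖ := by
    intro z
    rcases (norm_nonneg z).eq_or_lt with h | h
    · simp [← h]
    · have := hL0 z
      exact (mul_nonneg_iff_of_pos_right h).1 (by nlinarith)
  have hMC : 0 ≤ M := by positivity
  have point : ∀ z : E, f (m + √h • z) * Real.log (f (m + √h • z) / a) - f (m + √h • z) + a ≤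
      h / (2 * a) * ⟪G m, z⟫ ^ 2 + h * √h * R z := by
    intro z
    set b := f (m + √h • z) with hb
    have hb0 : ε ≤ b := hf.lower _
    have hba : |b - a| ≤ C := by
      rw [abs_le]
      constructor <;> linarith [hf.upper m, hf.upper (m + √h • z)]
    have h1 := mul_log_div_sub_add_le hε ha0 hb0 hba
    have hex := hf.expansion m (√h • z)
    rw [← hb, ← ha, real_inner_smul_right, norm_smul, Real.norm_of_nonneg hs0, mul_pow,
      Real.sq_sqrt h0] at hex
    have hin : |⟪G m, z⟫| ≤ C * ‖z‖ :=
      (abs_real_inner_le_norm _ _).trans (by gcongr; exact hf.grad_le m)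
    have hLN : 0 ≤ L * ‖z‖ ^ 2 := hL0 z
    obtain ⟨hsq, hcube⟩ := sq_and_cube_le_of_expansion h0 h1' hC0 (norm_nonneg z) hLN hin hex
    set g := ⟪G m, z⟫
    set N := ‖z‖
    have hN0 : 0 ≤ N := norm_nonneg z
    have hP : 0 ≤ 2 * C * L * N ^ 3 + L ^ 2 * N ^ 4 := by
      have : 0 ≤ 2 * C * N * (L * N ^ 2) := by positivity
      have : 0 ≤ L ^ 2 * N ^ 4 := by positivity
      nlinarith
    calc b * Real.log (b / a) - b + a ≤ (b - a) ^ 2 / (2 * a) + M * |b - a| ^ 3 := h1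
      _ ≤ (h * g ^ 2 + h * √h * (2 * C * L * N ^ 3 + L ^ 2 * N ^ 4)) / (2 * a) +
          M * (h * √h * (C ^ 3 * N ^ 3 + 3 * C ^ 2 * L * N ^ 4 + 3 * C * L ^ 2 * N ^ 5 +
            L ^ 3 * N ^ 6)) := by gcongr
      _ = h / (2 * a) * g ^ 2 + h * √h * ((2 * C * L * N ^ 3 + L ^ 2 * N ^ 4) / (2 * a)) +
          M * (h * √h * (C ^ 3 * N ^ 3 + 3 * C ^ 2 * L * N ^ 4 + 3 * C * L ^ 2 * N ^ 5 +
            L ^ 3 * N ^ 6)) := by ring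
      _ ≤ h / (2 * a) * g ^ 2 + h * √h * ((2 * C * L * N ^ 3 + L ^ 2 * N ^ 4) / (2 * ε)) +
          M * (h * √h * (C ^ 3 * N ^ 3 + 3 * C ^ 2 * L * N ^ 4 + 3 * C * L ^ 2 * N ^ 5 +
            L ^ 3 * N ^ 6)) := by gcongr
      _ = h / (2 * a) * g ^ 2 + h * √h * R z := by simp only [R]; ring
  have if1 := integrable_shift hf.cont (hf.abs_le hε) m h
  have clog : Continuous fun x => f x * Real.log (f x) :=
    Real.continuous_mul_log.comp hf.cont
  obtain ⟨B, hB⟩ : ∃ B, ∀ x, ‖f x * Real.log (f x)‖ ≤ B := by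
    obtain ⟨B, hB⟩ := (isCompact_Icc (a := ε) (b := C)).exists_bound_of_continuousOn
      Real.continuous_mul_log.continuousOn
    exact ⟨B, fun x => hB (f x) ⟨hf.lower x, hf.upper x⟩⟩
  have if2 := integrable_shift clog hB m h
  have iG : Integrable (fun z : E => ⟪G m, z⟫ ^ 2) (stdGaussian E) := by
    refine ((integrable_norm_pow_stdGaussian (E := E) 2).const_mul (‖G m‖ ^ 2)).mono'
      (Continuous.aestronglyMeasurable (by fun_prop)) (ae_of_all _ fun z => ?_)
    rw [Real.norm_eq_abs, abs_pow, ← mul_pow]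
    gcongr
    exact abs_real_inner_le_norm _ _
  have hsum := integral_mono (μ := stdGaussian E)
    (f := fun z => f (m + √h • z) * Real.log (f (m + √h • z)) - (Real.log a + 1) * f (m + √h • z) + a)
    ((if2.sub (if1.const_mul (Real.log a + 1))).add (integrable_const a))
    ((iG.const_mul (h / (2 * a))).add (hR.const_mul (h * √h))) (fun z => by
      have := point z
      rw [Real.log_div (hε.trans_le (hf.lower _)).ne' hapos.ne'] at this
      simp only [Pi.add_apply]
      linarith)
  rw [integral_add' (iG.const_mul _) (hR.const_mul _), integral_const_mul, integral_const_mul,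
    integral_inner_sq_stdGaussian, integral_add (by exact if2.sub (if1.const_mul _)) (integrable_const a),
    integral_sub if2 (if1.const_mul _), integral_const_mul] at hsum
  simp only [integral_const, probReal_univ, smul_eq_mul, one_mul] at hsum
  change heat h (fun x => f x * Real.log (f x)) m - (Real.log a + 1) * heat h f m + a ≤ _ at hsum
  have hA : 0 < heat h f m := hε.trans_le ((hf.heat hε h).lower m)
  -- The expansion was taken around a = f(m), not around the mean A. Since A log(A/a) ≥ A - a,
  -- replacing a by A can only lower the left side.
  have hvar : heat h f m - a ≤ heat h f m * Real.log (heat h f m) - heat h f m * Real.log a := by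
    have := Real.one_sub_inv_le_log_of_pos (div_pos hA hapos)
    rw [Real.log_div hA.ne' hapos.ne', inv_div] at this
    have := mul_le_mul_of_nonneg_left this hA.le
    have e : heat h f m * (1 - a / heat h f m) = heat h f m - a := by field_simp
    rw [e] at this
    linarith
  have e : h / (2 * a) * ‖G m‖ ^ 2 = h / 2 * (‖G m‖ ^ 2 / a) := by ring
  rw [e] at hsum
  linarith

end Interpolation

/-! ### The logarithmic Sobolev inequality for tame functions, by summing short steps. -/

section Telescoping

variable {E : Type*} [NormedAddCommGroup E] [InnerProductSpace ℝ E] [FiniteDimensional ℝ E]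
  [MeasurableSpace E] [BorelSpace E]

lemma heat_heat {a b : ℝ} (ha : 0 ≤ a) (hb : 0 ≤ b) {f : E → ℝ} {C : ℝ}
    (hf : Continuous f) (hC : ∀ x, |f x| ≤ C) (x : E) :
    heat a (heat b f) x = heat (a + b) f x :=
  integral_stdGaussian_add ha hb hf hC x

lemma heat_one (f : E → ℝ) : heat 1 f 0 = ∫ z, f z ∂(stdGaussian E) := by
  simp [heat]

lemma heat_zero (f : E → ℝ) (x : E) : heat 0 f x = f x := by
  simp [heat]

lemma norm_heat_le {f : E → ℝ} {C : ℝ} (hC : ∀ x, ‖f x‖ ≤ C) (t : ℝ) (x : E) :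
    ‖heat t f x‖ ≤ C := by
  have := norm_integral_le_of_norm_le_const (μ := stdGaussian E)
    (f := fun z => f (x + √t • z)) (C := C) (ae_of_all _ fun z => hC _)
  simpa [heat] using this

namespace HasTameGradient

variable {f : E → ℝ} {G : E → E} {ε C L : ℝ}

lemma continuous_mul_log (h : HasTameGradient f G ε C L) :
    Continuous fun x => f x * Real.log (f x) :=
  Real.continuous_mul_log.comp h.cont

lemma exists_mul_log_le (ε C : ℝ) :
    ∃ B : ℝ, ∀ (f : E → ℝ) (G : E → E) (L : ℝ), HasTameGradient f G ε C L →
      ∀ x, ‖f x * Real.log (f x)‖ ≤ B := by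
  obtain ⟨B, hB⟩ := (isCompact_Icc (a := ε) (b := C)).exists_bound_of_continuousOn
    Real.continuous_mul_log.continuousOn
  exact ⟨B, fun f G L h x => hB (f x) ⟨h.lower x, h.upper x⟩⟩

/-- Apply the short-time inequality to `heat s f` at every point and average with `heat t`. By
convexity of |G|²/f the Fisher term moves inside `heat s`, and the semigroup law leaves the single
time t + s. -/
lemma entropy_heat_le (hε : 0 < ε) {K : ℝ}
    (hK : ∀ (f : E → ℝ) (G : E → E), HasTameGradient f G ε C L → ∀ h : ℝ, 0 ≤ h → h ≤ 1 →
      ∀ m : E, heat h (fun x => f x * Real.log (f x)) m - heat h f m * Real.log (heat h f m) ≤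
        h / 2 * (‖G m‖ ^ 2 / f m) + K * (h * √h))
    (hf : HasTameGradient f G ε C L) {t h s : ℝ} (ht : 0 ≤ t) (h0 : 0 ≤ h) (h1 : h ≤ 1)
    (hs : 0 ≤ s) :
    heat (t + h) (fun x => heat s f x * Real.log (heat s f x)) 0 -
      heat t (fun x => heat (h + s) f x * Real.log (heat (h + s) f x)) 0 ≤
      h / 2 * heat (t + s) (fun x => ‖G x‖ ^ 2 / f x) 0 + K * (h * √h) := by
  obtain ⟨B, hB⟩ := exists_mul_log_le (E := E) ε C
  have f1 := hf.heat hε s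
  have f2 := hf.heat hε (h + s)
  rw [← heat_heat ht h0 f1.continuous_mul_log (hB _ _ _ f1),
    ← heat_heat ht hs (hf.continuous_fisher hε) (hf.fisher_le hε)]
  have c1 := continuous_heat f1.continuous_mul_log (hB _ _ _ f1) h
  have b1 := norm_heat_le (hB _ _ _ f1) h
  have i1 := integrable_shift c1 b1 0 t
  have i2 := integrable_shift f2.continuous_mul_log (hB _ _ _ f2) 0 t
  have c3 := continuous_heat (hf.continuous_fisher hε) (hf.fisher_le hε) s
  have b3 := norm_heat_le (hf.fisher_le hε) s
  have i3 := integrable_shift c3 b3 0 t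
  have := integral_mono (i1.sub i2) ((i3.const_mul (h / 2)).add (integrable_const (K * (h * √h))))
    (fun z => by
      have k1 := hK _ _ f1 h h0 h1 (0 + √t • z)
      have k2 := hf.fisher_heat_le hε s (0 + √t • z)
      have k3 := heat_heat h0 hs hf.cont (hf.abs_le hε) (0 + √t • z)
      rw [k3] at k1
      simp only [Pi.sub_apply, Pi.add_apply]
      have k4 := mul_le_mul_of_nonneg_left k2 (by positivity : 0 ≤ h / 2)
      linarith)
  rw [integral_sub' i1 i2, integral_add' (i3.const_mul _) (integrable_const _),
    integral_const_mul] at this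
  simpa [heat] using this

/-- Logarithmic Sobolev inequality for the Gaussian measure and tame functions. -/
theorem entropy_le (hf : HasTameGradient f G ε C L) (hε : 0 < ε) :
    ∫ z, f z * Real.log (f z) ∂(stdGaussian E) -
      (∫ z, f z ∂(stdGaussian E)) * Real.log (∫ z, f z ∂(stdGaussian E)) ≤
      1 / 2 * ∫ z, ‖G z‖ ^ 2 / f z ∂(stdGaussian E) := by
  obtain ⟨K, hK⟩ := exists_local_entropy_le (E := E) (ε := ε) (C := C) (L := L) hε
  let φ : E → ℝ := fun x => ‖G x‖ ^ 2 / f x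
  have hφc : Continuous φ := hf.continuous_fisher hε
  have hφb : ∀ x, ‖φ x‖ ≤ C ^ 2 / ε := hf.fisher_le hε
  have main : ∀ N : ℕ, ∫ z, f z * Real.log (f z) ∂(stdGaussian E) -
      (∫ z, f z ∂(stdGaussian E)) * Real.log (∫ z, f z ∂(stdGaussian E)) ≤
      1 / 2 * heat (1 - 1 / ((N : ℝ) + 1)) φ 0 + K * √(1 / ((N : ℝ) + 1)) := by
    intro N
    set h : ℝ := 1 / ((N : ℝ) + 1) with hh
    have hN : (0 : ℝ) < (N : ℝ) + 1 := by positivity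
    have h0 : 0 ≤ h := by positivity
    have h1 : h ≤ 1 := by
      rw [hh, div_le_one hN]; linarith [Nat.cast_nonneg (α := ℝ) N]
    have hNh : ((N : ℝ) + 1) * h = 1 := by rw [hh]; field_simp
    -- Interpolates between m log m at k = 0, with m the mean of f, and the mean of f log f at k = N
    -- + 1. Each step has s + t = 1 - h, so all increments share the same Fisher term, and the N + 1
    -- errors K h^{3/2} sum to K √h.
    let A : ℕ → ℝ := fun k => heat (k * h)
      (fun x => heat (1 - k * h) f x * Real.log (heat (1 - k * h) f x)) 0
    have hstep : ∀ k ∈ Finset.range (N + 1), A (k + 1) - A k ≤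
        h / 2 * heat (1 - h) φ 0 + K * (h * √h) := by
      intro k hk
      have hk' : (k : ℝ) ≤ N := by
        exact_mod_cast Nat.lt_succ_iff.1 (Finset.mem_range.1 hk)
      have := hf.entropy_heat_le hε hK (t := k * h) (h := h) (s := 1 - (k + 1) * h) (by positivity) h0 h1
        (by nlinarith)
      rw [show (k : ℝ) * h + h = (k + 1) * h by ring,
        show h + (1 - (k + 1) * h) = 1 - k * h by ring,
        show (k : ℝ) * h + (1 - (k + 1) * h) = 1 - h by ring] at this
      simpa only [A, Nat.cast_add, Nat.cast_one] using this
    have hsum := Finset.sum_le_sum hstep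
    rw [Finset.sum_range_sub, Finset.sum_const, Finset.card_range, nsmul_eq_mul] at hsum
    have e1 : A (N + 1) = ∫ z, f z * Real.log (f z) ∂(stdGaussian E) := by
      simp only [A, Nat.cast_add, Nat.cast_one, hNh, sub_self, heat_zero, heat_one]
    have e0 : A 0 = (∫ z, f z ∂(stdGaussian E)) * Real.log (∫ z, f z ∂(stdGaussian E)) := by
      simp only [A, Nat.cast_zero, zero_mul, sub_zero, heat_zero, heat_one]
    rw [e1, e0] at hsum
    refine hsum.trans (le_of_eq ?_)
    push_cast
    calc ((N : ℝ) + 1) * (h / 2 * heat (1 - h) φ 0 + K * (h * √h))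
        = (((N : ℝ) + 1) * h) * (1 / 2 * heat (1 - h) φ 0 + K * √h) := by ring
      _ = _ := by rw [hNh, one_mul]
  have hlim0 : Tendsto (fun N : ℕ => 1 / ((N : ℝ) + 1)) atTop (𝓝 0) :=
    tendsto_one_div_add_atTop_nhds_zero_nat
  have hcont : Continuous fun t : ℝ => heat t φ 0 := by
    refine continuous_of_dominated (bound := fun _ => C ^ 2 / ε) (fun t => ?_) (fun t => ?_)
      (integrable_const _) (ae_of_all _ fun z => by fun_prop)
    · exact Continuous.aestronglyMeasurable (by fun_prop)
    · exact ae_of_all _ fun z => hφb _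
  have hlim : Tendsto (fun N : ℕ => 1 / 2 * heat (1 - 1 / ((N : ℝ) + 1)) φ 0 +
      K * √(1 / ((N : ℝ) + 1))) atTop (𝓝 (1 / 2 * heat 1 φ 0 + K * √0)) := by
    refine Tendsto.add (Tendsto.const_mul _ ?_) (Tendsto.const_mul _ ?_)
    · have := (hcont.tendsto 1).comp (by simpa using hlim0.const_sub 1 :
        Tendsto (fun N : ℕ => 1 - 1 / ((N : ℝ) + 1)) atTop (𝓝 1))
      exact this
    · exact (Real.continuous_sqrt.tendsto 0).comp hlim0
  have := ge_of_tendsto' hlim main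
  simpa only [heat_one, Real.sqrt_zero, mul_zero, add_zero] using this

end HasTameGradient

end Telescoping

/-! ### Removal of tameness by truncation. -/

section SmoothLSI

variable {E : Type*} [NormedAddCommGroup E] [InnerProductSpace ℝ E] [FiniteDimensional ℝ E]
  [MeasurableSpace E] [BorelSpace E]

lemma continuous_gradient {f : E → ℝ} (hf : ContDiff ℝ 1 f) : Continuous (gradient f) :=
  (InnerProductSpace.toDual ℝ E).symm.continuous.comp (hf.continuous_fderiv one_ne_zero)

lemma norm_gradient (f : E → ℝ) (x : E) : ‖gradient f x‖ = ‖fderiv ℝ f x‖ := by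
  simp [gradient]

lemma inner_gradient_left (f : E → ℝ) (x w : E) : ⟪gradient f x, w⟫ = fderiv ℝ f x w := by
  simp [gradient]

/-- Compact support makes the derivative bounded and Lipschitz; the mean value inequality on the
segment turns the Lipschitz constant into the quadratic expansion bound. -/
lemma exists_hasTameGradient {g : E → ℝ} (hg : ContDiff ℝ 2 g) (hs : HasCompactSupport g)
    (h0 : ∀ x, 0 ≤ g x) {ε : ℝ} :
    ∃ C L, HasTameGradient (fun x => g x + ε) (gradient g) ε C L := by
  have hd : ContDiff ℝ 1 (fderiv ℝ g) := hg.fderiv_right (by norm_num)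
  have hds : HasCompactSupport (fderiv ℝ g) := hs.fderiv ℝ
  obtain ⟨L, hL⟩ := hd.lipschitzWith_of_hasCompactSupport hds one_ne_zero
  obtain ⟨C₁, hC₁⟩ := hs.exists_bound_of_continuous hg.continuous
  obtain ⟨C₂, hC₂⟩ := hds.exists_bound_of_continuous hd.continuous
  refine ⟨max (C₁ + ε) C₂, L, ⟨by have := hg.continuous; fun_prop,
    continuous_gradient (hg.of_le (by norm_num)), fun x => by linarith [h0 x], fun x => ?_,
    fun x => ?_, fun x w => ?_⟩⟩
  · exact le_max_of_le_left (by linarith [(Real.le_norm_self _).trans (hC₁ x)])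
  · exact le_max_of_le_right ((norm_gradient g x).le.trans (hC₂ x))
  · rw [inner_gradient_left]
    have := (convex_segment x (x + w)).norm_image_sub_le_of_norm_hasFDerivWithin_le'
      (f := g) (f' := fderiv ℝ g) (φ := fderiv ℝ g x) (C := L * ‖w‖)
      (fun y _ => (hg.differentiable (by norm_num) y).hasFDerivAt.hasFDerivWithinAt)
      (fun y hy => ?_) (left_mem_segment ℝ _ _) (right_mem_segment ℝ _ _)
    · rw [add_sub_cancel_left, Real.norm_eq_abs] at this
      convert! this using 1
      · ring_nf
      · ring
    · rw [← dist_eq_norm]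
      refine (hL.dist_le_mul y x).trans ?_
      gcongr
      rw [dist_eq_norm]
      have := norm_sub_le_of_mem_segment hy
      simpa using this

lemma fderiv_eq_zero_of_nonneg {f : E → ℝ} (h0 : ∀ x, 0 ≤ f x) {x : E} (hx : f x = 0) :
    fderiv ℝ f x = 0 :=
  IsLocalMin.fderiv_eq_zero (Eventually.of_forall fun y => by simpa [hx] using h0 y)

lemma gradient_eq_zero_of_nonneg {f : E → ℝ} (h0 : ∀ x, 0 ≤ f x) {x : E} (hx : f x = 0) :
    gradient f x = 0 := by
  simp [gradient, fderiv_eq_zero_of_nonneg h0 hx]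

/-- Squaring the cutoff puts a factor χ in the gradient, whose square cancels against the χ² in the
denominator. What remains is Young's inequality with parameter δ. -/
lemma fisher_cutoff_le {f χ : E → ℝ} (hf : Differentiable ℝ f) (hχ : Differentiable ℝ χ)
    (h0 : ∀ x, 0 ≤ f x) (hχ0 : ∀ x, 0 ≤ χ x) (hχ1 : ∀ x, χ x ≤ 1) {B δ ε : ℝ}
    (hB : ∀ x, ‖gradient χ x‖ ≤ B) (hδ : 0 < δ) (hε : 0 < ε) (x : E) :
    ‖gradient (fun y => χ y ^ 2 * f y) x‖ ^ 2 / (χ x ^ 2 * f x + ε) ≤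
      (1 + δ) * (‖gradient f x‖ ^ 2 / f x) + (1 + 1 / δ) * (4 * B ^ 2) * f x := by
  have hgrad : gradient (fun y => χ y ^ 2 * f y) x =
      χ x • (χ x • gradient f x + (2 * f x) • gradient χ x) := by
    have h1 : HasFDerivAt (fun y => χ y ^ 2 * f y) _ x :=
      ((hχ x).hasFDerivAt.pow 2).mul (hf x).hasFDerivAt
    simp only [gradient, h1.fderiv, map_add, map_smul]
    simp only [smul_add, smul_smul]
    congr 1
    · congr 1; ring
    · congr 1; push_cast; ring
  rcases (h0 x).eq_or_lt with hx | hx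
  · have := gradient_eq_zero_of_nonneg h0 hx.symm
    rw [hgrad, this, ← hx]
    simp
  · rw [hgrad, norm_smul, mul_pow, Real.norm_of_nonneg (hχ0 x)]
    set w := χ x • gradient f x + (2 * f x) • gradient χ x with hw
    have hden : 0 < χ x ^ 2 * f x + ε := by positivity
    have s1 : χ x ^ 2 * ‖w‖ ^ 2 / (χ x ^ 2 * f x + ε) ≤ ‖w‖ ^ 2 / f x := by
      rw [div_le_div_iff₀ hden hx]
      have : 0 ≤ ‖w‖ ^ 2 * ε := by positivity
      nlinarith
    have s2 : ‖w‖ ≤ ‖gradient f x‖ + 2 * f x * B := by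
      refine (norm_add_le _ _).trans ?_
      rw [norm_smul, norm_smul, Real.norm_of_nonneg (hχ0 x),
        Real.norm_of_nonneg (by positivity : 0 ≤ 2 * f x)]
      gcongr
      · exact mul_le_of_le_one_left (norm_nonneg _) (hχ1 x)
      · exact hB x
    refine s1.trans ?_
    rw [div_le_iff₀ hx]
    have s3 : ‖w‖ ^ 2 ≤ (‖gradient f x‖ + 2 * f x * B) ^ 2 := by gcongr
    refine s3.trans ?_
    have e : ((1 + δ) * (‖gradient f x‖ ^ 2 / f x) + (1 + 1 / δ) * (4 * B ^ 2) * f x) * f x =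
        (1 + δ) * ‖gradient f x‖ ^ 2 + (1 + 1 / δ) * (2 * f x * B) ^ 2 := by
      field_simp
      ring
    rw [e]
    have : 0 ≤ (δ * ‖gradient f x‖ - 2 * f x * B) ^ 2 / δ := by positivity
    have e2 : (δ * ‖gradient f x‖ - 2 * f x * B) ^ 2 / δ = δ * ‖gradient f x‖ ^ 2 -
        2 * ‖gradient f x‖ * (2 * f x * B) + 1 / δ * (2 * f x * B) ^ 2 := by
      field_simp
      ring
    rw [e2] at this
    nlinarith

lemma exists_cutoff : ∃ B : ℝ, ∀ R : ℝ, 0 < R → ∃ χ : E → ℝ, ContDiff ℝ 2 χ ∧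
    HasCompactSupport χ ∧ (∀ x, 0 ≤ χ x) ∧ (∀ x, χ x ≤ 1) ∧ (∀ x, ‖x‖ ≤ R → χ x = 1) ∧
    ∀ x, ‖gradient χ x‖ ≤ B / R := by
  let φ : ContDiffBump (0 : E) := ⟨1, 2, one_pos, one_lt_two⟩
  have hφ : ContDiff ℝ 2 (φ : E → ℝ) := φ.contDiff
  obtain ⟨B, hB⟩ := (φ.hasCompactSupport.fderiv ℝ).exists_bound_of_continuous
    (hφ.continuous_fderiv (by norm_num))
  refine ⟨B, fun R hR => ⟨fun x => φ (R⁻¹ • x), hφ.comp (contDiff_const_smul _),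
    φ.hasCompactSupport.comp_smul (inv_ne_zero hR.ne'), fun x => φ.nonneg, fun x => φ.le_one,
    fun x hx => φ.one_of_mem_closedBall ?_, fun x => ?_⟩⟩
  · rw [mem_closedBall_zero_iff, norm_smul, norm_inv, Real.norm_of_nonneg hR.le,
      inv_mul_le_iff₀ hR]
    simpa [φ] using hx
  · rw [norm_gradient]
    have h1 : HasFDerivAt (fun x : E => φ (R⁻¹ • x)) _ x :=
      ((hφ.differentiable (by norm_num) (R⁻¹ • x)).hasFDerivAt).comp x
        ((hasFDerivAt_id x).const_smul R⁻¹)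
    rw [h1.fderiv, ContinuousLinearMap.comp_smul, norm_smul, norm_inv, Real.norm_of_nonneg hR.le,
      ContinuousLinearMap.comp_id, div_eq_inv_mul]
    gcongr
    exact hB _

/-- Logarithmic Sobolev inequality for the Gaussian measure and smooth probability densities. -/
theorem integral_klFun_le {f : E → ℝ} (hf : ContDiff ℝ 2 f) (h0 : ∀ x, 0 ≤ f x)
    (hfi : Integrable f (stdGaussian E)) (hf1 : ∫ x, f x ∂(stdGaussian E) = 1)
    (hI : Integrable (fun x => ‖gradient f x‖ ^ 2 / f x) (stdGaussian E)) :
    Integrable (fun x => klFun (f x)) (stdGaussian E) ∧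
      ∫ x, klFun (f x) ∂(stdGaussian E) ≤ 1 / 2 * ∫ x, ‖gradient f x‖ ^ 2 / f x ∂(stdGaussian E) := by
  obtain ⟨B, hB⟩ := exists_cutoff (E := E)
  choose! χ hχ using hB
  let R : ℕ → ℝ := fun k => (k : ℝ) + 1
  have hR : ∀ k, 0 < R k := fun k => by positivity
  have hR0 : Tendsto (fun k => 1 / R k) atTop (𝓝 0) := tendsto_one_div_add_atTop_nhds_zero_nat
  -- The tame approximations are g k + 1/R k: one parameter R controls the cutoff radius, the lower
  -- bound and the δ of `fisher_cutoff_le`.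
  let g : ℕ → E → ℝ := fun k x => χ (R k) x ^ 2 * f x
  have hg2 : ∀ k, ContDiff ℝ 2 (g k) := fun k => ((hχ _ (hR k)).1.pow 2).mul hf
  have hgs : ∀ k, HasCompactSupport (g k) := fun k => by
    have : HasCompactSupport (fun x => χ (R k) x ^ 2) :=
      (hχ _ (hR k)).2.1.comp_left (g := fun t : ℝ => t ^ 2) (by norm_num)
    exact this.mul_right
  have hg0 : ∀ k x, 0 ≤ g k x := fun k x => mul_nonneg (sq_nonneg _) (h0 x)
  have hgf : ∀ k x, g k x ≤ f x := fun k x => by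
    obtain ⟨-, -, a, b, -⟩ := hχ _ (hR k)
    exact mul_le_of_le_one_left (h0 x) (pow_le_one₀ (a x) (b x))
  have hglim : ∀ x, Tendsto (fun k => g k x) atTop (𝓝 (f x)) := fun x => by
    refine tendsto_const_nhds.congr' ?_
    filter_upwards [eventually_ge_atTop ⌈‖x‖⌉₊] with k hk
    have : χ (R k) x = 1 := (hχ _ (hR k)).2.2.2.2.1 x
      (((Nat.le_ceil _).trans (Nat.cast_le.2 hk)).trans (by simp [R]))
    simp [g, this]
  set I : ℝ := ∫ x, ‖gradient f x‖ ^ 2 / f x ∂(stdGaussian E) with hIdef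
  have hgi : ∀ k, Integrable (g k) (stdGaussian E) := fun k =>
    hfi.mono' (hg2 k).continuous.aestronglyMeasurable
      (ae_of_all _ fun x => by rw [Real.norm_of_nonneg (hg0 k x)]; exact hgf k x)
  let m : ℕ → ℝ := fun k => ∫ x, (g k x + 1 / R k) ∂(stdGaussian E)
  have hm : Tendsto m atTop (𝓝 1) := by
    have e : ∀ k, m k = ∫ x, g k x ∂(stdGaussian E) + 1 / R k := fun k => by
      simp only [m]
      rw [integral_add (hgi k) (integrable_const _)]
      simp
    have : Tendsto (fun k => ∫ x, g k x ∂(stdGaussian E)) atTop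
        (𝓝 (∫ x, f x ∂(stdGaussian E))) := by
      refine tendsto_integral_of_dominated_convergence f
        (fun k => (hg2 k).continuous.aestronglyMeasurable) hfi (fun k => ae_of_all _ fun x => ?_)
        (ae_of_all _ hglim)
      rw [Real.norm_of_nonneg (hg0 k x)]; exact hgf k x
    rw [hf1] at this
    simpa [funext e] using this.add hR0
  -- With δ = 1/R the gradient of the cutoff costs (1 + R) · 4(B/R)², which vanishes in the limit.
  -- The approximations have mass m rather than 1, and the integral of `klFun` exceeds the entropy
  -- by `klFun m`.
  let b : ℕ → ℝ := fun k => 1 / 2 * ((1 + 1 / R k) * I + (1 / R k + (1 / R k) ^ 2) * (4 * B ^ 2)) +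
    klFun (m k)
  have hb : Tendsto b atTop (𝓝 (1 / 2 * I)) := by
    have h1 : Tendsto (fun k => klFun (m k)) atTop (𝓝 0) := by
      have := (continuous_klFun.tendsto 1).comp hm
      rwa [klFun_one] at this
    have h2 := ((((hR0.const_add 1).mul_const I).add
      ((hR0.add (hR0.pow 2)).mul_const (4 * B ^ 2))).const_mul (1 / 2)).add h1
    simpa [b] using h2
  have hEnt : ∀ k, Integrable (fun x => klFun (g k x + 1 / R k)) (stdGaussian E) ∧
      ∫ x, klFun (g k x + 1 / R k) ∂(stdGaussian E) ≤ b k := by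
    intro k
    have hε : 0 < 1 / R k := one_div_pos.2 (hR k)
    obtain ⟨C, L, ht⟩ := exists_hasTameGradient (hg2 k) (hgs k) (hg0 k) (ε := 1 / R k)
    obtain ⟨B', hB'⟩ := HasTameGradient.exists_mul_log_le (E := E) (1 / R k) C
    have i1 : Integrable (fun x => (g k x + 1 / R k) * Real.log (g k x + 1 / R k))
        (stdGaussian E) :=
      Integrable.of_bound ht.continuous_mul_log.aestronglyMeasurable B'
        (ae_of_all _ fun x => hB' _ _ _ ht x)
    have i2 : Integrable (fun x => g k x + 1 / R k) (stdGaussian E) :=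
      (hgi k).add (integrable_const _)
    have hle := ht.entropy_le hε
    have hfish : ∫ z, ‖gradient (g k) z‖ ^ 2 / (g k z + 1 / R k) ∂(stdGaussian E) ≤
        (1 + 1 / R k) * I + (1 / R k + (1 / R k) ^ 2) * (4 * B ^ 2) := by
      have i3 : Integrable (fun z => ‖gradient (g k) z‖ ^ 2 / (g k z + 1 / R k))
          (stdGaussian E) :=
        Integrable.of_bound (ht.continuous_fisher hε).aestronglyMeasurable _
          (ae_of_all _ fun x => ht.fisher_le hε x)
      obtain ⟨c1, -, c3, c4, -, c6⟩ := hχ _ (hR k)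
      have := integral_mono i3 ((hI.const_mul (1 + 1 / R k)).add
        (hfi.const_mul ((1 + 1 / (1 / R k)) * (4 * (B / R k) ^ 2))))
        (fun x => fisher_cutoff_le (hf.differentiable (by norm_num))
          (c1.differentiable (by norm_num)) h0 c3 c4 c6 hε hε x)
      rw [integral_add' (hI.const_mul _) (hfi.const_mul _), integral_const_mul,
        integral_const_mul, hf1, mul_one] at this
      refine this.trans (le_of_eq ?_)
      have := (hR k).ne'
      rw [← hIdef]
      field_simp
      ring
    refine ⟨?_, ?_⟩
    · simp only [klFun]
      exact (i1.add (integrable_const 1)).sub i2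
    · simp only [klFun]
      rw [integral_sub (by exact i1.add (integrable_const 1)) i2, integral_add i1 (integrable_const 1)]
      simp only [b, klFun]
      change _ + _ - m k ≤ _
      change _ - m k * Real.log (m k) ≤ _ at hle
      simp only [integral_const, probReal_univ, smul_eq_mul, one_mul]
      linarith
  have hcont : ∀ k, Continuous fun x => klFun (g k x + 1 / R k) := fun k =>
    continuous_klFun.comp ((hg2 k).continuous.add continuous_const)
  have hkl0 : ∀ x, 0 ≤ klFun (f x) := fun x => klFun_nonneg (h0 x)
  -- `klFun` is nonnegative, unlike t log t, so Fatou applies and gives integrability and the bound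
  -- together.
  have hfatou : ∫⁻ x, ENNReal.ofReal (klFun (f x)) ∂(stdGaussian E) ≤ ENNReal.ofReal (1 / 2 * I) := by
    calc ∫⁻ x, ENNReal.ofReal (klFun (f x)) ∂(stdGaussian E)
        = ∫⁻ x, liminf (fun k => ENNReal.ofReal (klFun (g k x + 1 / R k))) atTop
            ∂(stdGaussian E) := by
          refine lintegral_congr fun x => (Tendsto.liminf_eq ?_).symm
          refine (ENNReal.continuous_ofReal.tendsto _).comp ((continuous_klFun.tendsto _).comp ?_)
          simpa using (hglim x).add hR0
      _ ≤ liminf (fun k => ∫⁻ x, ENNReal.ofReal (klFun (g k x + 1 / R k)) ∂(stdGaussian E))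
            atTop := lintegral_liminf_le fun k => (hcont k).measurable.ennreal_ofReal
      _ ≤ liminf (fun k => ENNReal.ofReal (b k)) atTop := by
          refine liminf_le_liminf (Eventually.of_forall fun k => ?_)
          rw [← ofReal_integral_eq_lintegral_ofReal (hEnt k).1 (ae_of_all _ fun x =>
            klFun_nonneg (add_nonneg (hg0 k x) (one_div_pos.2 (hR k)).le))]
          exact ENNReal.ofReal_le_ofReal (hEnt k).2
      _ = ENNReal.ofReal (1 / 2 * I) :=
          ((ENNReal.continuous_ofReal.tendsto _).comp hb).liminf_eq
  have hmeas : AEStronglyMeasurable (fun x => klFun (f x)) (stdGaussian E) :=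
    (continuous_klFun.comp hf.continuous).aestronglyMeasurable
  have hI0 : 0 ≤ I := integral_nonneg fun x => div_nonneg (sq_nonneg _) (h0 x)
  refine ⟨⟨hmeas, ?_⟩, ?_⟩
  · rw [hasFiniteIntegral_iff_ofReal (ae_of_all _ hkl0)]
    exact hfatou.trans_lt ENNReal.ofReal_lt_top
  · rw [integral_eq_lintegral_of_nonneg_ae (ae_of_all _ hkl0) hmeas]
    exact ENNReal.toReal_le_of_le_ofReal (by positivity) hfatou

end SmoothLSI

/-! ### Gaussian densities and integration by parts. -/

section GaussDensity

variable {n : ℕ}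

local notation "𝔼" n => EuclideanSpace ℝ (Fin n)

lemma gaussDensity_pos (x : 𝔼 n) : 0 < gaussDensity n x := by
  unfold gaussDensity; positivity

lemma log_gaussDensity (x : 𝔼 n) :
    Real.log (gaussDensity n x) = -(n / 2 * Real.log (2 * Real.pi)) - ‖x‖ ^ 2 / 2 := by
  have : 0 < (2 * Real.pi) ^ ((n : ℝ) / 2) := by positivity
  rw [gaussDensity, Real.log_mul (by positivity) (Real.exp_pos _).ne', Real.log_exp, Real.log_inv,
    Real.log_rpow (by positivity)]
  ring

lemma contDiff_gaussDensity {k : WithTop ℕ∞} : ContDiff ℝ k (gaussDensity n) := by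
  unfold gaussDensity
  exact contDiff_const.mul (Real.contDiff_exp.comp (((contDiff_norm_sq ℝ).neg).div_const 2))

lemma continuous_gaussDensity : Continuous (gaussDensity n) :=
  (contDiff_gaussDensity (k := 0)).continuous

lemma gradient_gaussDensity (x : 𝔼 n) : gradient (gaussDensity n) x = -(gaussDensity n x • x) := by
  have h1 : HasFDerivAt (fun x : 𝔼 n => -‖x‖ ^ 2 / 2) (-innerSL ℝ x) x := by
    have := ((hasStrictFDerivAt_norm_sq x).hasFDerivAt.neg).mul_const (2⁻¹ : ℝ)
    refine (this.congr_fderiv ?_).congr_of_eventuallyEq (Eventually.of_forall fun y => ?_)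
    · ext y; simp
    · simp [div_eq_mul_inv]
  have h2 := (h1.exp).const_mul (((2 * Real.pi) ^ ((n : ℝ) / 2))⁻¹)
  have h3 : HasFDerivAt (gaussDensity n) _ x := h2
  refine ext_inner_right ℝ fun w => ?_
  rw [inner_gradient_left, h3.fderiv]
  simp [gaussDensity, inner_smul_left]
  ring

lemma integrable_stdGaussian_iff {f : (𝔼 n) → ℝ} :
    Integrable f (stdGaussian (𝔼 n)) ↔ Integrable (fun x => gaussDensity n x * f x) := by
  rw [stdGaussian_eq_withDensity, integrable_withDensity_iff_integrable_smul'
    (by have := continuous_gaussDensity (n := n); fun_prop) (by simp)]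
  simp only [ENNReal.toReal_ofReal (gaussDensity_pos _).le, smul_eq_mul]

lemma integral_stdGaussian_eq (f : (𝔼 n) → ℝ) :
    ∫ x, f x ∂(stdGaussian (𝔼 n)) = ∫ x, gaussDensity n x * f x := by
  rw [stdGaussian_eq_withDensity, integral_withDensity_eq_integral_toReal_smul
    (by have := continuous_gaussDensity (n := n); fun_prop) (by simp)]
  simp only [ENNReal.toReal_ofReal (gaussDensity_pos _).le, smul_eq_mul]

lemma integrable_gaussDensity : Integrable (gaussDensity n) := by
  have := (integrable_stdGaussian_iff (n := n)).1 (integrable_const 1)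
  simpa using this

lemma integral_gaussDensity : ∫ x, gaussDensity n x = 1 := by
  have := integral_stdGaussian_eq (n := n) (fun _ => 1)
  simpa using this.symm

/-- The divergence theorem for the field g(x)φ(x)x, carried out one coordinate at a time. The weight
φ allows truncation before the second moment is known to be finite. -/
lemma integral_mul_fderiv_self {φ g : (𝔼 n) → ℝ} (hφ : ContDiff ℝ 1 φ) (hg : ContDiff ℝ 1 g)
    (i1 : Integrable fun x => φ x * g x)
    (i2 : Integrable fun x => ‖fderiv ℝ φ x‖ * ‖x‖ * g x)
    (i3 : Integrable fun x => φ x * ‖x‖ * ‖fderiv ℝ g x‖)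
    (i4 : Integrable fun x => φ x * ‖x‖ * g x) :
    ∫ x, φ x * fderiv ℝ g x x = -∫ x, (n * φ x + fderiv ℝ φ x x) * g x := by
  let e : Fin n → 𝔼 n := fun i => EuclideanSpace.single i 1
  have he : ∀ i, ‖e i‖ = 1 := fun i => by simp [e]
  have hxi : ∀ (x : 𝔼 n) i, |x i| ≤ ‖x‖ := fun x i => PiLp.norm_apply_le x i
  have hx : ∀ x : 𝔼 n, x = ∑ i, x i • e i := fun x => by
    ext j
    simp [e, Finset.sum_apply, Pi.single_apply]
  have hsum : ∀ (T : (𝔼 n) →L[ℝ] ℝ) (x : 𝔼 n), T x = ∑ i, x i * T (e i) := fun T x => by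
    conv_lhs => rw [hx x]
    simp
  have cφ : Continuous fun x => fderiv ℝ φ x := hφ.continuous_fderiv one_ne_zero
  have cg : Continuous fun x => fderiv ℝ g x := hg.continuous_fderiv one_ne_zero
  have cφ0 := hφ.continuous
  have cg0 := hg.continuous
  have dprod : ∀ i x, HasFDerivAt (fun x : 𝔼 n => φ x * x i)
      (φ x • (EuclideanSpace.proj i : (𝔼 n) →L[ℝ] ℝ) + x i • fderiv ℝ φ x) x := fun i x =>
    (hφ.differentiable one_ne_zero x).hasFDerivAt.mul
      (EuclideanSpace.proj i : (𝔼 n) →L[ℝ] ℝ).hasFDerivAt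
  have ddir : ∀ i x, fderiv ℝ (fun x : 𝔼 n => φ x * x i) x (e i) =
      φ x + x i * fderiv ℝ φ x (e i) := fun i x => by
    rw [(dprod i x).fderiv]; simp [e]
  have a1 : ∀ i, Integrable fun x : 𝔼 n => φ x * x i * fderiv ℝ g x (e i) := fun i => by
    refine i3.mono (Continuous.aestronglyMeasurable (by fun_prop)) (ae_of_all _ fun x => ?_)
    simp only [norm_mul, norm_norm]
    gcongr
    · exact hxi x i
    · simpa [he] using (fderiv ℝ g x).le_opNorm (e i)
  have a2' : ∀ i, Integrable fun x : 𝔼 n => x i * fderiv ℝ φ x (e i) * g x := fun i => by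
    refine i2.mono (Continuous.aestronglyMeasurable (by fun_prop)) (ae_of_all _ fun x => ?_)
    simp only [norm_mul, norm_norm]
    rw [mul_comm ‖x i‖]
    gcongr
    · simpa [he] using (fderiv ℝ φ x).le_opNorm (e i)
    · exact hxi x i
  have a2 : ∀ i, Integrable fun x : 𝔼 n => (φ x + x i * fderiv ℝ φ x (e i)) * g x := fun i => by
    refine (i1.add (a2' i)).congr (ae_of_all _ fun x => ?_)
    simp only [Pi.add_apply]; ring
  have a3 : ∀ i, Integrable fun x : 𝔼 n => φ x * x i * g x := fun i => by
    refine i4.mono (Continuous.aestronglyMeasurable (by fun_prop)) (ae_of_all _ fun x => ?_)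
    simp only [norm_mul, norm_norm]
    gcongr
    exact hxi x i
  have parts : ∀ i, ∫ x : 𝔼 n, φ x * x i * fderiv ℝ g x (e i) =
      -∫ x : 𝔼 n, (φ x + x i * fderiv ℝ φ x (e i)) * g x := fun i => by
    have := integral_mul_fderiv_eq_neg_fderiv_mul_of_integrable (μ := volume)
      (f := fun x : 𝔼 n => φ x * x i) (g := g) (v := e i)
      (by simpa only [ddir] using a2 i) (a1 i) (a3 i)
      (fun x _ => (dprod i x).differentiableAt) (fun x _ => hg.differentiable one_ne_zero x)
    simpa only [ddir] using this
  calc ∫ x, φ x * fderiv ℝ g x x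
      = ∫ x : 𝔼 n, ∑ i, φ x * x i * fderiv ℝ g x (e i) := by
        refine integral_congr_ae (ae_of_all _ fun x => ?_)
        simp only
        rw [hsum (fderiv ℝ g x) x, Finset.mul_sum]
        exact Finset.sum_congr rfl fun i _ => by ring
    _ = ∑ i, -∫ x : 𝔼 n, (φ x + x i * fderiv ℝ φ x (e i)) * g x := by
        rw [integral_finsetSum _ fun i _ => a1 i]
        exact Finset.sum_congr rfl fun i _ => parts i
    _ = -∫ x, ∑ i, (φ x + x i * fderiv ℝ φ x (e i)) * g x := by
        rw [Finset.sum_neg_distrib, integral_finsetSum _ fun i _ => a2 i]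
    _ = _ := by
        congr 1
        refine integral_congr_ae (ae_of_all _ fun x => ?_)
        simp only
        rw [← Finset.sum_mul, Finset.sum_add_distrib, ← hsum (fderiv ℝ φ x) x]
        simp

end GaussDensity

/-! ### From the Gaussian to the Euclidean logarithmic Sobolev inequality. -/

section EuclideanLSI

variable {n : ℕ}

local notation "𝔼" n => EuclideanSpace ℝ (Fin n)

/-- `|∇g| |x|` is dominated by the Fisher information density and the second moment density. -/
lemma norm_gradient_mul_le {g : (𝔼 n) → ℝ} (h0 : ∀ x, 0 ≤ g x) (x : 𝔼 n) :
    ‖gradient g x‖ * ‖x‖ ≤ 1 / 2 * (‖gradient g x‖ ^ 2 / g x + ‖x‖ ^ 2 * g x) := by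
  rcases (h0 x).eq_or_lt with hx | hx
  · rw [gradient_eq_zero_of_nonneg h0 hx.symm, ← hx]; simp
  · have : 0 ≤ (‖gradient g x‖ - ‖x‖ * g x) ^ 2 / g x := by positivity
    have e : (‖gradient g x‖ - ‖x‖ * g x) ^ 2 / g x =
      ‖gradient g x‖ ^ 2 / g x + ‖x‖ ^ 2 * g x - 2 * (‖gradient g x‖ * ‖x‖) := by
      field_simp
      ring
    linarith

/-- The standing integrability assumptions on an unnormalized density. -/
structure IsFisherDensity (g : (𝔼 n) → ℝ) : Prop where
  contDiff : ContDiff ℝ 2 g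
  nonneg : ∀ x, 0 ≤ g x
  integrable : Integrable g
  moment : Integrable fun x => ‖x‖ ^ 2 * g x
  fisher : Integrable fun x => ‖gradient g x‖ ^ 2 / g x

namespace IsFisherDensity

variable {g : (𝔼 n) → ℝ}

lemma integrable_inner_gradient (h : IsFisherDensity g) :
    Integrable fun x => ⟪gradient g x, x⟫ := by
  refine ((h.fisher.add h.moment).const_mul (1 / 2)).mono' ?_ (ae_of_all _ fun x => ?_)
  · have := continuous_gradient (h.contDiff.of_le one_le_two)
    exact Continuous.aestronglyMeasurable (by fun_prop)
  · exact (norm_inner_le_norm _ _).trans (norm_gradient_mul_le h.nonneg x)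

lemma integral_inner_gradient (h : IsFisherDensity g) :
    ∫ x, ⟪gradient g x, x⟫ = -(n * ∫ x, g x) := by
  have hc := h.contDiff.continuous
  have hc' : Continuous (fderiv ℝ g) := h.contDiff.continuous_fderiv (by norm_num)
  have := integral_mul_fderiv_self (φ := fun _ => 1) (g := g) contDiff_const
    (h.contDiff.of_le one_le_two) (by simpa using h.integrable) (by simp) ?_ ?_
  · simpa [inner_gradient_left, integral_const_mul] using this
  · refine ((h.fisher.add h.moment).const_mul (1 / 2)).mono'
      (Continuous.aestronglyMeasurable (by fun_prop)) (ae_of_all _ fun x => ?_)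
    rw [one_mul, ← norm_gradient, norm_mul, norm_norm, norm_norm, mul_comm]
    exact norm_gradient_mul_le h.nonneg x
  · refine (h.integrable.add h.moment).mono'
      (Continuous.aestronglyMeasurable (by fun_prop)) (ae_of_all _ fun x => ?_)
    rw [one_mul, norm_mul, norm_norm, Real.norm_of_nonneg (h.nonneg x)]
    simp only [Pi.add_apply]
    nlinarith [h.nonneg x, mul_nonneg (sq_nonneg (‖x‖ - 1)) (h.nonneg x),
      mul_nonneg (sq_nonneg ‖x‖) (h.nonneg x)]

lemma norm_gradient_add_sq_div (h : IsFisherDensity g) (x : 𝔼 n) :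
    ‖gradient g x + g x • x‖ ^ 2 / g x =
      ‖gradient g x‖ ^ 2 / g x + 2 * ⟪gradient g x, x⟫ + ‖x‖ ^ 2 * g x := by
  rcases (h.nonneg x).eq_or_lt with hx | hx
  · rw [gradient_eq_zero_of_nonneg h.nonneg hx.symm, ← hx]; simp
  · rw [norm_add_sq_real, norm_smul, inner_smul_right, Real.norm_of_nonneg hx.le]
    field_simp

lemma integrable_relFisher (h : IsFisherDensity g) :
    Integrable fun x => ‖gradient g x + g x • x‖ ^ 2 / g x := by
  simp only [h.norm_gradient_add_sq_div]
  exact (h.fisher.add (h.integrable_inner_gradient.const_mul 2)).add h.moment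

lemma integral_relFisher (h : IsFisherDensity g) :
    ∫ x, ‖gradient g x + g x • x‖ ^ 2 / g x =
      (∫ x, ‖gradient g x‖ ^ 2 / g x) - 2 * n * (∫ x, g x) + ∫ x, ‖x‖ ^ 2 * g x := by
  simp only [h.norm_gradient_add_sq_div]
  rw [integral_add (by exact h.fisher.add (h.integrable_inner_gradient.const_mul 2)) h.moment,
    integral_add h.fisher (h.integrable_inner_gradient.const_mul 2), integral_const_mul,
    h.integral_inner_gradient]
  ring

end IsFisherDensity

lemma gradient_div_gaussDensity {g : (𝔼 n) → ℝ} (hg : Differentiable ℝ g) (x : 𝔼 n) :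
    gradient (fun y => g y / gaussDensity n y) x =
      (gaussDensity n x)⁻¹ • (gradient g x + g x • x) := by
  have hq := gaussDensity_pos x
  have h1 : HasFDerivAt (gaussDensity n) (fderiv ℝ (gaussDensity n) x) x :=
    (contDiff_gaussDensity.differentiable one_ne_zero x).hasFDerivAt
  have h2 := (hg x).hasFDerivAt.mul ((hasDerivAt_inv hq.ne').comp_hasFDerivAt x h1)
  refine ext_inner_right ℝ fun w => ?_
  rw [inner_gradient_left]
  have h4 := h2.congr_of_eventuallyEq (f₁ := fun y => g y / gaussDensity n y)
    (Eventually.of_forall fun y => div_eq_mul_inv _ _)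
  rw [h4.fderiv]
  have h3 := inner_gradient_left (gaussDensity n) x w
  rw [gradient_gaussDensity, inner_neg_left, real_inner_smul_left] at h3
  simp only [add_apply, smul_apply, Function.comp_apply, smul_eq_mul, ← h3, real_inner_smul_left,
    inner_add_left, inner_gradient_left]
  field_simp
  ring

lemma klFun_div_gaussDensity {g : (𝔼 n) → ℝ} (x : 𝔼 n) :
    gaussDensity n x * klFun (g x / gaussDensity n x) =
      g x * Real.log (g x) + (n / 2 * Real.log (2 * Real.pi)) * g x + 1 / 2 * (‖x‖ ^ 2 * g x) +
        gaussDensity n x - g x := by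
  have hq := gaussDensity_pos x
  rcases eq_or_ne (g x) 0 with hx | hx
  · simp [hx, klFun]
  · rw [klFun, Real.log_div hx hq.ne', log_gaussDensity]
    field_simp
    ring

namespace IsFisherDensity

variable {g : (𝔼 n) → ℝ}

/-- Logarithmic Sobolev inequality with respect to the standard Gaussian, for densities. -/
theorem lsi (h : IsFisherDensity g) (h1 : ∫ x, g x = 1) :
    (Integrable fun x => g x * Real.log (g x)) ∧
    2 * ∫ x, g x * Real.log (g x) ≤
      (∫ x, ‖gradient g x‖ ^ 2 / g x) - (2 * n + n * Real.log (2 * Real.pi)) := by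
  -- For the density relative to the Gaussian, the entropy and the Fisher term contain the second
  -- moment with matching coefficients. It cancels, which leaves an inequality suited to dilation.
  let f : (𝔼 n) → ℝ := fun x => g x / gaussDensity n x
  have hq := fun x : 𝔼 n => (gaussDensity_pos x)
  have hf : ContDiff ℝ 2 f := h.contDiff.div contDiff_gaussDensity fun x => (hq x).ne'
  have hf0 : ∀ x, 0 ≤ f x := fun x => div_nonneg (h.nonneg x) (hq x).le
  have hqf : ∀ x, gaussDensity n x * f x = g x := fun x => mul_div_cancel₀ _ (hq x).ne'
  have hfi : Integrable f (stdGaussian (𝔼 n)) := by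
    rw [integrable_stdGaussian_iff]; simpa only [hqf] using h.integrable
  have hf1 : ∫ x, f x ∂(stdGaussian (𝔼 n)) = 1 := by
    rw [integral_stdGaussian_eq]; simpa only [hqf] using h1
  have hI : ∀ x, gaussDensity n x * (‖gradient f x‖ ^ 2 / f x) =
      ‖gradient g x + g x • x‖ ^ 2 / g x := fun x => by
    have := hq x
    simp only [f]
    rw [gradient_div_gaussDensity (h.contDiff.differentiable (by norm_num)), norm_smul, norm_inv,
      Real.norm_of_nonneg this.le]
    rcases eq_or_ne (g x) 0 with hx | hx
    · simp [hx]
    · field_simp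
  obtain ⟨k1, k2⟩ := integral_klFun_le hf hf0 hfi hf1
    (by rw [integrable_stdGaussian_iff]; simpa only [hI] using h.integrable_relFisher)
  rw [integrable_stdGaussian_iff] at k1
  rw [integral_stdGaussian_eq, integral_stdGaussian_eq] at k2
  simp only [hI] at k2
  rw [h.integral_relFisher, h1] at k2
  simp only [f, klFun_div_gaussDensity] at k1 k2
  have hlog : Integrable fun x => g x * Real.log (g x) := by
    refine ((((k1.add h.integrable).sub integrable_gaussDensity).sub
      (h.moment.const_mul (1 / 2))).sub
      (h.integrable.const_mul (n / 2 * Real.log (2 * Real.pi)))).congr (ae_of_all _ fun x => ?_)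
    simp only [Pi.add_apply, Pi.sub_apply]
    ring
  refine ⟨hlog, ?_⟩
  have j1 := hlog.add (h.integrable.const_mul (n / 2 * Real.log (2 * Real.pi)))
  have j2 := j1.add (h.moment.const_mul (1 / 2))
  have j3 := j2.add (integrable_gaussDensity (n := n))
  rw [integral_sub (by exact j3) h.integrable, integral_add (by exact j2) integrable_gaussDensity,
    integral_add (by exact j1) (h.moment.const_mul (1 / 2)),
    integral_add hlog (h.integrable.const_mul _), integral_const_mul, integral_const_mul,
    h1, integral_gaussDensity] at k2
  linarith

lemma gradient_comp_smul {g : (𝔼 n) → ℝ} (hg : Differentiable ℝ g) (c s : ℝ) (x : 𝔼 n) :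
    gradient (fun y => c * g (s • y)) x = (c * s) • gradient g (s • x) := by
  have h1 : HasFDerivAt (fun y : 𝔼 n => g (s • y)) _ x :=
    ((hg (s • x)).hasFDerivAt).comp x ((hasFDerivAt_id x).const_smul s)
  refine ext_inner_right ℝ fun w => ?_
  rw [inner_gradient_left, (h1.const_mul c).fderiv, real_inner_smul_left, inner_gradient_left]
  simp
  ring

/-- Euclidean logarithmic Sobolev inequality, with a free scale parameter `v`. -/
theorem euclidean_lsi (h : IsFisherDensity g) (hm : 0 < ∫ x, g x) {v : ℝ} (hv : 0 < v) :
    (Integrable fun x => g x * Real.log (g x)) ∧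
    2 * ∫ x, g x * Real.log (g x) ≤ 2 * ((∫ x, g x) * Real.log (∫ x, g x)) +
      v * (∫ x, ‖gradient g x‖ ^ 2 / g x) -
      (∫ x, g x) * (2 * n + n * Real.log (2 * Real.pi * v)) := by
  set m : ℝ := ∫ x, g x with hmdef
  obtain ⟨s, hs, rfl⟩ : ∃ s : ℝ, 0 < s ∧ s ^ 2 = v := ⟨√v, Real.sqrt_pos.2 hv, Real.sq_sqrt hv.le⟩
  -- The constant that makes x ↦ c g(s x) a probability density, because g(s ·) has mass m / sⁿ.
  let c : ℝ := m⁻¹ * s ^ n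
  have hc : 0 < c := by positivity
  have hcs : c * (s ^ n)⁻¹ = m⁻¹ := by simp only [c]; field_simp
  let G : (𝔼 n) → ℝ := fun x => c * g (s • x)
  have hgd := h.contDiff.differentiable (by norm_num)
  have scale : ∀ F : (𝔼 n) → ℝ, ∫ x, F (s • x) = (s ^ n)⁻¹ * ∫ x, F x := fun F => by
    have := Measure.integral_comp_smul_of_nonneg (volume : Measure (𝔼 n)) F s (hR := hs.le)
    simpa using this
  have hfish : ∀ x, ‖gradient G x‖ ^ 2 / G x =
      c * s ^ 2 * (‖gradient g (s • x)‖ ^ 2 / g (s • x)) := fun x => by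
    simp only [G]
    rw [gradient_comp_smul hgd, norm_smul, Real.norm_of_nonneg (by positivity)]
    rcases eq_or_ne (g (s • x)) 0 with hx | hx
    · simp [hx]
    · field_simp
  have hG : IsFisherDensity G := by
    refine ⟨contDiff_const.mul (h.contDiff.comp (contDiff_const_smul s)),
      fun x => mul_nonneg hc.le (h.nonneg _), (h.integrable.comp_smul hs.ne').const_mul c, ?_, ?_⟩
    · refine ((h.moment.comp_smul hs.ne').const_mul (c * (s ^ 2)⁻¹)).congr
        (ae_of_all _ fun x => ?_)
      simp only [G, norm_smul, Real.norm_of_nonneg hs.le]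
      field_simp
    · simp only [hfish]
      exact (h.fisher.comp_smul hs.ne').const_mul _
  have hG1 : ∫ x, G x = 1 := by
    simp only [G]
    rw [integral_const_mul, scale, ← mul_assoc, hcs, ← hmdef, inv_mul_cancel₀ hm.ne']
  obtain ⟨k1, k2⟩ := hG.lsi hG1
  have hlogG : ∀ x, G x * Real.log (G x) =
      c * (g (s • x) * Real.log (g (s • x))) + Real.log c * (c * g (s • x)) := fun x => by
    simp only [G]
    rcases eq_or_ne (g (s • x)) 0 with hx | hx
    · simp [hx]
    · rw [Real.log_mul hc.ne' hx]; ring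
  have k3 : Integrable fun x => g (s • x) * Real.log (g (s • x)) := by
    refine ((k1.sub (hG.integrable.const_mul (Real.log c))).const_mul c⁻¹).congr
      (ae_of_all _ fun x => ?_)
    simp only [Pi.sub_apply, hlogG]
    simp only [G]
    field_simp
    ring
  refine ⟨(integrable_comp_smul_iff volume (fun x => g x * Real.log (g x)) hs.ne').1 k3, ?_⟩
  have hG1' : c * ∫ x, g (s • x) = 1 := by rw [← integral_const_mul]; exact hG1
  simp only [hlogG, hfish] at k2
  rw [integral_add (k3.const_mul c) (hG.integrable.const_mul _), integral_const_mul,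
    integral_const_mul, integral_const_mul, integral_const_mul, hG1', scale (fun x => g x * Real.log (g x)),
    scale (fun x => ‖gradient g x‖ ^ 2 / g x)] at k2
  have e1 : Real.log c = n * Real.log s - Real.log m := by
    simp only [c]
    rw [Real.log_mul (by positivity) (by positivity), Real.log_inv, Real.log_pow]; ring
  have e2 : Real.log (2 * Real.pi * s ^ 2) = Real.log (2 * Real.pi) + 2 * Real.log s := by
    rw [Real.log_mul (by positivity) (by positivity), Real.log_pow]; push_cast; ring
  rw [e1, ← mul_assoc c, hcs, mul_comm c (s ^ 2), mul_assoc (s ^ 2) c, ← mul_assoc c, hcs] at k2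
  rw [e2]
  have k4 := mul_le_mul_of_nonneg_left k2 hm.le
  field_simp at k4
  linarith

end IsFisherDensity

end EuclideanLSI

/-! ### Finite relative Fisher information implies a finite second moment. -/

section SecondMoment

variable {n : ℕ}

local notation "𝔼" n => EuclideanSpace ℝ (Fin n)

/-- A bounded radial weight approximating `1` as `δ → 0`. -/
noncomputable def radialWeight (δ : ℝ) (x : 𝔼 n) : ℝ := (1 + δ ^ 2 * ‖x‖ ^ 2)⁻¹

lemma radialWeight_pos (δ : ℝ) (x : 𝔼 n) : 0 < radialWeight δ x := by
  unfold radialWeight; positivity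

lemma radialWeight_le_one (δ : ℝ) (x : 𝔼 n) : radialWeight δ x ≤ 1 := by
  unfold radialWeight
  exact inv_le_one_of_one_le₀ (by nlinarith [mul_nonneg (sq_nonneg δ) (sq_nonneg ‖x‖)])

lemma sq_mul_radialWeight_le (δ : ℝ) (x : 𝔼 n) : δ ^ 2 * ‖x‖ ^ 2 * radialWeight δ x ≤ 1 := by
  unfold radialWeight
  rw [← div_eq_mul_inv, div_le_one (by positivity)]
  linarith

lemma mul_radialWeight_le {δ : ℝ} (hδ : 0 < δ) (x : 𝔼 n) : radialWeight δ x * ‖x‖ ≤ 1 / δ := by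
  unfold radialWeight
  rw [inv_mul_eq_div, div_le_div_iff₀ (by positivity) hδ]
  nlinarith [sq_nonneg (δ * ‖x‖ - 1), mul_nonneg hδ.le (norm_nonneg x)]

lemma contDiff_radialWeight (δ : ℝ) : ContDiff ℝ 1 (radialWeight δ : (𝔼 n) → ℝ) := by
  unfold radialWeight
  refine ContDiff.inv (contDiff_const.add (contDiff_const.mul (contDiff_norm_sq ℝ))) fun x => ?_
  positivity

lemma fderiv_radialWeight (δ : ℝ) (x : 𝔼 n) :
    fderiv ℝ (radialWeight δ) x = (-2 * δ ^ 2 * radialWeight δ x ^ 2) • innerSL ℝ x := by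
  have h1 : HasFDerivAt (fun x : 𝔼 n => 1 + δ ^ 2 * ‖x‖ ^ 2) _ x :=
    ((hasStrictFDerivAt_norm_sq x).hasFDerivAt.const_mul (δ ^ 2)).const_add 1
  have hne : 1 + δ ^ 2 * ‖x‖ ^ 2 ≠ 0 := by positivity
  have h2 : HasFDerivAt (radialWeight δ) _ x := (hasDerivAt_inv hne).comp_hasFDerivAt x h1
  rw [h2.fderiv]
  ext w
  simp [radialWeight]
  ring

/-- The second moment is controlled by the relative Fisher information. -/
theorem integrable_second_moment {p : (𝔼 n) → ℝ} (hp : ContDiff ℝ 1 p) (h0 : ∀ x, 0 ≤ p x)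
    (hi : Integrable p) (hV : Integrable fun x => ‖gradient p x + p x • x‖ ^ 2 / p x) :
    Integrable fun x => ‖x‖ ^ 2 * p x := by
  set V : (𝔼 n) → ℝ := fun x => ‖gradient p x + p x • x‖ ^ 2 / p x with hVdef
  have hc := hp.continuous
  have hcg := continuous_gradient hp
  have hcf : Continuous (fderiv ℝ p) := hp.continuous_fderiv one_ne_zero
  have hu : ∀ x, ‖gradient p x + p x • x‖ ^ 2 = V x * p x := fun x => by
    rcases (h0 x).eq_or_lt with hx | hx
    · simp [gradient_eq_zero_of_nonneg h0 hx.symm, ← hx]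
    · simp only [hVdef]; field_simp
  have hV0 : ∀ x, 0 ≤ V x := fun x => div_nonneg (sq_nonneg _) (h0 x)
  have hu1 : ∀ x, ‖gradient p x + p x • x‖ ≤ V x + p x := fun x => by
    refine abs_le_of_sq_le_sq' ?_ (add_nonneg (hV0 x) (h0 x)) |>.2
    rw [hu]
    nlinarith [hV0 x, h0 x, mul_nonneg (hV0 x) (h0 x), sq_nonneg (V x), sq_nonneg (p x)]
  -- The squared norm of ∇p + p x is V p, so the arithmetic-geometric mean inequality applies.
  have hu2 : ∀ x, ⟪gradient p x + p x • x, x⟫ ≤ 1 / 2 * V x + 1 / 2 * (‖x‖ ^ 2 * p x) := fun x => by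
    refine (real_inner_le_norm _ _).trans ?_
    refine abs_le_of_sq_le_sq' ?_ (add_nonneg (by linarith [hV0 x])
      (mul_nonneg (by norm_num) (mul_nonneg (sq_nonneg _) (h0 x)))) |>.2
    rw [mul_pow, hu]
    nlinarith [sq_nonneg (V x - ‖x‖ ^ 2 * p x)]
  set I : ℝ := ∫ x, V x
  set m : ℝ := ∫ x, p x
  -- Write |x|² p = ⟨∇p + p x, x⟩ - ⟨∇p, x⟩ under the weight. The first term is at most half of I
  -- plus half of the quantity being bounded, which is finite thanks to the weight and can be
  -- absorbed. The second is at most n m after integration by parts.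
  have bound : ∀ δ : ℝ, 0 < δ → Integrable (fun x => radialWeight δ x * (‖x‖ ^ 2 * p x)) ∧
      ∫ x, radialWeight δ x * (‖x‖ ^ 2 * p x) ≤ 2 * n * m + I := by
    intro δ hδ
    let φ : (𝔼 n) → ℝ := radialWeight δ
    have hφ : ContDiff ℝ 1 φ := contDiff_radialWeight δ
    have cφ : Continuous φ := hφ.continuous
    have cφ' : Continuous (fderiv ℝ φ) := hφ.continuous_fderiv one_ne_zero
    have φ0 : ∀ x, 0 < φ x := radialWeight_pos δ
    have φ1 : ∀ x, φ x ≤ 1 := radialWeight_le_one δ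
    have φ2 : ∀ x, φ x * ‖x‖ ≤ 1 / δ := mul_radialWeight_le hδ
    have φ3 : ∀ x, φ x * ‖x‖ ^ 2 ≤ 1 / δ ^ 2 := fun x => by
      rw [le_div_iff₀ (by positivity)]
      linarith [sq_mul_radialWeight_le δ x]
    have i1 : Integrable fun x => φ x * p x :=
      hi.mono' (Continuous.aestronglyMeasurable (by fun_prop)) (ae_of_all _ fun x => by
        rw [Real.norm_of_nonneg (mul_nonneg (φ0 x).le (h0 x))]
        exact mul_le_of_le_one_left (h0 x) (φ1 x))
    have iA : Integrable fun x => φ x * (‖x‖ ^ 2 * p x) :=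
      (hi.const_mul (1 / δ ^ 2)).mono' (Continuous.aestronglyMeasurable (by fun_prop))
        (ae_of_all _ fun x => by
          rw [Real.norm_of_nonneg (mul_nonneg (φ0 x).le (mul_nonneg (sq_nonneg _) (h0 x))),
            ← mul_assoc]
          exact mul_le_mul_of_nonneg_right (φ3 x) (h0 x))
    have i4 : Integrable fun x => φ x * ‖x‖ * p x :=
      (hi.const_mul (1 / δ)).mono' (Continuous.aestronglyMeasurable (by fun_prop))
        (ae_of_all _ fun x => by
          rw [Real.norm_of_nonneg (mul_nonneg (mul_nonneg (φ0 x).le (norm_nonneg _)) (h0 x))]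
          exact mul_le_mul_of_nonneg_right (φ2 x) (h0 x))
    have iu : Integrable fun x => φ x * ⟪gradient p x + p x • x, x⟫ :=
      ((hV.add hi).const_mul (1 / δ)).mono' (Continuous.aestronglyMeasurable (by fun_prop))
        (ae_of_all _ fun x => by
          rw [norm_mul, Real.norm_of_nonneg (φ0 x).le]
          calc φ x * ‖⟪gradient p x + p x • x, x⟫‖
              ≤ φ x * (‖gradient p x + p x • x‖ * ‖x‖) := by
                gcongr
                · exact (φ0 x).le
                · exact norm_inner_le_norm _ _
            _ = (φ x * ‖x‖) * ‖gradient p x + p x • x‖ := by ring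
            _ ≤ 1 / δ * (V x + p x) := by
                gcongr
                · exact φ2 x
                · exact hu1 x)
    have i3 : Integrable fun x => φ x * ‖x‖ * ‖fderiv ℝ p x‖ :=
      (((hV.add hi).const_mul (1 / δ)).add (hi.const_mul (1 / δ ^ 2))).mono'
        (Continuous.aestronglyMeasurable (by fun_prop)) (ae_of_all _ fun x => by
          have hx := mul_nonneg (φ0 x).le (norm_nonneg x)
          rw [← norm_gradient, norm_mul, norm_norm, Real.norm_of_nonneg hx]
          calc φ x * ‖x‖ * ‖gradient p x‖
              ≤ φ x * ‖x‖ * (‖gradient p x + p x • x‖ + p x * ‖x‖) := by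
                refine mul_le_mul_of_nonneg_left ?_ hx
                have := norm_sub_le (gradient p x + p x • x) (p x • x)
                rwa [add_sub_cancel_right, norm_smul, Real.norm_of_nonneg (h0 x)] at this
            _ = φ x * ‖x‖ * ‖gradient p x + p x • x‖ + φ x * ‖x‖ ^ 2 * p x := by ring
            _ ≤ 1 / δ * (V x + p x) + 1 / δ ^ 2 * p x := by
                gcongr
                · exact φ2 x
                · exact hu1 x
                · exact h0 x
                · exact φ3 x)
    -- The weight decreases radially, so its derivative enters the integration by parts with a
    -- favourable sign and the bound is uniform in δ.
    have hφx : ∀ x, fderiv ℝ φ x x = -(2 * φ x * (δ ^ 2 * ‖x‖ ^ 2 * φ x)) := fun x => by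
      rw [fderiv_radialWeight]; simp; ring
    have i2 : Integrable fun x => ‖fderiv ℝ φ x‖ * ‖x‖ * p x :=
      (hi.const_mul 2).mono' (Continuous.aestronglyMeasurable (by fun_prop))
        (ae_of_all _ fun x => by
          rw [Real.norm_of_nonneg (by have := h0 x; positivity), fderiv_radialWeight, norm_smul,
            innerSL_apply_norm, norm_mul, norm_mul, Real.norm_eq_abs, norm_pow, norm_pow,
            Real.norm_of_nonneg hδ.le, Real.norm_of_nonneg (radialWeight_pos δ x).le]
          refine mul_le_mul_of_nonneg_right ?_ (h0 x)
          norm_num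
          have h1 := sq_mul_radialWeight_le δ x
          have h2 := radialWeight_le_one δ x
          have h3 := (radialWeight_pos δ x).le
          have : δ ^ 2 * ‖x‖ ^ 2 * radialWeight δ x * radialWeight δ x ≤ 1 * 1 := by gcongr
          linarith)
    have parts := integral_mul_fderiv_self hφ hp i1 i2 i3 i4
    have iE : Integrable fun x => φ x * fderiv ℝ p x x := by
      refine (iu.sub iA).congr (ae_of_all _ fun x => ?_)
      simp only [Pi.sub_apply]
      rw [inner_add_left, inner_gradient_left, real_inner_smul_left, real_inner_self_eq_norm_sq]
      ring
    have eA : ∫ x, φ x * (‖x‖ ^ 2 * p x) =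
        (∫ x, φ x * ⟪gradient p x + p x • x, x⟫) - ∫ x, φ x * fderiv ℝ p x x := by
      rw [← integral_sub iu iE]
      refine integral_congr_ae (ae_of_all _ fun x => ?_)
      simp only
      rw [inner_add_left, inner_gradient_left, real_inner_smul_left, real_inner_self_eq_norm_sq]
      ring
    have b1 : ∫ x, φ x * ⟪gradient p x + p x • x, x⟫ ≤
        1 / 2 * I + 1 / 2 * ∫ x, φ x * (‖x‖ ^ 2 * p x) := by
      rw [← integral_const_mul, ← integral_const_mul, ← integral_add (hV.const_mul _)
        (iA.const_mul _)]
      refine integral_mono iu ((hV.const_mul _).add (iA.const_mul _)) fun x => ?_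
      beta_reduce
      have := mul_le_mul_of_nonneg_left (hu2 x) (φ0 x).le
      have := mul_le_mul_of_nonneg_right (φ1 x) (hV0 x)
      simp only [hVdef] at *
      linarith
    have b2 : ∫ x, (n * φ x + fderiv ℝ φ x x) * p x ≤ n * m := by
      rw [← integral_const_mul]
      refine integral_mono ?_ (hi.const_mul _) fun x => ?_
      · refine ((i1.const_mul n).add (i2.mono' (g := fun x => ‖fderiv ℝ φ x‖ * ‖x‖ * p x)
          (f := fun x => fderiv ℝ φ x x * p x)
          (Continuous.aestronglyMeasurable (by fun_prop)) (ae_of_all _ fun x => ?_))).congr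
          (ae_of_all _ fun x => ?_)
        · rw [norm_mul, Real.norm_of_nonneg (h0 x)]
          exact mul_le_mul_of_nonneg_right ((fderiv ℝ φ x).le_opNorm x) (h0 x)
        · simp only [Pi.add_apply]; ring
      · refine mul_le_mul_of_nonneg_right ?_ (h0 x)
        rw [hφx]
        have h1 : 0 ≤ 2 * φ x * (δ ^ 2 * ‖x‖ ^ 2 * φ x) := by have := (φ0 x).le; positivity
        have h2 : n * φ x ≤ n := mul_le_of_le_one_right (Nat.cast_nonneg n) (φ1 x)
        linarith
    refine ⟨iA, ?_⟩
    linarith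
  refine ⟨Continuous.aestronglyMeasurable (by fun_prop), ?_⟩
  rw [hasFiniteIntegral_iff_ofReal (ae_of_all _ fun x => mul_nonneg (sq_nonneg _) (h0 x))]
  let δ : ℕ → ℝ := fun k => 1 / ((k : ℝ) + 1)
  have hδ : ∀ k, 0 < δ k := fun k => by positivity
  calc ∫⁻ x, ENNReal.ofReal (‖x‖ ^ 2 * p x)
      = ∫⁻ x, liminf (fun k => ENNReal.ofReal (radialWeight (δ k) x * (‖x‖ ^ 2 * p x))) atTop := by
        refine lintegral_congr fun x => (Tendsto.liminf_eq ?_).symm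
        refine (ENNReal.continuous_ofReal.tendsto _).comp ?_
        have h1 : Tendsto (fun k => radialWeight (δ k) x) atTop (𝓝 1) := by
          have := ((tendsto_one_div_add_atTop_nhds_zero_nat (𝕜 := ℝ)).pow 2).mul_const (‖x‖ ^ 2)
          have := (this.const_add 1).inv₀ (by norm_num)
          simpa [radialWeight, δ] using this
        simpa using h1.mul_const (‖x‖ ^ 2 * p x)
    _ ≤ liminf (fun k => ∫⁻ x, ENNReal.ofReal (radialWeight (δ k) x * (‖x‖ ^ 2 * p x))) atTop :=
        lintegral_liminf_le fun k => by
          have := (contDiff_radialWeight (n := n) (δ k)).continuous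
          fun_prop
    _ ≤ liminf (fun _ => ENNReal.ofReal (2 * n * m + I)) atTop := by
        refine liminf_le_liminf (Eventually.of_forall fun k => ?_)
        rw [← ofReal_integral_eq_lintegral_ofReal (bound _ (hδ k)).1 (ae_of_all _ fun x =>
          mul_nonneg (radialWeight_pos _ x).le (mul_nonneg (sq_nonneg _) (h0 x)))]
        exact ENNReal.ofReal_le_ofReal (bound _ (hδ k)).2
    _ < ⊤ := by simp

/-- With the second moment finite, ∇p = (∇p + p x) - p x bounds the Fisher integrand by twice the
relative one plus twice |x|² p. -/
theorem isFisherDensity_of_relFisher {p : (𝔼 n) → ℝ} (hp : ContDiff ℝ 2 p) (h0 : ∀ x, 0 ≤ p x)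
    (hi : Integrable p) (hV : Integrable fun x => ‖gradient p x + p x • x‖ ^ 2 / p x) :
    IsFisherDensity p := by
  have hm := integrable_second_moment (hp.of_le one_le_two) h0 hi hV
  refine ⟨hp, h0, hi, hm, ?_⟩
  refine ((hV.const_mul 2).add (hm.const_mul 2)).mono' ?_ (ae_of_all _ fun x => ?_)
  · have h1 := hp.continuous.measurable
    have h2 := (continuous_gradient (hp.of_le one_le_two)).measurable
    exact Measurable.aestronglyMeasurable (by fun_prop)
  · rw [Real.norm_of_nonneg (div_nonneg (sq_nonneg _) (h0 x))]
    rcases (h0 x).eq_or_lt with hx | hx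
    · simp [← hx]
    · simp only [Pi.add_apply]
      have h1 : ‖gradient p x‖ ≤ ‖gradient p x + p x • x‖ + p x * ‖x‖ := by
        have := norm_sub_le (gradient p x + p x • x) (p x • x)
        rwa [add_sub_cancel_right, norm_smul, Real.norm_of_nonneg hx.le] at this
      have h2 : ‖gradient p x‖ ^ 2 ≤ (‖gradient p x + p x • x‖ + p x * ‖x‖) ^ 2 := by gcongr
      rw [div_le_iff₀ hx, add_mul, mul_assoc 2, div_mul_cancel₀ _ hx.ne']
      nlinarith [sq_nonneg (‖gradient p x + p x • x‖ - p x * ‖x‖)]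

end SecondMoment

/-! ### Gaussian noise kernels. -/

section ScaledGauss

variable {n : ℕ}

local notation "𝔼" n => EuclideanSpace ℝ (Fin n)

/-- The density of the centred Gaussian with standard deviation `σ` in each direction. -/
noncomputable def scaledGauss (n : ℕ) (σ : ℝ) (w : 𝔼 n) : ℝ :=
  (σ ^ n)⁻¹ * gaussDensity n (σ⁻¹ • w)

lemma scaledGauss_pos {σ : ℝ} (hσ : 0 < σ) (w : 𝔼 n) : 0 < scaledGauss n σ w :=
  mul_pos (inv_pos.2 (pow_pos hσ n)) (gaussDensity_pos _)

lemma contDiff_scaledGauss {k : WithTop ℕ∞} (σ : ℝ) : ContDiff ℝ k (scaledGauss n σ) :=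
  contDiff_const.mul (contDiff_gaussDensity.comp (contDiff_const_smul σ⁻¹))

lemma continuous_scaledGauss (σ : ℝ) : Continuous (scaledGauss n σ) :=
  (contDiff_scaledGauss (k := 0) σ).continuous

lemma log_scaledGauss {σ : ℝ} (hσ : 0 < σ) (w : 𝔼 n) :
    Real.log (scaledGauss n σ w) =
      -(n * Real.log σ) - n / 2 * Real.log (2 * Real.pi) - ‖w‖ ^ 2 / (2 * σ ^ 2) := by
  rw [scaledGauss, Real.log_mul (by positivity) (gaussDensity_pos _).ne', Real.log_inv,
    Real.log_pow, log_gaussDensity, norm_smul, norm_inv, Real.norm_of_nonneg hσ.le, mul_pow]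
  field_simp
  ring

lemma gaussDensity_le (w : 𝔼 n) : gaussDensity n w ≤ gaussDensity n 0 := by
  unfold gaussDensity
  gcongr
  simp

lemma scaledGauss_le {σ : ℝ} (hσ : 0 < σ) (w : 𝔼 n) :
    scaledGauss n σ w ≤ (σ ^ n)⁻¹ * gaussDensity n 0 := by
  unfold scaledGauss
  gcongr
  exact gaussDensity_le _

lemma gradient_scaledGauss_sub {σ : ℝ} (y x : 𝔼 n) :
    gradient (fun x => scaledGauss n σ (y - x)) x =
      (scaledGauss n σ (y - x) * (σ ^ 2)⁻¹) • (y - x) := by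
  have h0 : HasFDerivAt (fun x : 𝔼 n => σ⁻¹ • (y - x)) _ x :=
    ((hasFDerivAt_id (𝕜 := ℝ) x).const_sub y).const_smul σ⁻¹
  have h1 : HasFDerivAt (fun x => gaussDensity n (σ⁻¹ • (y - x))) _ x :=
    ((contDiff_gaussDensity.differentiable one_ne_zero _).hasFDerivAt).comp x h0
  have h2 : HasFDerivAt (fun x => scaledGauss n σ (y - x)) _ x := h1.const_mul (σ ^ n)⁻¹
  refine ext_inner_right ℝ fun w => ?_
  rw [inner_gradient_left, h2.fderiv]
  have h3 := inner_gradient_left (gaussDensity n) (σ⁻¹ • (y - x)) w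
  rw [gradient_gaussDensity, inner_neg_left, real_inner_smul_left, real_inner_smul_left] at h3
  simp [← h3, real_inner_smul_left, scaledGauss]
  ring

lemma map_stdGaussian_add_smul {σ : ℝ} (hσ : 0 < σ) (x : 𝔼 n) :
    (stdGaussian (𝔼 n)).map (fun w => x + σ • w) =
      volume.withDensity (fun y => ENNReal.ofReal (scaledGauss n σ (y - x))) := by
  have hk : Measurable fun y => ENNReal.ofReal (scaledGauss n σ (y - x)) := by
    have := continuous_scaledGauss (n := n) σ
    exact Measurable.ennreal_ofReal (Continuous.measurable (by fun_prop))
  have hq : Measurable fun y => ENNReal.ofReal (gaussDensity n y) :=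
    continuous_gaussDensity.measurable.ennreal_ofReal
  refine Measure.ext_of_lintegral _ fun F hF => ?_
  have hF' : Measurable fun w : 𝔼 n => F (x + σ • w) := hF.comp (by fun_prop)
  rw [lintegral_map hF (by fun_prop), stdGaussian_eq_withDensity,
    lintegral_withDensity_eq_lintegral_mul _ hq hF', lintegral_withDensity_eq_lintegral_mul _ hk hF]
  have hG : Measurable fun y => ((fun y => ENNReal.ofReal (scaledGauss n σ (y - x))) * F) (x + y) :=
    (hk.mul hF).comp (by fun_prop)
  have e1 := lintegral_map (μ := (volume : Measure (𝔼 n))) hG (measurable_const_smul σ)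
  rw [Measure.map_addHaar_smul _ hσ.ne', lintegral_smul_measure, lintegral_add_left_eq_self] at e1
  rw [finrank_euclideanSpace_fin, abs_of_pos (by positivity)] at e1
  have hc : ENNReal.ofReal (σ ^ n) * ENNReal.ofReal (σ ^ n)⁻¹ = 1 := by
    rw [← ENNReal.ofReal_mul (by positivity), mul_inv_cancel₀ (by positivity), ENNReal.ofReal_one]
  have e2 := congrArg (fun t => ENNReal.ofReal (σ ^ n) * t) e1
  simp only [smul_eq_mul, ← mul_assoc, hc, one_mul] at e2
  rw [e2, ← lintegral_const_mul]
  · refine lintegral_congr fun w => ?_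
    simp only [Pi.mul_apply]
    rw [← mul_assoc, ← ENNReal.ofReal_mul (by positivity), add_sub_cancel_left, scaledGauss,
      smul_smul, inv_mul_cancel₀ hσ.ne', one_smul, ← mul_assoc, mul_inv_cancel₀ (by positivity),
      one_mul]
  · exact hG.comp (measurable_const_smul σ)

lemma integrable_scaledGauss {σ : ℝ} (hσ : 0 < σ) (c : 𝔼 n) :
    Integrable (fun z => scaledGauss n σ (z - c)) ∧ ∫ z, scaledGauss n σ (z - c) = 1 := by
  have hm := congrArg (fun ν : Measure (𝔼 n) => ν Set.univ) (map_stdGaussian_add_smul hσ c)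
  simp only [withDensity_apply _ MeasurableSet.univ, Measure.restrict_univ] at hm
  rw [Measure.map_apply (by fun_prop) MeasurableSet.univ, Set.preimage_univ, measure_univ] at hm
  have hmeas : AEStronglyMeasurable (fun z => scaledGauss n σ (z - c)) := by
    have := continuous_scaledGauss (n := n) σ
    exact Continuous.aestronglyMeasurable (by fun_prop)
  have h0 : 0 ≤ᵐ[volume] fun z => scaledGauss n σ (z - c) :=
    ae_of_all _ fun z => (scaledGauss_pos hσ _).le
  refine ⟨⟨hmeas, ?_⟩, ?_⟩
  · rw [hasFiniteIntegral_iff_ofReal h0, ← hm]; simp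
  · rw [integral_eq_lintegral_of_nonneg_ae h0 hmeas, ← hm]; simp

/-- Convolution of Gaussian densities. -/
lemma integral_scaledGauss_sub_stdGaussian {σ τ : ℝ} (hσ : 0 < σ) (hτ : 0 < τ)
    (hστ : τ ^ 2 = 1 + σ ^ 2) (y : 𝔼 n) :
    ∫ z, scaledGauss n σ (y - z) ∂(stdGaussian (𝔼 n)) = scaledGauss n τ y := by
  have hr : 0 < σ / τ := div_pos hσ hτ
  -- Completing the square: given the noisy value y, the variable z is Gaussian with mean y/τ² and
  -- standard deviation σ/τ.
  have key : ∀ z : 𝔼 n, gaussDensity n z * scaledGauss n σ (y - z) =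
      scaledGauss n τ y * scaledGauss n (σ / τ) (z - (τ ^ 2)⁻¹ • y) := by
    intro z
    refine Real.log_injOn_pos (Set.mem_Ioi.2 (mul_pos (gaussDensity_pos _) (scaledGauss_pos hσ _)))
      (Set.mem_Ioi.2 (mul_pos (scaledGauss_pos hτ _) (scaledGauss_pos hr _))) ?_
    rw [Real.log_mul (gaussDensity_pos _).ne' (scaledGauss_pos hσ _).ne',
      Real.log_mul (scaledGauss_pos hτ _).ne' (scaledGauss_pos hr _).ne', log_gaussDensity,
      log_scaledGauss hσ, log_scaledGauss hτ, log_scaledGauss hr, Real.log_div hσ.ne' hτ.ne',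
      norm_sub_sq_real, norm_sub_sq_real, norm_smul, real_inner_smul_right, real_inner_comm z y,
      Real.norm_of_nonneg (by positivity)]
    have hσ2 : σ ^ 2 = τ ^ 2 - 1 := by linarith
    have : τ ^ 2 - 1 ≠ 0 := by rw [← hσ2]; positivity
    rw [div_pow, hσ2]
    field_simp
    ring
  rw [integral_stdGaussian_eq]
  simp only [key]
  rw [integral_const_mul, (integrable_scaledGauss hr _).2, mul_one]

lemma integral_norm_sq_stdGaussian : ∫ w, ‖w‖ ^ 2 ∂(stdGaussian (𝔼 n)) = n := by
  have h : ∀ w : 𝔼 n, ‖w‖ ^ 2 = ∑ i, ⟪EuclideanSpace.single i (1 : ℝ), w⟫ ^ 2 := fun w => by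
    simp [EuclideanSpace.norm_sq_eq, EuclideanSpace.inner_single_left]
  simp only [h]
  rw [integral_finsetSum]
  · simp [integral_inner_sq_stdGaussian]
  · intro i _
    refine (integrable_norm_pow_stdGaussian (E := 𝔼 n) 2).mono'
      (Continuous.aestronglyMeasurable (by fun_prop)) (ae_of_all _ fun z => ?_)
    rw [norm_pow]
    gcongr
    refine (norm_inner_le_norm _ _).trans ?_
    simp

end ScaledGauss

/-! ### Entropy of the conditional laws for a fixed noisy value. -/

section Coupling

variable {n : ℕ}

local notation "𝔼" n => EuclideanSpace ℝ (Fin n)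

/-- The measure with density `p`. -/
noncomputable def lawOf (p : (𝔼 n) → ℝ) : Measure (𝔼 n) :=
  volume.withDensity fun x => ENNReal.ofReal (p x)

/-- The score function `∇p / p`. -/
noncomputable def score (p : (𝔼 n) → ℝ) (x : 𝔼 n) : 𝔼 n := (p x)⁻¹ • gradient p x

lemma integrable_lawOf_iff {p : (𝔼 n) → ℝ} (hp : Continuous p) (h0 : ∀ x, 0 ≤ p x)
    {f : (𝔼 n) → ℝ} : Integrable f (lawOf p) ↔ Integrable fun x => p x * f x := by
  rw [lawOf, integrable_withDensity_iff_integrable_smul' (by fun_prop) (by simp)]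
  simp only [ENNReal.toReal_ofReal (h0 _), smul_eq_mul]

lemma integral_lawOf {p : (𝔼 n) → ℝ} (hp : Continuous p) (h0 : ∀ x, 0 ≤ p x) (f : (𝔼 n) → ℝ) :
    ∫ x, f x ∂(lawOf p) = ∫ x, p x * f x := by
  rw [lawOf, integral_withDensity_eq_integral_toReal_smul (by fun_prop) (by simp)]
  simp only [ENNReal.toReal_ofReal (h0 _), smul_eq_mul]

lemma integrable_comp_fst_of_fst_eq {α β : Type*} [MeasurableSpace α] [MeasurableSpace β]
    {π : Measure (α × β)} {μ : Measure α} (hπ : π.fst = μ)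
    {f : α → ℝ} (hf : Integrable f μ) : Integrable (fun q => f q.1) π := by
  rw [← hπ] at hf
  exact hf.comp_measurable measurable_fst

lemma integrable_comp_snd_of_snd_eq {α β : Type*} [MeasurableSpace α] [MeasurableSpace β]
    {π : Measure (α × β)} {μ : Measure β} (hπ : π.snd = μ)
    {f : β → ℝ} (hf : Integrable f μ) : Integrable (fun q => f q.2) π := by
  rw [← hπ] at hf
  exact hf.comp_measurable measurable_snd

lemma integral_comp_fst_of_fst_eq {α β : Type*} [MeasurableSpace α] [MeasurableSpace β]
    {π : Measure (α × β)} {μ : Measure α} (hπ : π.fst = μ)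
    {f : α → ℝ} (hf : AEStronglyMeasurable f μ) : ∫ q, f q.1 ∂π = ∫ x, f x ∂μ := by
  rw [← hπ] at hf ⊢
  exact (integral_map measurable_fst.aemeasurable hf).symm

lemma integral_comp_snd_of_snd_eq {α β : Type*} [MeasurableSpace α] [MeasurableSpace β]
    {π : Measure (α × β)} {μ : Measure β} (hπ : π.snd = μ)
    {f : β → ℝ} (hf : AEStronglyMeasurable f μ) : ∫ q, f q.2 ∂π = ∫ x, f x ∂μ := by
  rw [← hπ] at hf ⊢
  exact (integral_map measurable_snd.aemeasurable hf).symm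

/-- The log-sum inequality. -/
lemma integral_mul_log_le {α : Type*} [MeasurableSpace α] {π : Measure α} {a b : α → ℝ}
    (ha : ∀ x, 0 < a x) (hb : ∀ x, 0 < b x) (hai : Integrable a π) (hbi : Integrable b π)
    (hab : Integrable (fun x => a x * (Real.log (a x) - Real.log (b x))) π)
    (hA : 0 < ∫ x, a x ∂π) (hB : 0 < ∫ x, b x ∂π) :
    (∫ x, a x ∂π) * Real.log (∫ x, a x ∂π) ≤ (∫ x, a x ∂π) * Real.log (∫ x, b x ∂π) +
      ∫ x, a x * (Real.log (a x) - Real.log (b x)) ∂π := by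
  set A := ∫ x, a x ∂π with hAdef
  set B := ∫ x, b x ∂π with hBdef
  -- This is log t ≥ 1 - 1/t at t = a/((A/B) b), multiplied by a; integrating makes the linear terms
  -- A - (A/B) B cancel.
  have hpt : ∀ x, (Real.log A - Real.log B + 1) * a x - A / B * b x ≤
      a x * (Real.log (a x) - Real.log (b x)) := by
    intro x
    have hc : 0 < A / B := div_pos hA hB
    have := Real.one_sub_inv_le_log_of_pos (div_pos (ha x) (mul_pos hc (hb x)))
    rw [Real.log_div (ha x).ne' (mul_pos hc (hb x)).ne', Real.log_mul hc.ne' (hb x).ne',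
      Real.log_div hA.ne' hB.ne', inv_div] at this
    have h2 := mul_le_mul_of_nonneg_left this (ha x).le
    have e : a x * (1 - A / B * b x / a x) = a x - A / B * b x := by
      have := (ha x).ne'
      field_simp
    rw [e] at h2
    linarith
  have := integral_mono ((hai.const_mul _).sub (hbi.const_mul _)) hab hpt
  rw [integral_sub' (hai.const_mul _) (hbi.const_mul _), integral_const_mul, integral_const_mul,
    ← hAdef, ← hBdef, div_mul_cancel₀ _ hB.ne'] at this
  linarith

lemma integral_pos_of_forall_pos {μ : Measure (𝔼 n)} [NeZero μ] {f : (𝔼 n) → ℝ}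
    (hf : ∀ x, 0 < f x) (hi : Integrable f μ) : 0 < ∫ x, f x ∂μ := by
  rw [integral_pos_iff_support_of_nonneg (fun x => (hf x).le) hi]
  have : Function.support f = Set.univ := by
    ext x; simp [(hf x).ne']
  rw [this]
  exact Measure.measure_univ_pos.2 (NeZero.ne μ)

namespace IsFisherDensity

variable {p : (𝔼 n) → ℝ}

lemma measurable_score (h : IsFisherDensity p) : Measurable (score p) := by
  have h1 := h.contDiff.continuous.measurable
  have h2 := (continuous_gradient (h.contDiff.of_le one_le_two)).measurable
  unfold score
  fun_prop

lemma mul_norm_score_sq (p : (𝔼 n) → ℝ) (x : 𝔼 n) :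
    p x * ‖score p x‖ ^ 2 = ‖gradient p x‖ ^ 2 / p x := by
  rw [score, norm_smul, mul_pow, norm_inv, inv_pow, Real.norm_eq_abs, sq_abs]
  rcases eq_or_ne (p x) 0 with hx | hx
  · simp [hx]
  · field_simp

lemma isProbabilityMeasure_lawOf (h : IsFisherDensity p) (h1 : ∫ x, p x = 1) :
    IsProbabilityMeasure (lawOf p) := by
  constructor
  rw [lawOf, withDensity_apply _ MeasurableSet.univ, Measure.restrict_univ,
    ← ofReal_integral_eq_lintegral_ofReal h.integrable (ae_of_all _ h.nonneg), h1,
    ENNReal.ofReal_one]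

lemma integrable_log (h : IsFisherDensity p) (h1 : ∫ x, p x = 1) :
    Integrable (fun x => Real.log (p x)) (lawOf p) := by
  rw [integrable_lawOf_iff h.contDiff.continuous h.nonneg]
  exact (h.lsi h1).1

lemma integrable_norm_sq (h : IsFisherDensity p) :
    Integrable (fun x => ‖x‖ ^ 2) (lawOf p) := by
  rw [integrable_lawOf_iff h.contDiff.continuous h.nonneg]
  simpa only [mul_comm] using h.moment

lemma integrable_norm_score_sq (h : IsFisherDensity p) :
    Integrable (fun x => ‖score p x‖ ^ 2) (lawOf p) := by
  rw [integrable_lawOf_iff h.contDiff.continuous h.nonneg]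
  simpa only [mul_norm_score_sq] using h.fisher

lemma integrable_norm_score_add_sq [IsFiniteMeasure (lawOf p)] (h : IsFisherDensity p)
    (c : ℝ) (y : 𝔼 n) :
    Integrable (fun x => ‖score p x + c • (y - x)‖ ^ 2) (lawOf p) := by
  refine (((h.integrable_norm_score_sq.const_mul 2).add
    ((integrable_const (4 * c ^ 2 * ‖y‖ ^ 2)).add
      (h.integrable_norm_sq.const_mul (4 * c ^ 2))))).mono' ?_ (ae_of_all _ fun x => ?_)
  · have := h.measurable_score
    exact Measurable.aestronglyMeasurable (by fun_prop)
  · rw [norm_pow, norm_norm]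
    simp only [Pi.add_apply]
    have h1 : ‖score p x + c • (y - x)‖ ≤ ‖score p x‖ + |c| * (‖y‖ + ‖x‖) := by
      refine (norm_add_le _ _).trans ?_
      rw [norm_smul, Real.norm_eq_abs]
      gcongr
      exact norm_sub_le _ _
    have h2 : ‖score p x + c • (y - x)‖ ^ 2 ≤ (‖score p x‖ + |c| * (‖y‖ + ‖x‖)) ^ 2 := by gcongr
    have h3 := sq_abs c
    nlinarith [sq_nonneg (‖score p x‖ - |c| * (‖y‖ + ‖x‖)), sq_nonneg (|c| * (‖y‖ - ‖x‖))]

/-- Multiplying by a translated Gaussian density. -/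
lemma mul_scaledGauss (h : IsFisherDensity p) (h1 : ∫ x, p x = 1) {σ : ℝ} (hσ : 0 < σ) (y : 𝔼 n) :
    IsFisherDensity (fun x => p x * scaledGauss n σ (y - x)) ∧
    ∀ x, ‖gradient (fun x => p x * scaledGauss n σ (y - x)) x‖ ^ 2 /
      (p x * scaledGauss n σ (y - x)) =
      p x * (scaledGauss n σ (y - x) * ‖score p x + (σ ^ 2)⁻¹ • (y - x)‖ ^ 2) := by
  have := h.isProbabilityMeasure_lawOf h1
  have hcd : ContDiff ℝ 2 fun x => scaledGauss n σ (y - x) :=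
    (contDiff_scaledGauss σ).comp (contDiff_const.sub contDiff_id)
  have hc := hcd.continuous
  have hc0 := h.contDiff.continuous
  have hbd : ∀ᵐ x ∂(volume : Measure (𝔼 n)), ‖scaledGauss n σ (y - x)‖ ≤
      (σ ^ n)⁻¹ * gaussDensity n 0 := ae_of_all _ fun x => by
    rw [Real.norm_of_nonneg (scaledGauss_pos hσ _).le]; exact scaledGauss_le hσ _
  have hgrad : ∀ x, gradient (fun x => p x * scaledGauss n σ (y - x)) x =
      scaledGauss n σ (y - x) • (gradient p x + (p x * (σ ^ 2)⁻¹) • (y - x)) := fun x => by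
    have d1 := (h.contDiff.differentiable (by norm_num) x).hasFDerivAt
    have d2 := (hcd.differentiable (by norm_num) x).hasFDerivAt
    have d3 : HasFDerivAt (fun x => p x * scaledGauss n σ (y - x)) _ x := d1.mul d2
    refine ext_inner_right ℝ fun w => ?_
    rw [inner_gradient_left, d3.fderiv]
    have h3 := inner_gradient_left (fun x => scaledGauss n σ (y - x)) x w
    rw [gradient_scaledGauss_sub, real_inner_smul_left] at h3
    simp only [add_apply, smul_apply, smul_eq_mul, ← h3, real_inner_smul_left, inner_add_left,
      inner_gradient_left]
    ring
  have hfish : ∀ x, ‖gradient (fun x => p x * scaledGauss n σ (y - x)) x‖ ^ 2 /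
      (p x * scaledGauss n σ (y - x)) =
      p x * (scaledGauss n σ (y - x) * ‖score p x + (σ ^ 2)⁻¹ • (y - x)‖ ^ 2) := fun x => by
    have hk := scaledGauss_pos hσ (y - x)
    rw [hgrad, norm_smul, Real.norm_of_nonneg hk.le]
    rcases (h.nonneg x).eq_or_lt with hx | hx
    · simp [← hx]
    · have e : gradient p x + (p x * (σ ^ 2)⁻¹) • (y - x) =
          p x • (score p x + (σ ^ 2)⁻¹ • (y - x)) := by
        rw [score, smul_add, smul_smul, smul_smul, mul_inv_cancel₀ hx.ne', one_smul]
      rw [e, norm_smul, Real.norm_of_nonneg hx.le]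
      field_simp
  refine ⟨⟨h.contDiff.mul hcd, fun x => mul_nonneg (h.nonneg x) (scaledGauss_pos hσ _).le, ?_, ?_,
    ?_⟩, hfish⟩
  · exact h.integrable.mul_bdd (c := (σ ^ n)⁻¹ * gaussDensity n 0) hc.aestronglyMeasurable hbd
  · refine (h.moment.mul_bdd (c := (σ ^ n)⁻¹ * gaussDensity n 0) hc.aestronglyMeasurable hbd).congr (ae_of_all _ fun x => ?_)
    simp only; ring
  · simp only [hfish]
    have := (integrable_lawOf_iff hc0 h.nonneg).1 (h.integrable_norm_score_add_sq (σ ^ 2)⁻¹ y)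
    refine (this.mul_bdd (c := (σ ^ n)⁻¹ * gaussDensity n 0) hc.aestronglyMeasurable hbd).congr (ae_of_all _ fun x => ?_)
    simp only; ring

end IsFisherDensity

/-- The integrand obtained by combining the Euclidean logarithmic Sobolev inequality with the
log-sum inequality. -/
noncomputable def couplingIntegrand (p : (𝔼 n) → ℝ) (σ τ v : ℝ) (q : (𝔼 n) × (𝔼 n)) (y : 𝔼 n) : ℝ :=
  -2 * Real.log (p q.1) + 2 * Real.log (scaledGauss n τ y) -
    2 * Real.log (scaledGauss n σ (y - q.2)) + v * ‖score p q.1 + (σ ^ 2)⁻¹ • (y - q.1)‖ ^ 2 -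
    (2 * n + n * Real.log (2 * Real.pi * v))

/-- The function p(x) k(y - x), with k the noise kernel, is the unnormalized density of X given X +
σG = y. The Euclidean inequality bounds its entropy up to the term 2 m log m in its mass m. The
log-sum inequality compares m with the density of Z + σG at y through the coupling. The terms k log
k(y - x) from both bounds cancel, leaving the stated integrand. -/
lemma IsFisherDensity.integral_couplingIntegrand_nonneg {p : (𝔼 n) → ℝ} (h : IsFisherDensity p)
    (h1 : ∫ x, p x = 1) {π : Measure ((𝔼 n) × (𝔼 n))} (hfst : π.fst = lawOf p)
    (hsnd : π.snd = stdGaussian (𝔼 n)) {σ τ v : ℝ} (hσ : 0 < σ) (hτ : 0 < τ)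
    (hστ : τ ^ 2 = 1 + σ ^ 2) (hv : 0 < v) (y : 𝔼 n) :
    0 ≤ ∫ q, scaledGauss n σ (y - q.1) * couplingIntegrand p σ τ v q y ∂π := by
  have hμ := h.isProbabilityMeasure_lawOf h1
  have : IsProbabilityMeasure π := by
    refine ⟨?_⟩; rw [← Measure.fst_univ, hfst]; exact measure_univ
  have hc0 := h.contDiff.continuous
  have hK := continuous_scaledGauss (n := n) σ
  obtain ⟨hg, hfish⟩ := h.mul_scaledGauss h1 hσ y
  let k : (𝔼 n) → ℝ := fun x => scaledGauss n σ (y - x)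
  have hk : Continuous k := by simp only [k]; fun_prop
  have hk0 : ∀ x, 0 < k x := fun x => scaledGauss_pos hσ _
  have hkb : ∀ x, ‖k x‖ ≤ (σ ^ n)⁻¹ * gaussDensity n 0 := fun x => by
    rw [Real.norm_of_nonneg (hk0 x).le]; exact scaledGauss_le hσ _
  have ikμ : Integrable k (lawOf p) :=
    Integrable.of_bound hk.aestronglyMeasurable _ (ae_of_all _ hkb)
  have ik : Integrable (fun q => k q.1) π := integrable_comp_fst_of_fst_eq hfst ikμ
  have ik2 : Integrable (fun q => k q.2) π := integrable_comp_snd_of_snd_eq hsnd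
    (Integrable.of_bound hk.aestronglyMeasurable _ (ae_of_all _ hkb))
  have tr : ∀ F : (𝔼 n) → ℝ, AEStronglyMeasurable F (lawOf p) →
      ∫ q, F q.1 ∂π = ∫ x, p x * F x := fun F hF => by
    rw [integral_comp_fst_of_fst_eq hfst hF, integral_lawOf hc0 h.nonneg]
  have bdd : ∀ F : (𝔼 n) × (𝔼 n) → ℝ, Integrable F π → Integrable (fun q => k q.1 * F q) π :=
    fun F hF => hF.bdd_mul (c := (σ ^ n)⁻¹ * gaussDensity n 0)
      (Continuous.aestronglyMeasurable (by fun_prop)) (ae_of_all _ fun q => hkb q.1)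
  have ilogp : Integrable (fun q => k q.1 * Real.log (p q.1)) π :=
    bdd _ (integrable_comp_fst_of_fst_eq hfst (h.integrable_log h1))
  have isq : ∀ (μ : Measure (𝔼 n)) [IsFiniteMeasure μ], Integrable (fun x => ‖x‖ ^ 2) μ →
      Integrable (fun x => Real.log (k x)) μ := fun μ _ hi => by
    simp only [k, log_scaledGauss hσ]
    refine (integrable_const _).sub (Integrable.div_const ?_ _)
    refine ((integrable_const (2 * ‖y‖ ^ 2)).add (hi.const_mul 2)).mono'
      (Continuous.aestronglyMeasurable (by fun_prop)) (ae_of_all _ fun x => ?_)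
    rw [norm_pow, norm_norm]
    have : ‖y - x‖ ^ 2 ≤ (‖y‖ + ‖x‖) ^ 2 := by gcongr; exact norm_sub_le _ _
    simp only [Pi.add_apply]
    nlinarith [sq_nonneg (‖y‖ - ‖x‖)]
  have ilogk1 : Integrable (fun q => k q.1 * Real.log (k q.1)) π :=
    bdd _ (integrable_comp_fst_of_fst_eq hfst (isq _ h.integrable_norm_sq))
  have ilogk2 : Integrable (fun q => k q.1 * Real.log (k q.2)) π :=
    bdd _ (integrable_comp_snd_of_snd_eq hsnd (isq _ (integrable_norm_pow_stdGaussian 2)))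
  have iscore : Integrable (fun q => k q.1 * ‖score p q.1 + (σ ^ 2)⁻¹ • (y - q.1)‖ ^ 2) π :=
    bdd _ (integrable_comp_fst_of_fst_eq hfst (h.integrable_norm_score_add_sq _ y))
  set m : ℝ := ∫ q, k q.1 ∂π with hm
  have em : ∫ x, p x * k x = m := (tr k hk.aestronglyMeasurable).symm
  have hm0 : 0 < m := by
    rw [hm, integral_comp_fst_of_fst_eq hfst hk.aestronglyMeasurable]
    exact integral_pos_of_forall_pos hk0 ikμ
  have eQ : ∫ q, k q.2 ∂π = scaledGauss n τ y := by
    rw [integral_comp_snd_of_snd_eq hsnd hk.aestronglyMeasurable]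
    exact integral_scaledGauss_sub_stdGaussian hσ hτ hστ y
  have hQ0 := scaledGauss_pos (n := n) hτ y
  obtain ⟨j1, j2⟩ := hg.euclidean_lsi (by rw [em]; exact hm0) hv
  simp only [hfish] at j2
  have elog : ∀ x, p x * k x * Real.log (p x * k x) =
      p x * (k x * Real.log (p x) + k x * Real.log (k x)) := fun x => by
    rcases eq_or_ne (p x) 0 with hx | hx
    · simp [hx]
    · rw [Real.log_mul hx (hk0 x).ne']; ring
  have mlog : AEStronglyMeasurable (fun x => k x * Real.log (p x) + k x * Real.log (k x))
      (lawOf p) := by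
    have := hk.measurable
    have := hc0.measurable
    exact Measurable.aestronglyMeasurable (by fun_prop)
  have mscore : AEStronglyMeasurable
      (fun x => k x * ‖score p x + (σ ^ 2)⁻¹ • (y - x)‖ ^ 2) (lawOf p) := by
    have := hk.measurable
    have := h.measurable_score
    exact Measurable.aestronglyMeasurable (by fun_prop)
  change 2 * ∫ x, p x * k x * Real.log (p x * k x) ≤
    2 * ((∫ x, p x * k x) * Real.log (∫ x, p x * k x)) +
      v * (∫ x, p x * (k x * ‖score p x + (σ ^ 2)⁻¹ • (y - x)‖ ^ 2)) -
      (∫ x, p x * k x) * _ at j2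
  rw [em, ← tr _ mscore] at j2
  simp only [elog] at j2
  rw [← tr _ mlog, integral_add ilogp ilogk1] at j2
  have ls := integral_mul_log_le (π := π) (a := fun q => k q.1) (b := fun q => k q.2)
    (fun q => hk0 _) (fun q => hk0 _) ik ik2
    ((ilogk1.sub ilogk2).congr (ae_of_all _ fun q => by simp only [Pi.sub_apply]; ring)) hm0
    (by rw [eQ]; exact hQ0)
  rw [eQ, ← hm] at ls
  simp only [mul_sub] at ls
  rw [integral_sub ilogk1 ilogk2] at ls
  have efin : ∫ q, k q.1 * couplingIntegrand p σ τ v q y ∂π =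
      -2 * (∫ q, k q.1 * Real.log (p q.1) ∂π) + 2 * Real.log (scaledGauss n τ y) * m -
        2 * (∫ q, k q.1 * Real.log (k q.2) ∂π) +
        v * (∫ q, k q.1 * ‖score p q.1 + (σ ^ 2)⁻¹ • (y - q.1)‖ ^ 2 ∂π) -
        (2 * n + n * Real.log (2 * Real.pi * v)) * m := by
    have e : ∀ q, k q.1 * couplingIntegrand p σ τ v q y =
        -2 * (k q.1 * Real.log (p q.1)) + 2 * Real.log (scaledGauss n τ y) * k q.1 -
        2 * (k q.1 * Real.log (k q.2)) +
        v * (k q.1 * ‖score p q.1 + (σ ^ 2)⁻¹ • (y - q.1)‖ ^ 2) -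
        (2 * n + n * Real.log (2 * Real.pi * v)) * k q.1 := fun q => by
      simp only [couplingIntegrand, k]; ring
    simp only [e]
    have t1 := (ilogp.const_mul (-2)).add (ik.const_mul (2 * Real.log (scaledGauss n τ y)))
    have t2 := t1.sub (ilogk2.const_mul 2)
    have t3 := t2.add (iscore.const_mul v)
    rw [integral_sub (by exact t3) (ik.const_mul _), integral_add (by exact t2) (iscore.const_mul v),
      integral_sub (by exact t1) (ilogk2.const_mul 2),
      integral_add (ilogp.const_mul (-2)) (ik.const_mul _)]
    simp only [integral_const_mul, ← hm]
  change 0 ≤ ∫ q, k q.1 * couplingIntegrand p σ τ v q y ∂π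
  rw [efin]
  linarith

end Coupling

/-! ### Integration over the noisy value. -/

section CouplingBound

variable {n : ℕ}

local notation "𝔼" n => EuclideanSpace ℝ (Fin n)

lemma lintegral_add_smul_stdGaussian {σ : ℝ} (hσ : 0 < σ) (x : 𝔼 n) {F : (𝔼 n) → ENNReal}
    (hF : Measurable F) :
    ∫⁻ w, F (x + σ • w) ∂(stdGaussian (𝔼 n)) =
      ∫⁻ y, ENNReal.ofReal (scaledGauss n σ (y - x)) * F y := by
  have hK := continuous_scaledGauss (n := n) σ
  have hd : Measurable fun y : 𝔼 n => ENNReal.ofReal (scaledGauss n σ (y - x)) :=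
    Measurable.ennreal_ofReal (Continuous.measurable (by fun_prop))
  rw [← lintegral_map (g := fun w => x + σ • w) hF (by fun_prop), map_stdGaussian_add_smul hσ,
    lintegral_withDensity_eq_lintegral_mul _ hd hF]
  rfl

/-- Two descriptions of the joint law of (X, Z, X + σG). The one with independent noise makes
expectations computable; the one with a density in y allows integrating over (x, z) first, where
nonnegativity is known. -/
lemma map_prod_stdGaussian_eq_withDensity (π : Measure ((𝔼 n) × (𝔼 n))) [IsProbabilityMeasure π]
    {σ : ℝ} (hσ : 0 < σ) :
    (π.prod (stdGaussian (𝔼 n))).map (fun t => (t.1, t.1.1 + σ • t.2)) =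
      (π.prod volume).withDensity
        (fun t => ENNReal.ofReal (scaledGauss n σ (t.2 - t.1.1))) := by
  have hK := continuous_scaledGauss (n := n) σ
  have hd : Measurable fun t : ((𝔼 n) × (𝔼 n)) × (𝔼 n) =>
      ENNReal.ofReal (scaledGauss n σ (t.2 - t.1.1)) :=
    Measurable.ennreal_ofReal (Continuous.measurable (by fun_prop))
  refine Measure.ext_of_lintegral _ fun F hF => ?_
  rw [lintegral_map hF (by fun_prop), lintegral_withDensity_eq_lintegral_mul _ hd hF,
    lintegral_prod _ (by fun_prop), lintegral_prod _ (by fun_prop)]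
  refine lintegral_congr fun q => ?_
  exact lintegral_add_smul_stdGaussian hσ q.1 (hF.comp measurable_prodMk_left)

/-- Sorted by degree in the noise w: the linear term averages to zero and |w|² averages to n. -/
lemma couplingIntegrand_add_smul (p : (𝔼 n) → ℝ) {σ τ v : ℝ} (hσ : 0 < σ) (hτ : 0 < τ)
    (q : (𝔼 n) × (𝔼 n)) (w : 𝔼 n) :
    couplingIntegrand p σ τ v q (q.1 + σ • w) =
      (-2 * Real.log (p q.1) - (τ ^ 2)⁻¹ * ‖q.1‖ ^ 2 + (σ ^ 2)⁻¹ * ‖q.1 - q.2‖ ^ 2 +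
      v * ‖score p q.1‖ ^ 2 + (-(2 * n * Real.log τ) + 2 * n * Real.log σ -
      (2 * n + n * Real.log (2 * Real.pi * v)))) +
      ⟪(-(2 * σ / τ ^ 2)) • q.1 + (2 / σ) • (q.1 - q.2) + (2 * v / σ) • score p q.1, w⟫ +
      (1 - σ ^ 2 / τ ^ 2 + v / σ ^ 2) * ‖w‖ ^ 2 := by
  obtain ⟨x, z⟩ := q
  simp only [couplingIntegrand]
  rw [log_scaledGauss hτ, log_scaledGauss hσ, add_sub_cancel_left, add_sub_right_comm x,
    norm_add_sq_real x, norm_add_sq_real (x - z), norm_add_sq_real (score p x),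
    inner_add_left, inner_add_left]
  simp only [real_inner_smul_left, real_inner_smul_right, norm_smul, mul_pow, norm_inv, norm_pow,
    Real.norm_of_nonneg hσ.le]
  field_simp
  ring

lemma integrable_of_integrable_norm_sq {α : Type*} [MeasurableSpace α] {π : Measure α}
    [IsFiniteMeasure π] {F : α → 𝔼 n} (hF : Measurable F) (h : Integrable (fun a => ‖F a‖ ^ 2) π) :
    Integrable F π := by
  refine ((integrable_const 1).add h).mono' hF.aestronglyMeasurable (ae_of_all _ fun a => ?_)
  simp only [Pi.add_apply]
  nlinarith [sq_nonneg (‖F a‖ - 1)]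

/-- The expectation of the integrand at Y = X + σG is nonnegative because it is so for each value of
Y. Computing it explicitly and solving for the entropy gives the bound; the coupling enters only
through its cost divided by σ². -/
theorem IsFisherDensity.entropy_le_of_coupling {p : (𝔼 n) → ℝ} (h : IsFisherDensity p)
    (h1 : ∫ x, p x = 1) {π : Measure ((𝔼 n) × (𝔼 n))} (hfst : π.fst = lawOf p)
    (hsnd : π.snd = stdGaussian (𝔼 n)) {σ τ v : ℝ} (hσ : 0 < σ) (hτ : 0 < τ)
    (hστ : τ ^ 2 = 1 + σ ^ 2) (hv : 0 < v) :
    2 * ∫ x, p x * Real.log (p x) ≤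
      -(2 * n * Real.log τ) + 2 * n * Real.log σ - (∫ x, ‖x‖ ^ 2 * p x) / τ ^ 2 +
      (∫ q, ‖q.1 - q.2‖ ^ 2 ∂π) / σ ^ 2 + v * (∫ x, ‖gradient p x‖ ^ 2 / p x) -
      (2 * n + n * Real.log (2 * Real.pi * v)) + n * (1 - σ ^ 2 / τ ^ 2 + v / σ ^ 2) := by
  have hμ := h.isProbabilityMeasure_lawOf h1
  have hπ : IsProbabilityMeasure π := by
    refine ⟨?_⟩; rw [← Measure.fst_univ, hfst]; exact measure_univ
  have hK := continuous_scaledGauss (n := n) σ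
  have hKτ := continuous_scaledGauss (n := n) τ
  have hc0 := h.contDiff.continuous
  have hs := h.measurable_score
  have mlog : Measurable fun x => Real.log (p x) := by fun_prop
  have tr : ∀ F : (𝔼 n) → ℝ, AEStronglyMeasurable F (lawOf p) →
      ∫ q, F q.1 ∂π = ∫ x, p x * F x := fun F hF => by
    rw [integral_comp_fst_of_fst_eq hfst hF, integral_lawOf hc0 h.nonneg]
  have ilog : Integrable (fun q => Real.log (p q.1)) π :=
    integrable_comp_fst_of_fst_eq hfst (h.integrable_log h1)
  have ix : Integrable (fun q => ‖q.1‖ ^ 2) π :=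
    integrable_comp_fst_of_fst_eq hfst h.integrable_norm_sq
  have iz : Integrable (fun q => ‖q.2‖ ^ 2) π :=
    integrable_comp_snd_of_snd_eq hsnd (integrable_norm_pow_stdGaussian 2)
  have isc : Integrable (fun q => ‖score p q.1‖ ^ 2) π :=
    integrable_comp_fst_of_fst_eq hfst h.integrable_norm_score_sq
  have ixz : Integrable (fun q => ‖q.1 - q.2‖ ^ 2) π := by
    refine ((ix.const_mul 2).add (iz.const_mul 2)).mono'
      (Continuous.aestronglyMeasurable (by fun_prop)) (ae_of_all _ fun q => ?_)
    rw [norm_pow, norm_norm]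
    have : ‖q.1 - q.2‖ ^ 2 ≤ (‖q.1‖ + ‖q.2‖) ^ 2 := by gcongr; exact norm_sub_le _ _
    simp only [Pi.add_apply]
    nlinarith [sq_nonneg (‖q.1‖ - ‖q.2‖)]
  let A : (𝔼 n) × (𝔼 n) → 𝔼 n := fun q =>
    (-(2 * σ / τ ^ 2)) • q.1 + (2 / σ) • (q.1 - q.2) + (2 * v / σ) • score p q.1
  let B : (𝔼 n) × (𝔼 n) → ℝ := fun q =>
    -2 * Real.log (p q.1) - (τ ^ 2)⁻¹ * ‖q.1‖ ^ 2 + (σ ^ 2)⁻¹ * ‖q.1 - q.2‖ ^ 2 +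
      v * ‖score p q.1‖ ^ 2 + (-(2 * n * Real.log τ) + 2 * n * Real.log σ -
      (2 * n + n * Real.log (2 * Real.pi * v)))
  let κ : ℝ := 1 - σ ^ 2 / τ ^ 2 + v / σ ^ 2
  have hexp : ∀ q w, couplingIntegrand p σ τ v q (q.1 + σ • w) =
      B q + ⟪A q, w⟫ + κ * ‖w‖ ^ 2 := fun q w => couplingIntegrand_add_smul p hσ hτ q w
  have b1 := (ilog.const_mul (-2)).sub (ix.const_mul (τ ^ 2)⁻¹)
  have b2 := b1.add (ixz.const_mul (σ ^ 2)⁻¹)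
  have b3 := b2.add (isc.const_mul v)
  have iB : Integrable B π := b3.add (integrable_const _)
  have iA : Integrable A π := by
    have hs' : Measurable fun q : (𝔼 n) × (𝔼 n) => score p q.1 := hs.comp measurable_fst
    have a1 := (integrable_of_integrable_norm_sq (F := fun q : (𝔼 n) × (𝔼 n) => q.1)
      (by fun_prop) ix).smul (-(2 * σ / τ ^ 2))
    have a2 := (integrable_of_integrable_norm_sq (F := fun q : (𝔼 n) × (𝔼 n) => q.1 - q.2)
      (by fun_prop) ixz).smul (2 / σ)
    have a3 := (integrable_of_integrable_norm_sq hs' isc).smul (2 * v / σ)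
    exact (a1.add a2).add a3
  have iB' : Integrable (fun t : ((𝔼 n) × (𝔼 n)) × (𝔼 n) => B t.1) (π.prod (stdGaussian (𝔼 n))) :=
    iB.comp_fst _
  have iw : Integrable (fun t : ((𝔼 n) × (𝔼 n)) × (𝔼 n) => κ * ‖t.2‖ ^ 2)
      (π.prod (stdGaussian (𝔼 n))) :=
    ((integrable_norm_pow_stdGaussian (E := 𝔼 n) 2).comp_snd _).const_mul κ
  have iAw : Integrable (fun t : ((𝔼 n) × (𝔼 n)) × (𝔼 n) => ⟪A t.1, t.2⟫)
      (π.prod (stdGaussian (𝔼 n))) := by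
    have hid : Integrable (fun w : 𝔼 n => ‖w‖) (stdGaussian (𝔼 n)) := by
      simpa using integrable_norm_pow_stdGaussian (E := 𝔼 n) 1
    refine (iA.norm.mul_prod hid).mono' ?_ (ae_of_all _ fun t => norm_inner_le_norm _ _)
    exact (iA.aestronglyMeasurable.comp_fst).inner
      (measurable_snd.aestronglyMeasurable)
  have iΘ : Integrable (fun t : ((𝔼 n) × (𝔼 n)) × (𝔼 n) =>
      couplingIntegrand p σ τ v t.1 (t.1.1 + σ • t.2)) (π.prod (stdGaussian (𝔼 n))) := by
    simp only [hexp]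
    exact (iB'.add iAw).add iw
  have eA : ∫ t : ((𝔼 n) × (𝔼 n)) × (𝔼 n), ⟪A t.1, t.2⟫ ∂(π.prod (stdGaussian (𝔼 n))) = 0 := by
    rw [integral_prod _ iAw]
    have : ∀ q, ∫ w, ⟪A q, w⟫ ∂(stdGaussian (𝔼 n)) = 0 := fun q => by
      rw [integral_inner (f := fun w => w) (IsGaussian.integrable_fun_id), integral_id_stdGaussian,
        inner_zero_right]
    simp [this]
  have eΘ : ∫ t : ((𝔼 n) × (𝔼 n)) × (𝔼 n),
      couplingIntegrand p σ τ v t.1 (t.1.1 + σ • t.2) ∂(π.prod (stdGaussian (𝔼 n))) =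
      ∫ q, B q ∂π + κ * n := by
    simp only [hexp]
    rw [integral_add (by exact iB'.add iAw) iw, integral_add iB' iAw, eA, add_zero,
      integral_const_mul, integral_fun_fst, integral_fun_snd (fun w => ‖w‖ ^ 2),
      integral_norm_sq_stdGaussian]
    simp
  have mΦ : Measurable fun t : ((𝔼 n) × (𝔼 n)) × (𝔼 n) => couplingIntegrand p σ τ v t.1 t.2 := by
    unfold couplingIntegrand
    have := hKτ.measurable
    have := hK.measurable
    have := hc0.measurable
    fun_prop
  have mΨ : Measurable fun t : ((𝔼 n) × (𝔼 n)) × (𝔼 n) => (t.1, t.1.1 + σ • t.2) := by fun_prop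
  have hd : Measurable fun t : ((𝔼 n) × (𝔼 n)) × (𝔼 n) =>
      ENNReal.ofReal (scaledGauss n σ (t.2 - t.1.1)) :=
    Measurable.ennreal_ofReal (Continuous.measurable (by fun_prop))
  -- Integrability is checked in the form with independent noise and carried over by the change of
  -- variables, which justifies Fubini with y as the outer variable.
  have key : 0 ≤ ∫ t : ((𝔼 n) × (𝔼 n)) × (𝔼 n),
      couplingIntegrand p σ τ v t.1 (t.1.1 + σ • t.2) ∂(π.prod (stdGaussian (𝔼 n))) := by
    have i1 := (integrable_map_measure mΦ.aestronglyMeasurable mΨ.aemeasurable).2 iΘ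
    rw [← integral_map mΨ.aemeasurable mΦ.aestronglyMeasurable]
    rw [map_prod_stdGaussian_eq_withDensity π hσ] at i1 ⊢
    rw [integrable_withDensity_iff_integrable_smul' hd (by simp)] at i1
    rw [integral_withDensity_eq_integral_toReal_smul hd (by simp), integral_prod_symm _ i1]
    refine integral_nonneg fun y => ?_
    have := h.integral_couplingIntegrand_nonneg h1 hfst hsnd hσ hτ hστ hv y
    simp only [ENNReal.toReal_ofReal (scaledGauss_pos hσ _).le, smul_eq_mul]
    exact this
  rw [eΘ] at key
  have eB : ∫ q, B q ∂π = -2 * (∫ x, p x * Real.log (p x)) - (τ ^ 2)⁻¹ * (∫ x, ‖x‖ ^ 2 * p x) +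
      (σ ^ 2)⁻¹ * (∫ q, ‖q.1 - q.2‖ ^ 2 ∂π) + v * (∫ x, ‖gradient p x‖ ^ 2 / p x) +
      (-(2 * n * Real.log τ) + 2 * n * Real.log σ -
      (2 * n + n * Real.log (2 * Real.pi * v))) := by
    simp only [B]
    rw [integral_add (by exact b3) (integrable_const _), integral_add (by exact b2) (isc.const_mul v),
      integral_add (by exact b1) (ixz.const_mul _), integral_sub (ilog.const_mul _) (ix.const_mul _)]
    simp only [integral_const_mul, integral_const, probReal_univ, one_smul]
    rw [tr (fun x => Real.log (p x)) mlog.aestronglyMeasurable,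
      tr (fun x => ‖x‖ ^ 2) (Continuous.aestronglyMeasurable (by fun_prop)),
      tr (fun x => ‖score p x‖ ^ 2) (Measurable.aestronglyMeasurable (by fun_prop))]
    simp only [mul_norm_score_sq]
    simp only [mul_comm (p _) (‖_‖ ^ 2)]
  rw [eB] at key
  simp only [κ] at key
  rw [div_eq_inv_mul (∫ x, ‖x‖ ^ 2 * p x), div_eq_inv_mul (∫ q, ‖q.1 - q.2‖ ^ 2 ∂π)]
  linarith

end CouplingBound

/-! ### Monotone transport to the Gaussian on the line. -/

section MonotoneTransport

/-- The standard Gaussian measure on the line. -/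
local notation "γ₁" => gaussianReal 0 1

lemma continuous_cdf_of_singleton {κ : Measure ℝ} [IsProbabilityMeasure κ] (h : ∀ x, κ {x} = 0) :
    Continuous (cdf κ) := by
  refine continuous_iff_continuousAt.2 fun x => ?_
  rw [(cdf κ).mono.continuousAt_iff_leftLim_eq_rightLim, (cdf κ).rightLim_eq]
  have h1 := (cdf κ).measure_singleton x
  rw [measure_cdf, h x] at h1
  have h2 := ENNReal.ofReal_eq_zero.1 h1.symm
  have h3 := (cdf κ).mono.leftLim_le (le_refl x)
  linarith

section

variable {κ : Measure ℝ} [IsProbabilityMeasure κ]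

lemma exists_cdf_eq (hκ : Continuous (cdf κ)) {u : ℝ} (hu : u ∈ Set.Ioo (0 : ℝ) 1) :
    ∃ x, cdf κ x = u := by
  have h0 : ∃ a, cdf κ a ≤ u :=
    (((tendsto_cdf_atBot κ).eventually (gt_mem_nhds hu.1)).exists).imp fun _ h => le_of_lt h
  have h1 : ∃ a, u ≤ cdf κ a :=
    (((tendsto_cdf_atTop κ).eventually (lt_mem_nhds hu.2)).exists).imp fun _ h => le_of_lt h
  exact mem_range_of_exists_le_of_exists_ge hκ h0 h1

/-- The sublevel set is a closed half-line, and continuity makes the distribution function equal to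
u at its endpoint. Flat stretches do no harm, since the endpoint is the largest point at level u. -/
lemma measure_cdf_le (hκ : Continuous (cdf κ)) {u : ℝ} (hu : u ∈ Set.Ioo (0 : ℝ) 1) :
    κ {x | cdf κ x ≤ u} = ENNReal.ofReal u := by
  set S : Set ℝ := {x | cdf κ x ≤ u}
  obtain ⟨x₀, hx₀⟩ := exists_cdf_eq hκ hu
  obtain ⟨b, hb⟩ := ((tendsto_cdf_atTop κ).eventually (lt_mem_nhds hu.2)).exists
  have hSb : BddAbove S := ⟨b, fun x hx => le_of_lt ((cdf κ).mono.reflect_lt (hx.trans_lt hb))⟩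
  have hSc : IsClosed S := isClosed_le hκ continuous_const
  have hSn : S.Nonempty := ⟨x₀, hx₀.le⟩
  have hs : sSup S ∈ S := hSc.csSup_mem hSn hSb
  have hle : cdf κ (sSup S) = u :=
    le_antisymm hs (hx₀.symm.le.trans ((cdf κ).mono (le_csSup hSb hx₀.le)))
  have : S = Set.Iic (sSup S) :=
    Set.Subset.antisymm (fun x hx => le_csSup hSb hx)
      fun x hx => ((cdf κ).mono hx).trans hs
  rw [this, ← ofReal_cdf, hle]

lemma ae_cdf_mem_Ioo (hκ : Continuous (cdf κ)) : ∀ᵐ x ∂κ, cdf κ x ∈ Set.Ioo (0 : ℝ) 1 := by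
  -- The shift by 2 keeps every level strictly below 1, including k = 0.
  have hlim : Tendsto (fun k : ℕ => 1 / ((k : ℝ) + 2)) atTop (𝓝 0) := by
    have := (tendsto_one_div_add_atTop_nhds_zero_nat (𝕜 := ℝ)).comp (tendsto_add_atTop_nat 1)
    refine this.congr fun k => ?_
    simp only [Function.comp_apply]; push_cast; ring_nf
  have hmem : ∀ k : ℕ, 1 / ((k : ℝ) + 2) ∈ Set.Ioo (0 : ℝ) 1 := fun k => by
    have : (0 : ℝ) ≤ k := Nat.cast_nonneg k
    exact ⟨by positivity, by rw [div_lt_one (by positivity)]; linarith⟩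
  have hmem' : ∀ k : ℕ, 1 - 1 / ((k : ℝ) + 2) ∈ Set.Ioo (0 : ℝ) 1 := fun k =>
    ⟨by linarith [(hmem k).2], by linarith [(hmem k).1]⟩
  have h0 : κ {x | cdf κ x ≤ 0} = 0 := by
    refine le_antisymm (ge_of_tendsto' (x := atTop)
      (f := fun k : ℕ => ENNReal.ofReal (1 / ((k : ℝ) + 2))) ?_ fun k => ?_) zero_le
    · simpa [Function.comp_def] using (ENNReal.continuous_ofReal.tendsto 0).comp hlim
    · rw [← measure_cdf_le hκ (hmem k)]
      exact measure_mono fun x (hx : cdf κ x ≤ 0) => hx.trans (hmem k).1.le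
  have h1 : κ {x | 1 ≤ cdf κ x} = 0 := by
    refine le_antisymm (ge_of_tendsto' (x := atTop)
      (f := fun k : ℕ => ENNReal.ofReal (1 / ((k : ℝ) + 2))) ?_ fun k => ?_) zero_le
    · simpa [Function.comp_def] using (ENNReal.continuous_ofReal.tendsto 0).comp hlim
    · have hm : MeasurableSet {x | cdf κ x ≤ 1 - 1 / ((k : ℝ) + 2)} :=
        (isClosed_le hκ continuous_const).measurableSet
      have hc := prob_compl_eq_one_sub (μ := κ) hm
      rw [measure_cdf_le hκ (hmem' k), ← ENNReal.ofReal_one, ← ENNReal.ofReal_sub _ (hmem' k).1.le,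
        sub_sub_cancel] at hc
      rw [← hc]
      refine measure_mono fun x (hx : 1 ≤ cdf κ x) => ?_
      simp only [Set.mem_compl_iff, Set.mem_ofPred_eq, not_le]
      linarith [(hmem' k).2]
  rw [ae_iff]
  refine measure_mono_null (t := {x | cdf κ x ≤ 0} ∪ {x | 1 ≤ cdf κ x}) (fun x hx => ?_)
    (measure_union_null h0 h1)
  simp only [Set.mem_ofPred_eq, Set.mem_Ioo, not_and_or, not_lt] at hx
  exact hx

end

lemma gaussianReal_singleton (x : ℝ) : γ₁ {x} = 0 :=
  gaussianReal_absolutelyContinuous 0 one_ne_zero (by simp)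

lemma continuous_cdf_gaussianReal : Continuous (cdf γ₁) :=
  continuous_cdf_of_singleton gaussianReal_singleton

open scoped Classical in
/-- The quantile function of the standard Gaussian, set to `0` outside `(0, 1)`. -/
noncomputable def gaussQuantile (u : ℝ) : ℝ :=
  if u ∈ Set.Ioo (0 : ℝ) 1 then sInf {z | u ≤ cdf γ₁ z} else 0

/-- Continuity makes the superlevel set closed, so the infimum defining the quantile is attained. -/
lemma gaussQuantile_le_iff {u : ℝ} (hu : u ∈ Set.Ioo (0 : ℝ) 1) (z : ℝ) :
    gaussQuantile u ≤ z ↔ u ≤ cdf γ₁ z := by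
  rw [gaussQuantile, if_pos hu]
  set S : Set ℝ := {z | u ≤ cdf γ₁ z}
  obtain ⟨x₀, hx₀⟩ := exists_cdf_eq continuous_cdf_gaussianReal hu
  obtain ⟨b, hb⟩ := ((tendsto_cdf_atBot γ₁).eventually (gt_mem_nhds hu.1)).exists
  have hSb : BddBelow S := ⟨b, fun x hx => le_of_lt ((cdf γ₁).mono.reflect_lt (hb.trans_le hx))⟩
  have hSc : IsClosed S := isClosed_le continuous_const continuous_cdf_gaussianReal
  have hs : sInf S ∈ S := hSc.csInf_mem ⟨x₀, hx₀.symm.le⟩ hSb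
  exact ⟨fun h => hs.trans ((cdf γ₁).mono h), fun h => csInf_le hSb h⟩

lemma cdf_gaussQuantile {u : ℝ} (hu : u ∈ Set.Ioo (0 : ℝ) 1) : cdf γ₁ (gaussQuantile u) = u := by
  refine le_antisymm ?_ ((gaussQuantile_le_iff hu _).1 le_rfl)
  obtain ⟨x₀, hx₀⟩ := exists_cdf_eq continuous_cdf_gaussianReal hu
  have := (gaussQuantile_le_iff hu x₀).2 hx₀.symm.le
  exact ((cdf γ₁).mono this).trans hx₀.le

lemma measurable_gaussQuantile : Measurable gaussQuantile := by
  refine measurable_of_Iic fun c => ?_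
  have : gaussQuantile ⁻¹' Set.Iic c = (Set.Ioo 0 1 ∩ Set.Iic (cdf γ₁ c)) ∪
      ((Set.Ioo 0 1)ᶜ ∩ {_u : ℝ | 0 ≤ c}) := by
    ext u
    by_cases hu : u ∈ Set.Ioo (0 : ℝ) 1
    · simp only [Set.mem_preimage, Set.mem_Iic, gaussQuantile_le_iff hu, Set.mem_union,
        Set.mem_inter_iff, Set.mem_compl_iff, hu, true_and, not_true_eq_false, false_and, or_false]
    · simp only [Set.mem_preimage, Set.mem_Iic, Set.mem_union, Set.mem_inter_iff,
        Set.mem_compl_iff, hu, false_and, not_false_eq_true, true_and, false_or, gaussQuantile,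
        if_false, Set.mem_ofPred_eq]
  rw [this]
  exact (measurableSet_Ioo.inter measurableSet_Iic).union
    (measurableSet_Ioo.compl.inter (MeasurableSet.const _))

lemma gaussianPDFReal_std (z : ℝ) :
    gaussianPDFReal 0 1 z = (√(2 * Real.pi))⁻¹ * Real.exp (-z ^ 2 / 2) := by
  simp [gaussianPDFReal]

lemma hasDerivAt_gaussianPDFReal (z : ℝ) :
    HasDerivAt (gaussianPDFReal 0 1) (-(z * gaussianPDFReal 0 1 z)) z := by
  have h1 : HasDerivAt (fun z : ℝ => -z ^ 2 / 2) (-z) z := by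
    have := ((hasDerivAt_pow 2 z).neg).div_const 2
    refine this.congr_deriv ?_
    simp only [Nat.cast_ofNat, Nat.add_one_sub_one, pow_one]
    ring
  have h2 := (h1.exp).const_mul (√(2 * Real.pi))⁻¹
  have h3 : gaussianPDFReal 0 1 = fun z => (√(2 * Real.pi))⁻¹ * Real.exp (-z ^ 2 / 2) :=
    funext gaussianPDFReal_std
  rw [h3]
  refine h2.congr_deriv ?_
  ring

lemma integrable_pow_gaussianReal (k : ℕ) : Integrable (fun z : ℝ => z ^ k) γ₁ := by
  have := (memLp_id_gaussianReal' (μ := 0) (v := 1) k (by simp)).integrable_norm_pow'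
  exact this.mono (Continuous.aestronglyMeasurable (by fun_prop))
    (ae_of_all _ fun z => by simp)

lemma integral_id_gaussianReal_std : ∫ z, z ∂γ₁ = 0 := by simp

lemma integral_sq_gaussianReal_std : ∫ z, z ^ 2 ∂γ₁ = 1 := by
  have h := variance_fun_id_gaussianReal (μ := 0) (v := 1)
  rw [variance_of_integral_eq_zero (by fun_prop) integral_id_gaussianReal_std] at h
  simpa using h

/-- The Gaussian density φ satisfies φ' = -zφ, so -φ is a primitive of zφ and vanishes at infinity.
-/
lemma setIntegral_Ioi_gaussianReal (t : ℝ) : ∫ z in Set.Ioi t, z ∂γ₁ = gaussianPDFReal 0 1 t := by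
  have hint : Integrable fun z => z * gaussianPDFReal 0 1 z := by
    have := integrable_pow_gaussianReal 1
    rw [gaussianReal_of_var_ne_zero 0 one_ne_zero, integrable_withDensity_iff_integrable_smul'
      (measurable_gaussianPDF 0 1) (ae_of_all _ fun x => gaussianPDF_lt_top)] at this
    simpa [mul_comm] using this
  have hlim : Tendsto (fun z => -gaussianPDFReal 0 1 z) atTop (𝓝 0) := by
    have h1 : Tendsto (fun z : ℝ => z ^ 2 / 2) atTop atTop :=
      (tendsto_pow_atTop two_ne_zero).atTop_div_const two_pos
    have h2 := (Real.tendsto_exp_atBot.comp (tendsto_neg_atTop_atBot.comp h1)).const_mul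
      (-(√(2 * Real.pi))⁻¹)
    rw [mul_zero] at h2
    refine h2.congr fun z => ?_
    simp only [gaussianPDFReal_std, Function.comp_apply, neg_div]
    ring
  have h := integral_Ioi_of_hasDerivAt_of_tendsto' (a := t)
    (fun z _ => ((hasDerivAt_gaussianPDFReal z).neg).congr_deriv (neg_neg _))
    hint.integrableOn hlim
  rw [← integral_indicator measurableSet_Ioi, integral_gaussianReal_eq_integral_smul one_ne_zero]
  rw [Pi.neg_apply, zero_sub, neg_neg] at h
  rw [← h, ← integral_indicator measurableSet_Ioi]
  refine integral_congr_ae (ae_of_all _ fun z => ?_)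
  by_cases hz : z ∈ Set.Ioi t
  · simp [hz, mul_comm]
  · simp [hz]

section Slice

variable {κ : Measure ℝ} [IsProbabilityMeasure κ]

/-- The monotone map from `κ` to the standard Gaussian. -/
noncomputable def gaussTransport (κ : Measure ℝ) (x : ℝ) : ℝ := gaussQuantile (cdf κ x)

lemma measurable_gaussTransport : Measurable (gaussTransport κ) :=
  measurable_gaussQuantile.comp (cdf κ).mono.measurable

lemma map_gaussTransport (hκ : Continuous (cdf κ)) : κ.map (gaussTransport κ) = γ₁ := by
  have := Measure.isProbabilityMeasure_map (μ := κ)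
    (measurable_gaussTransport (κ := κ)).aemeasurable
  have hae := ae_cdf_mem_Ioo hκ
  refine Measure.ext_of_Iic _ _ fun z => ?_
  rw [Measure.map_apply measurable_gaussTransport measurableSet_Iic]
  have h1 : κ (gaussTransport κ ⁻¹' Set.Iic z) = κ {x | cdf κ x ≤ cdf γ₁ z} := by
    refine measure_congr ?_
    filter_upwards [hae] with x hx
    exact propext (gaussQuantile_le_iff hx z)
  rw [h1, ← ofReal_cdf γ₁]
  rcases (cdf_nonneg γ₁ z).eq_or_lt with h | h
  · rw [← h, ENNReal.ofReal_zero]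
    refine measure_mono_null (t := {x | ¬ cdf κ x ∈ Set.Ioo (0 : ℝ) 1}) (fun x hx hx' => ?_)
      (ae_iff.1 hae)
    exact absurd hx (not_le.2 hx'.1)
  rcases (cdf_le_one γ₁ z).eq_or_lt with h' | h'
  · rw [h', ENNReal.ofReal_one]
    have : {x | cdf κ x ≤ 1} = Set.univ := Set.eq_univ_of_forall fun x => cdf_le_one κ x
    rw [this, measure_univ]
  · exact measure_cdf_le hκ ⟨h, h'⟩

lemma integrable_gaussTransport_pow (hκ : Continuous (cdf κ)) (k : ℕ) :
    Integrable (fun x => gaussTransport κ x ^ k) κ := by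
  have := integrable_pow_gaussianReal k
  rw [← map_gaussTransport hκ] at this
  exact this.comp_measurable measurable_gaussTransport

lemma integral_gaussTransport (hκ : Continuous (cdf κ)) (f : ℝ → ℝ) (hf : Measurable f) :
    ∫ x, f (gaussTransport κ x) ∂κ = ∫ z, f z ∂γ₁ := by
  rw [← map_gaussTransport hκ, integral_map measurable_gaussTransport.aemeasurable
    hf.aestronglyMeasurable]

/-- Monotonicity turns the half-line beyond x into the half-line beyond T(x), up to a null set. This
identity takes the place of the differential equation for T, so no derivative of T is needed. -/
lemma setIntegral_Ioi_gaussTransport (hκ : Continuous (cdf κ)) {x : ℝ}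
    (hx : cdf κ x ∈ Set.Ioo (0 : ℝ) 1) :
    ∫ y in Set.Ioi x, gaussTransport κ y ∂κ = gaussianPDFReal 0 1 (gaussTransport κ x) := by
  have hae := ae_cdf_mem_Ioo hκ
  -- T fails to be strictly increasing only where the distribution function is flat, and such
  -- stretches carry no mass.
  have hnull : κ ({y | cdf κ y ≤ cdf κ x} \ Set.Iic x) = 0 := by
    have hsub : Set.Iic x ⊆ {y | cdf κ y ≤ cdf κ x} := fun y hy => (cdf κ).mono hy
    rw [measure_sdiff hsub measurableSet_Iic.nullMeasurableSet (measure_ne_top _ _),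
      measure_cdf_le hκ hx, ← ofReal_cdf, tsub_self]
  have hset : (Set.Ioi x : Set ℝ) =ᵐ[κ] gaussTransport κ ⁻¹' Set.Ioi (gaussTransport κ x) := by
    have hnull' := measure_eq_zero_iff_ae_notMem.1 hnull
    filter_upwards [hae, hnull'] with y hy hy'
    refine propext ?_
    change x < y ↔ gaussTransport κ x < gaussTransport κ y
    have h1 : gaussTransport κ y ≤ gaussTransport κ x ↔ cdf κ y ≤ cdf κ x := by
      rw [gaussTransport, gaussQuantile_le_iff hy, gaussTransport, cdf_gaussQuantile hx]
    rw [← not_le, ← not_le, not_iff_not, h1]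
    refine ⟨fun h => (cdf κ).mono h, fun h => ?_⟩
    by_contra hc
    exact hy' ⟨h, hc⟩
  rw [setIntegral_congr_set hset, ← setIntegral_Ioi_gaussianReal, ← map_gaussTransport hκ,
    setIntegral_map measurableSet_Ioi (by fun_prop) measurable_gaussTransport.aemeasurable]

/-- At level 0 the half-line carries all the mass and T has mean zero; at level 1 it carries none.
-/
lemma setIntegral_Ioi_gaussTransport_nonneg (hκ : Continuous (cdf κ)) (x : ℝ) :
    0 ≤ ∫ y in Set.Ioi x, gaussTransport κ y ∂κ := by
  by_cases hx : cdf κ x ∈ Set.Ioo (0 : ℝ) 1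
  · rw [setIntegral_Ioi_gaussTransport hκ hx]
    exact gaussianPDFReal_nonneg _ _ _
  have hIic : κ (Set.Iic x) = ENNReal.ofReal (cdf κ x) := (ofReal_cdf κ x).symm
  rw [Set.mem_Ioo, not_and_or, not_lt, not_lt] at hx
  rcases hx with hx | hx
  · have h0 : κ (Set.Iic x) = 0 := by rw [hIic]; exact ENNReal.ofReal_eq_zero.2 hx
    have : (Set.Ioi x : Set ℝ) =ᵐ[κ] Set.univ := by
      have := measure_eq_zero_iff_ae_notMem.1 h0
      filter_upwards [this] with y hy
      refine propext ⟨fun _ => trivial, fun _ => ?_⟩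
      exact not_le.1 hy
    rw [setIntegral_congr_set this, setIntegral_univ,
      integral_gaussTransport hκ (fun z => z) measurable_id, integral_id_gaussianReal_std]
  · have h1 : κ (Set.Ioi x) = 0 := by
      rw [← Set.compl_Iic, prob_compl_eq_zero_iff measurableSet_Iic, hIic,
        le_antisymm (cdf_le_one κ x) hx, ENNReal.ofReal_one]
    rw [setIntegral_measure_zero _ h1]

/-- The layer-cake representation of a signed number; subtracting the indicator at 0 makes it
integrable. -/
lemma integral_indicator_Ioi_sub (y : ℝ) :
    Integrable (fun x => (Set.Ioi x).indicator (fun _ => (1 : ℝ)) y -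
      (Set.Ioi x).indicator (fun _ => (1 : ℝ)) 0) ∧
    ∫ x, ((Set.Ioi x).indicator (fun _ => (1 : ℝ)) y -
      (Set.Ioi x).indicator (fun _ => (1 : ℝ)) 0) = y ∧
    ∫ x, ‖(Set.Ioi x).indicator (fun _ => (1 : ℝ)) y -
      (Set.Ioi x).indicator (fun _ => (1 : ℝ)) 0‖ = |y| := by
  rcases le_total 0 y with hy | hy
  · have e : (fun x => (Set.Ioi x).indicator (fun _ => (1 : ℝ)) y -
        (Set.Ioi x).indicator (fun _ => (1 : ℝ)) 0) = (Set.Ico 0 y).indicator fun _ => (1 : ℝ) := by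
      ext x
      simp only [Set.indicator, Set.mem_Ioi, Set.mem_Ico]
      split_ifs <;> grind
    have e2 : ∀ x, ‖(Set.Ico 0 y).indicator (fun _ => (1 : ℝ)) x‖ =
        (Set.Ico 0 y).indicator (fun _ => (1 : ℝ)) x := fun x =>
      Real.norm_of_nonneg (Set.indicator_nonneg (fun _ _ => zero_le_one) _)
    have i : Integrable ((Set.Ico 0 y).indicator fun _ => (1 : ℝ)) :=
      (integrable_indicator_iff measurableSet_Ico).2 (by simp)
    have v : ∫ x, (Set.Ico 0 y).indicator (fun _ => (1 : ℝ)) x = y := by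
      rw [integral_indicator measurableSet_Ico]
      simp [hy]
    refine ⟨e ▸ i, ?_, ?_⟩
    · rw [e, v]
    · simp only [congrFun e, e2]
      rw [v, abs_of_nonneg hy]
  · have e : (fun x => (Set.Ioi x).indicator (fun _ => (1 : ℝ)) y -
        (Set.Ioi x).indicator (fun _ => (1 : ℝ)) 0) =
        fun x => -(Set.Ico y 0).indicator (fun _ => (1 : ℝ)) x := by
      ext x
      simp only [Set.indicator, Set.mem_Ioi, Set.mem_Ico]
      split_ifs <;> grind
    have e2 : ∀ x, ‖-(Set.Ico y 0).indicator (fun _ => (1 : ℝ)) x‖ =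
        (Set.Ico y 0).indicator (fun _ => (1 : ℝ)) x := fun x => by
      rw [norm_neg]
      exact Real.norm_of_nonneg (Set.indicator_nonneg (fun _ _ => zero_le_one) _)
    have i : Integrable ((Set.Ico y 0).indicator fun _ => (1 : ℝ)) :=
      (integrable_indicator_iff measurableSet_Ico).2 (by simp)
    have v : ∫ x, (Set.Ico y 0).indicator (fun _ => (1 : ℝ)) x = -y := by
      rw [integral_indicator measurableSet_Ico]
      simp [hy]
    refine ⟨e ▸ i.neg, ?_, ?_⟩
    · rw [e, integral_neg, v, neg_neg]
    · simp only [congrFun e, e2]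
      rw [v, abs_of_nonpos hy]

/-- Layer-cake formula for the correlation of the monotone transport with the identity. -/
lemma lintegral_setIntegral_Ioi_gaussTransport (hκ : Continuous (cdf κ))
    (h2 : Integrable (fun x => x ^ 2) κ) :
    0 ≤ ∫ y, gaussTransport κ y * y ∂κ ∧
    ∫⁻ x, ENNReal.ofReal (∫ y in Set.Ioi x, gaussTransport κ y ∂κ) =
      ENNReal.ofReal (∫ y, gaussTransport κ y * y ∂κ) := by
  let T := gaussTransport κ
  let k : ℝ → ℝ → ℝ := fun y x => (Set.Ioi x).indicator (fun _ => (1 : ℝ)) y -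
      (Set.Ioi x).indicator (fun _ => (1 : ℝ)) 0
  have hT : Measurable T := measurable_gaussTransport
  have hT1 : Integrable T κ := by simpa using integrable_gaussTransport_pow hκ 1
  have hT2 := integrable_gaussTransport_pow hκ 2
  have hT0 : ∫ y, T y ∂κ = 0 := by
    rw [show ∫ y, T y ∂κ = _ from integral_gaussTransport hκ (fun z => z) measurable_id,
      integral_id_gaussianReal_std]
  have hk : Measurable fun q : ℝ × ℝ => k q.1 q.2 := by
    have m1 : MeasurableSet {q : ℝ × ℝ | q.2 < q.1} := measurableSet_lt measurable_snd measurable_fst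
    have m2 : MeasurableSet {q : ℝ × ℝ | q.2 < 0} := measurableSet_lt measurable_snd measurable_const
    exact (measurable_const.indicator m1).sub (measurable_const.indicator m2)
  have hTy : Integrable (fun y => T y * y) κ := by
    refine (hT2.add h2).mono' (hT.mul measurable_id).aestronglyMeasurable (ae_of_all _ fun y => ?_)
    simp only [Pi.add_apply, Real.norm_eq_abs, abs_mul]
    change |T y| * |y| ≤ T y ^ 2 + y ^ 2
    nlinarith [sq_nonneg (|T y| - |y|), sq_abs (T y), sq_abs y, sq_nonneg (T y), sq_nonneg y]
  have hprod : Integrable (fun q : ℝ × ℝ => T q.1 * k q.1 q.2) (κ.prod volume) := by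
    refine (integrable_prod_iff ((hT.comp measurable_fst).mul hk).aestronglyMeasurable).2 ⟨ae_of_all _ fun y => ((integral_indicator_Ioi_sub y).1).const_mul (T y), ?_⟩
    refine hTy.norm.congr (ae_of_all _ fun y => ?_)
    change ‖T y * y‖ = ∫ x, ‖T y * k y x‖
    simp only [norm_mul]
    rw [integral_const_mul]
    congr 1
    exact ((integral_indicator_Ioi_sub y).2.2).symm
  -- The subtracted indicator does not depend on y, so it disappears because T has mean zero.
  have hG : ∀ x, ∫ y, T y * k y x ∂κ = ∫ y in Set.Ioi x, T y ∂κ := fun x => by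
    have e : (fun y => T y * k y x) = fun y => (Set.Ioi x).indicator T y -
        (Set.Ioi x).indicator (fun _ => (1 : ℝ)) 0 * T y := by
      ext y
      simp only [k, Set.indicator]
      split_ifs <;> ring
    rw [e, integral_sub (hT1.indicator measurableSet_Ioi) (hT1.const_mul _), integral_const_mul, hT0,
      mul_zero, sub_zero, integral_indicator measurableSet_Ioi]
  have hGi := hprod.integral_prod_right
  simp only [hG] at hGi
  have hG0 := fun x => setIntegral_Ioi_gaussTransport_nonneg hκ x
  rw [← ofReal_integral_eq_lintegral_ofReal hGi (ae_of_all _ hG0)]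
  suffices h : ∫ x, ∫ y in Set.Ioi x, T y ∂κ = ∫ y, T y * y ∂κ from
    ⟨h ▸ integral_nonneg hG0, congrArg ENNReal.ofReal h⟩
  simp only [← hG]
  rw [← integral_prod_symm _ hprod, integral_prod _ hprod]
  refine integral_congr_ae (ae_of_all _ fun y => ?_)
  simp only [integral_const_mul]
  rw [show ∫ x, k y x = y from (integral_indicator_Ioi_sub y).2.1]

end Slice

end MonotoneTransport

/-! ### Talagrand's inequality on the fibres of a kernel. -/

section FibreTransport

local notation "γ₁" => gaussianReal 0 1

variable {α : Type*} [MeasurableSpace α] {ρ : Measure α} [IsProbabilityMeasure ρ]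
  {κ : Kernel α ℝ} [IsMarkovKernel κ]

lemma measurable_cdf_kernel : Measurable fun q : α × ℝ => cdf (κ q.1) q.2 := by
  have ht : MeasurableSet {r : (α × ℝ) × ℝ | r.2 ≤ r.1.2} :=
    measurableSet_le measurable_snd (measurable_snd.comp measurable_fst)
  have h := (Kernel.measurable_kernel_prodMk_left (κ := κ.prodMkRight ℝ) ht).ennreal_toReal
  convert h using 2 with q
  rw [cdf_eq_real]
  rfl

lemma measurable_gaussTransport_kernel :
    Measurable fun q : α × ℝ => gaussTransport (κ q.1) q.2 :=
  measurable_gaussQuantile.comp measurable_cdf_kernel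

lemma ae_continuous_cdf (hac : ρ ⊗ₘ κ ≪ ρ.prod γ₁) : ∀ᵐ a ∂ρ, Continuous (cdf (κ a)) := by
  rw [← Measure.compProd_const, Measure.absolutelyContinuous_compProd_right_iff] at hac
  filter_upwards [hac] with a ha
  exact continuous_cdf_of_singleton fun x => ha (by simpa using gaussianReal_singleton x)

lemma lintegral_gaussTransport_kernel (hac : ρ ⊗ₘ κ ≪ ρ.prod γ₁) (g : ℝ → ENNReal)
    (hg : Measurable g) :
    ∫⁻ q, g (gaussTransport (κ q.1) q.2) ∂(ρ ⊗ₘ κ) = ∫⁻ z, g z ∂γ₁ := by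
  rw [Measure.lintegral_compProd (f := fun q => g (gaussTransport (κ q.1) q.2))
    (hg.comp measurable_gaussTransport_kernel)]
  have : ∀ᵐ a ∂ρ, ∫⁻ x, g (gaussTransport (κ a) x) ∂(κ a) = ∫⁻ z, g z ∂γ₁ := by
    filter_upwards [ae_continuous_cdf hac] with a ha
    rw [← map_gaussTransport ha, lintegral_map hg measurable_gaussTransport]
  rw [lintegral_congr_ae this]
  simp

open scoped Classical in
/-- The Gaussian density along the fibrewise transport, set to `0` outside the range of levels
`(0, 1)`. -/
noncomputable def transportPDF (κ : Kernel α ℝ) (q : α × ℝ) : ℝ :=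
  if cdf (κ q.1) q.2 ∈ Set.Ioo (0 : ℝ) 1 then gaussianPDFReal 0 1 (gaussTransport (κ q.1) q.2) else 0

lemma measurable_transportPDF : Measurable (transportPDF κ) := by
  refine Measurable.ite (measurable_cdf_kernel measurableSet_Ioo) ?_ measurable_const
  exact (measurable_gaussianPDFReal 0 1).comp measurable_gaussTransport_kernel

lemma transportPDF_nonneg (q : α × ℝ) : 0 ≤ transportPDF κ q := by
  rw [transportPDF]
  split_ifs
  · exact gaussianPDFReal_nonneg _ _ _
  · exact le_rfl

lemma transportPDF_le {a : α} (ha : Continuous (cdf (κ a))) (x : ℝ) :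
    transportPDF κ (a, x) ≤ ∫ y in Set.Ioi x, gaussTransport (κ a) y ∂(κ a) := by
  rw [transportPDF]
  split_ifs with h
  · exact (setIntegral_Ioi_gaussTransport ha h).ge
  · exact setIntegral_Ioi_gaussTransport_nonneg ha x

lemma moments_gaussTransport_kernel (hac : ρ ⊗ₘ κ ≪ ρ.prod γ₁)
    (h2 : Integrable (fun q : α × ℝ => q.2 ^ 2) (ρ ⊗ₘ κ)) :
    Integrable (fun q : α × ℝ => gaussTransport (κ q.1) q.2 ^ 2) (ρ ⊗ₘ κ) ∧
    ∫ q, gaussTransport (κ q.1) q.2 ^ 2 ∂(ρ ⊗ₘ κ) = 1 ∧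
    Integrable (fun q : α × ℝ => gaussTransport (κ q.1) q.2 * q.2) (ρ ⊗ₘ κ) := by
  have hT : Measurable fun q : α × ℝ => gaussTransport (κ q.1) q.2 :=
    measurable_gaussTransport_kernel
  have hl := lintegral_gaussTransport_kernel hac (fun z => ENNReal.ofReal (z ^ 2))
    (by fun_prop)
  rw [← ofReal_integral_eq_lintegral_ofReal (integrable_pow_gaussianReal 2)
    (ae_of_all _ fun z => sq_nonneg z), integral_sq_gaussianReal_std] at hl
  have hT2 : Integrable (fun q : α × ℝ => gaussTransport (κ q.1) q.2 ^ 2) (ρ ⊗ₘ κ) := by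
    refine ⟨(hT.pow_const 2).aestronglyMeasurable, ?_⟩
    rw [hasFiniteIntegral_iff_ofReal (ae_of_all _ fun q => sq_nonneg _), hl]
    simp
  refine ⟨hT2, ?_, ?_⟩
  · rw [integral_eq_lintegral_of_nonneg_ae (ae_of_all _ fun q => sq_nonneg _)
      hT2.aestronglyMeasurable, hl]
    simp
  · refine (hT2.add h2).mono' (hT.mul measurable_snd).aestronglyMeasurable (ae_of_all _ fun q => ?_)
    simp only [Pi.add_apply, Real.norm_eq_abs, abs_mul]
    set t := gaussTransport (κ q.1) q.2
    nlinarith [sq_nonneg (|t| - |q.2|), sq_abs t, sq_abs q.2, sq_nonneg t, sq_nonneg q.2]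

/-- On a fibre, dividing by the Gaussian density turns the left side into a Lebesgue integral. The
tail identity bounds its integrand by the tail integral of T, and the layer-cake formula identifies
the total with the correlation of T and the identity. -/
lemma lintegral_transportPDF_le (hac : ρ ⊗ₘ κ ≪ ρ.prod γ₁)
    (h2 : Integrable (fun q : α × ℝ => q.2 ^ 2) (ρ ⊗ₘ κ)) :
    ∫⁻ q, ENNReal.ofReal (transportPDF κ q / gaussianPDFReal 0 1 q.2) ∂(ρ.prod γ₁) ≤
      ENNReal.ofReal (∫ q, gaussTransport (κ q.1) q.2 * q.2 ∂(ρ ⊗ₘ κ)) := by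
  have hm : Measurable fun q : α × ℝ =>
      ENNReal.ofReal (transportPDF κ q / gaussianPDFReal 0 1 q.2) :=
    (measurable_transportPDF.div ((measurable_gaussianPDFReal 0 1).comp measurable_snd)).ennreal_ofReal
  obtain ⟨-, -, hTx⟩ := moments_gaussTransport_kernel hac h2
  have h2' := Measure.integrable_compProd_iff (h2.aestronglyMeasurable) |>.1 h2
  have hTi : Integrable (fun a => ∫ x, gaussTransport (κ a) x * x ∂(κ a)) ρ :=
    Integrable.integral_compProd (κ := Kernel.const Unit ρ) (η := Kernel.prodMkLeft Unit κ)
      (a := ()) hTx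
  have hfib : ∀ᵐ a ∂ρ, 0 ≤ ∫ x, gaussTransport (κ a) x * x ∂(κ a) ∧
      ∫⁻ x, ENNReal.ofReal (transportPDF κ (a, x) / gaussianPDFReal 0 1 x) ∂γ₁ ≤
        ENNReal.ofReal (∫ x, gaussTransport (κ a) x * x ∂(κ a)) := by
    filter_upwards [ae_continuous_cdf hac, h2'.1] with a ha ha2
    obtain ⟨h0, h1⟩ := lintegral_setIntegral_Ioi_gaussTransport ha ha2
    refine ⟨h0, ?_⟩
    rw [← h1, gaussianReal_of_var_ne_zero 0 one_ne_zero,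
      lintegral_withDensity_eq_lintegral_mul _ (measurable_gaussianPDF 0 1)
        (g := fun x => ENNReal.ofReal (transportPDF κ (a, x) / gaussianPDFReal 0 1 x))
        (hm.comp measurable_prodMk_left)]
    refine lintegral_mono fun x => ?_
    simp only [Pi.mul_apply, gaussianPDF]
    rw [← ENNReal.ofReal_mul (gaussianPDFReal_nonneg _ _ _),
      mul_div_cancel₀ _ (gaussianPDFReal_pos 0 1 x one_ne_zero).ne']
    exact ENNReal.ofReal_le_ofReal (transportPDF_le ha x)
  rw [lintegral_prod _ hm.aemeasurable, Measure.integral_compProd hTx,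
    ofReal_integral_eq_lintegral_ofReal hTi (hfib.mono fun a h => h.1)]
  exact lintegral_mono_ae (hfib.mono fun a h => h.2)

/-- Talagrand's transport inequality along one-dimensional fibres. -/
theorem lintegral_sq_sub_gaussTransport_le (hkl : klDiv (ρ ⊗ₘ κ) (ρ.prod γ₁) ≠ ⊤)
    (h2 : Integrable (fun q : α × ℝ => q.2 ^ 2) (ρ ⊗ₘ κ)) :
    ∫⁻ q, ENNReal.ofReal ((q.2 - gaussTransport (κ q.1) q.2) ^ 2) ∂(ρ ⊗ₘ κ) ≤
      2 * klDiv (ρ ⊗ₘ κ) (ρ.prod γ₁) := by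
  obtain ⟨hac, hllr⟩ := klDiv_ne_top_iff.1 hkl
  obtain ⟨hT2, hT2v, hTx⟩ := moments_gaussTransport_kernel hac h2
  set μ := ρ ⊗ₘ κ with hμ
  set ν := ρ.prod γ₁ with hν
  set T : α × ℝ → ℝ := fun q => gaussTransport (κ q.1) q.2 with hTdef
  have hTm : Measurable T := measurable_gaussTransport_kernel
  let q₁ : α × ℝ → ℝ := fun q => gaussianPDFReal 0 1 q.2
  have hq₁ : ∀ q, 0 < q₁ q := fun q => gaussianPDFReal_pos 0 1 q.2 one_ne_zero
  let f : α × ℝ → ℝ := fun q => (μ.rnDeriv ν q).toReal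
  -- Formally R is 1/T', because q₁ f is the density on the fibre and q₁ f = φ(T) T', with φ the
  -- Gaussian density; defining it as a quotient avoids differentiating T.
  let R : α × ℝ → ℝ := fun q => transportPDF κ q / q₁ q / f q
  have hR0 : ∀ q, 0 ≤ R q := fun q =>
    div_nonneg (div_nonneg (transportPDF_nonneg q) (hq₁ q).le) ENNReal.toReal_nonneg
  have hRm : Measurable R :=
    (measurable_transportPDF.div ((measurable_gaussianPDFReal 0 1).comp measurable_snd)).div
      (Measure.measurable_rnDeriv μ ν).ennreal_toReal
  have hRl : ∫⁻ q, ENNReal.ofReal (R q) ∂μ ≤ ENNReal.ofReal (∫ q, T q * q.2 ∂μ) := by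
    rw [← lintegral_rnDeriv_mul hac hRm.ennreal_ofReal.aemeasurable]
    refine le_trans (lintegral_mono_ae ?_) (lintegral_transportPDF_le hac h2)
    filter_upwards [Measure.rnDeriv_ne_top μ ν] with q hq
    rw [← ENNReal.ofReal_toReal hq, ← ENNReal.ofReal_mul ENNReal.toReal_nonneg]
    refine ENNReal.ofReal_le_ofReal ?_
    change f q * (transportPDF κ q / q₁ q / f q) ≤ transportPDF κ q / q₁ q
    rcases eq_or_ne (f q) 0 with h | h
    · rw [h, zero_mul]
      exact div_nonneg (transportPDF_nonneg q) (hq₁ q).le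
    · rw [mul_div_cancel₀ _ h]
  have hRi : Integrable R μ := by
    refine ⟨hRm.aestronglyMeasurable, ?_⟩
    rw [hasFiniteIntegral_iff_ofReal (ae_of_all _ hR0)]
    exact hRl.trans_lt ENNReal.ofReal_lt_top
  have hcorr : 0 ≤ ∫ q, T q * q.2 ∂μ := by
    rw [Measure.integral_compProd hTx]
    refine integral_nonneg_of_ae ?_
    filter_upwards [ae_continuous_cdf hac,
      ((Measure.integrable_compProd_iff (h2.aestronglyMeasurable)).1 h2).1] with a ha ha2
    exact (lintegral_setIntegral_Ioi_gaussTransport ha ha2).1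
  have hRv : ∫ q, R q ∂μ ≤ ∫ q, T q * q.2 ∂μ := by
    rw [← ofReal_integral_eq_lintegral_ofReal hRi (ae_of_all _ hR0)] at hRl
    exact (ENNReal.ofReal_le_ofReal_iff hcorr).1 hRl
  -- This is log R ≤ R - 1 with the Gaussian densities written out. Once integrated, with the
  -- integral of T² equal to 1 and that of R at most that of T x, the left side is at least half the
  -- transport cost.
  have hpt : ∀ᵐ q ∂μ, q.2 ^ 2 / 2 - T q ^ 2 / 2 + 1 - R q ≤ llr μ ν q := by
    have hmem : ∀ᵐ q ∂μ, cdf (κ q.1) q.2 ∈ Set.Ioo (0 : ℝ) 1 := by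
      refine Measure.ae_compProd_of_ae_ae (measurable_cdf_kernel measurableSet_Ioo) ?_
      filter_upwards [ae_continuous_cdf hac] with a ha
      exact ae_cdf_mem_Ioo ha
    filter_upwards [Measure.rnDeriv_pos hac, hac.ae_le (Measure.rnDeriv_ne_top μ ν), hmem]
      with q hf hf' hq
    have hf : 0 < f q := ENNReal.toReal_pos hf.ne' hf'
    have e : transportPDF κ q = gaussianPDFReal 0 1 (T q) := by rw [transportPDF, if_pos hq]
    have hTq : 0 < gaussianPDFReal 0 1 (T q) := gaussianPDFReal_pos _ _ _ one_ne_zero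
    have hlog : ∀ z, Real.log (gaussianPDFReal 0 1 z) = Real.log (√(2 * Real.pi))⁻¹ + -z ^ 2 / 2 :=
      fun z => by
        rw [gaussianPDFReal_std, Real.log_mul (by positivity) (Real.exp_pos _).ne', Real.log_exp]
    have h := Real.log_le_sub_one_of_pos (div_pos (div_pos hTq (hq₁ q)) hf)
    rw [Real.log_div (div_pos hTq (hq₁ q)).ne' hf.ne', Real.log_div hTq.ne' (hq₁ q).ne', hlog,
      show Real.log (q₁ q) = _ from hlog q.2] at h
    change _ - _ + 1 - transportPDF κ q / q₁ q / f q ≤ Real.log (f q)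
    rw [e]
    linarith
  have hle := integral_mono_ae ((((h2.div_const 2).sub (hT2.div_const 2)).add
    (integrable_const 1)).sub hRi) hllr hpt
  have hv : ∫ q, (q.2 ^ 2 / 2 - T q ^ 2 / 2 + 1 - R q) ∂μ =
      (∫ q, q.2 ^ 2 ∂μ) / 2 - 1 / 2 + 1 - ∫ q, R q ∂μ := by
    have i1 : Integrable (fun q => q.2 ^ 2 / 2 - T q ^ 2 / 2) μ :=
      (h2.div_const 2).sub (hT2.div_const 2)
    have i2 : Integrable (fun q => q.2 ^ 2 / 2 - T q ^ 2 / 2 + 1) μ := i1.add (integrable_const 1)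
    rw [integral_sub i2 hRi, integral_add i1 (integrable_const 1),
      integral_sub (h2.div_const 2) (hT2.div_const 2), integral_div, integral_div, hT2v]
    simp
  have hs : Integrable (fun q : α × ℝ => (q.2 - T q) ^ 2) μ := by
    refine ((h2.sub (hTx.const_mul 2)).add hT2).congr (ae_of_all _ fun q => ?_)
    simp only [Pi.add_apply, Pi.sub_apply, hTdef]
    ring
  have hsv : ∫ q, (q.2 - T q) ^ 2 ∂μ = (∫ q, q.2 ^ 2 ∂μ) - 2 * (∫ q, T q * q.2 ∂μ) + 1 := by
    have i1 : Integrable (fun q => q.2 ^ 2 - 2 * (T q * q.2)) μ := h2.sub (hTx.const_mul 2)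
    rw [← hT2v, ← integral_const_mul, ← integral_sub h2 (hTx.const_mul 2), ← integral_add i1 hT2]
    refine integral_congr_ae (ae_of_all _ fun q => ?_)
    simp only [hTdef]
    ring
  rw [← ofReal_integral_eq_lintegral_ofReal hs (ae_of_all _ fun q => sq_nonneg _),
    klDiv_of_ac_of_integrable hac hllr, show (2 : ENNReal) = ENNReal.ofReal 2 by simp,
    ← ENNReal.ofReal_mul two_pos.le]
  refine ENNReal.ofReal_le_ofReal ?_
  simp only [probReal_univ]
  rw [hsv]
  have hle' : (∫ q, q.2 ^ 2 ∂μ) / 2 - 1 / 2 + 1 - ∫ q, R q ∂μ ≤ ∫ q, llr μ ν q ∂μ := hv ▸ hle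
  linarith

end FibreTransport

/-! ### Talagrand's inequality in all dimensions, by the chain rule. -/

section Talagrand

local notation "γ₁" => gaussianReal 0 1

lemma fst_map_prodMap {α β : Type*} [MeasurableSpace α] [MeasurableSpace β]
    (π : Measure (α × α)) {ψ : α → β} (hψ : Measurable ψ) :
    (π.map (Prod.map ψ ψ)).fst = π.fst.map ψ ∧ (π.map (Prod.map ψ ψ)).snd = π.snd.map ψ := by
  have h := hψ.prodMap hψ
  constructor
  · rw [Measure.fst, Measure.fst, Measure.map_map measurable_fst h,
      Measure.map_map hψ measurable_fst]
    rfl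
  · rw [Measure.snd, Measure.snd, Measure.map_map measurable_snd h,
      Measure.map_map hψ measurable_snd]
    rfl

/-- Gluing a coupling of the bases with the fibrewise monotone transport. -/
lemma exists_coupling_compProd {α : Type*} [MeasurableSpace α] {ρ σ : Measure α}
    [IsProbabilityMeasure ρ] [IsProbabilityMeasure σ] {κ : Kernel α ℝ} [IsMarkovKernel κ]
    (hac : ρ ⊗ₘ κ ≪ ρ.prod γ₁) {π : Measure (α × α)} (hfst : π.fst = ρ) (hsnd : π.snd = σ)
    {c : α × α → ENNReal} (hc : Measurable c) :
    ∃ π' : Measure ((α × ℝ) × (α × ℝ)), π'.fst = ρ ⊗ₘ κ ∧ π'.snd = σ.prod γ₁ ∧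
      ∫⁻ z, (c (z.1.1, z.2.1) + ENNReal.ofReal ((z.1.2 - z.2.2) ^ 2)) ∂π' =
        ∫⁻ z, c z ∂π +
          ∫⁻ q, ENNReal.ofReal ((q.2 - gaussTransport (κ q.1) q.2) ^ 2) ∂(ρ ⊗ₘ κ) := by
  have hπ : IsProbabilityMeasure π := ⟨by
    rw [← Measure.fst_univ, hfst, measure_univ]⟩
  let T : α × ℝ → ℝ := fun q => gaussTransport (κ q.1) q.2
  have hT : Measurable T := measurable_gaussTransport_kernel
  let η : Kernel (α × α) ℝ := κ.comap Prod.fst measurable_fst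
  -- The transport uses the fibre over the first base point only. For almost every pair of base
  -- points the new coordinate has law γ₁, so it is independent of the second one and the second
  -- marginal is a product.
  let Φ : (α × α) × ℝ → (α × ℝ) × (α × ℝ) := fun r => ((r.1.1, r.2), (r.1.2, T (r.1.1, r.2)))
  have hΦ : Measurable Φ := by
    have h1 : Measurable fun r : (α × α) × ℝ => (r.1.1, r.2) := by fun_prop
    exact h1.prodMk ((measurable_snd.comp measurable_fst).prodMk (hT.comp h1))
  have hbase : ∀ g : α → ENNReal, Measurable g → ∫⁻ z, g z.1 ∂π = ∫⁻ a, g a ∂ρ := fun g hg => by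
    rw [← hfst, Measure.fst, lintegral_map hg measurable_fst]
  have hbase' : ∀ g : α → ENNReal, Measurable g → ∫⁻ z, g z.2 ∂π = ∫⁻ a, g a ∂σ := fun g hg => by
    rw [← hsnd, Measure.snd, lintegral_map hg measurable_snd]
  have hpush : ∀ g : α × ℝ → ENNReal, Measurable g →
      ∫⁻ r, g (r.1.1, r.2) ∂(π ⊗ₘ η) = ∫⁻ q, g q ∂(ρ ⊗ₘ κ) := fun g hg => by
    rw [Measure.lintegral_compProd (f := fun r : (α × α) × ℝ => g (r.1.1, r.2)) (by fun_prop),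
      Measure.lintegral_compProd hg, ← hbase _ hg.lintegral_kernel_prod_right']
    rfl
  have hcont : ∀ᵐ z ∂π, Continuous (cdf (κ z.1)) := by
    have := ae_continuous_cdf hac
    rw [← hfst] at this
    exact ae_of_ae_map measurable_fst.aemeasurable this
  refine ⟨(π ⊗ₘ η).map Φ, ?_, ?_, ?_⟩
  · refine Measure.ext_of_lintegral _ fun g hg => ?_
    rw [Measure.fst, Measure.map_map measurable_fst hΦ,
      lintegral_map hg (measurable_fst.comp hΦ), ← hpush g hg]
    rfl
  · refine Measure.ext_of_lintegral _ fun g hg => ?_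
    rw [Measure.snd, Measure.map_map measurable_snd hΦ,
      lintegral_map hg (measurable_snd.comp hΦ),
      Measure.lintegral_compProd (f := fun r => g ((Prod.snd ∘ Φ) r))
        (hg.comp (measurable_snd.comp hΦ)),
      lintegral_prod _ hg.aemeasurable, ← hbase' _ hg.lintegral_prod_right']
    refine lintegral_congr_ae ?_
    filter_upwards [hcont] with z hz
    have hz' : Measurable fun x => g (z.2, x) := hg.comp measurable_prodMk_left
    rw [← map_gaussTransport hz, lintegral_map hz' measurable_gaussTransport]
    rfl
  · rw [lintegral_map (by fun_prop) hΦ]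
    have h1 : Measurable fun r : (α × α) × ℝ => c r.1 := hc.comp measurable_fst
    have h2 : Measurable fun q : α × ℝ => ENNReal.ofReal ((q.2 - T q) ^ 2) := by fun_prop
    refine (lintegral_add_left h1 _).trans ?_
    congr 1
    · rw [Measure.lintegral_compProd h1]
      simp
    · exact hpush _ h2

lemma map_piFinSucc_gaussian (n : ℕ) :
    ((Measure.pi fun _ : Fin n => γ₁).prod γ₁).map
      (fun q => (Fin.cons q.2 q.1 : Fin (n + 1) → ℝ)) = Measure.pi fun _ : Fin (n + 1) => γ₁ := by
  have h := (measurePreserving_piFinSuccAbove (fun _ : Fin (n + 1) => γ₁) 0).symm.map_eq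
  rw [← Measure.prod_swap, Measure.map_map (MeasurableEquiv.measurable _) measurable_swap] at h
  refine Eq.trans (congrArg (fun f => Measure.map f _) (funext fun q => ?_)) h
  exact (Fin.insertNth_zero' q.2 q.1).symm

/-- Induction on the number of coordinates: the tail is coupled by the induction hypothesis and
coordinate 0 by transport of its conditional law. Costs add across coordinates, and so do entropies
by the chain rule. -/
theorem exists_coupling_pi (n : ℕ) (μ : Measure (Fin n → ℝ)) [IsProbabilityMeasure μ]
    (hkl : klDiv μ (Measure.pi fun _ => γ₁) ≠ ⊤) (h2 : ∀ i, Integrable (fun x => x i ^ 2) μ) :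
    ∃ π : Measure ((Fin n → ℝ) × (Fin n → ℝ)), π.fst = μ ∧ π.snd = (Measure.pi fun _ => γ₁) ∧
      ∫⁻ z, ∑ i, ENNReal.ofReal ((z.1 i - z.2 i) ^ 2) ∂π ≤
        2 * klDiv μ (Measure.pi fun _ => γ₁) := by
  induction n with
  | zero =>
    refine ⟨μ.prod (Measure.pi fun _ => γ₁), by simp, by simp, by simp⟩
  | succ n ih =>
    let φ : (Fin (n + 1) → ℝ) → (Fin n → ℝ) × ℝ := fun x => (Fin.tail x, x 0)
    let ψ : (Fin n → ℝ) × ℝ → (Fin (n + 1) → ℝ) := fun q => Fin.cons q.2 q.1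
    have hφ : Measurable φ := by
      refine Measurable.prodMk (measurable_pi_lambda _ fun i => ?_) (measurable_pi_apply 0)
      exact measurable_pi_apply i.succ
    have hψ : Measurable ψ := by
      refine measurable_pi_lambda _ fun i => ?_
      refine Fin.cases ?_ (fun j => ?_) i
      · exact measurable_snd
      · exact (measurable_pi_apply j).comp measurable_fst
    have hψφ : ψ ∘ φ = id := funext fun x => Fin.cons_self_tail x
    have hφψ : φ ∘ ψ = id := rfl
    have hν : (Measure.pi fun _ : Fin (n + 1) => γ₁).map φ =
        (Measure.pi fun _ : Fin n => γ₁).prod γ₁ := by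
      rw [← map_piFinSucc_gaussian n, Measure.map_map hφ hψ]
      exact Measure.map_id
    have := Measure.isProbabilityMeasure_map (μ := μ) hφ.aemeasurable
    set ρ := (μ.map φ).fst with hρ
    set κ := (μ.map φ).condKernel with hκ
    have hdis : ρ ⊗ₘ κ = μ.map φ := (μ.map φ).disintegrate _
    -- Data processing suffices here; the equality that holds for a bijection is not needed.
    have hle : klDiv (ρ ⊗ₘ κ) ((Measure.pi fun _ : Fin n => γ₁).prod γ₁) ≤
        klDiv μ (Measure.pi fun _ => γ₁) := by
      rw [hdis, ← hν]
      exact klDiv_map_le _ _ hφ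
    have hsplit : klDiv (ρ ⊗ₘ κ) ((Measure.pi fun _ : Fin n => γ₁).prod γ₁) =
        klDiv ρ (Measure.pi fun _ : Fin n => γ₁) + klDiv (ρ ⊗ₘ κ) (ρ.prod γ₁) := by
      rw [← Measure.compProd_const, klDiv_compProd_eq_add, Measure.compProd_const]
    rw [hsplit] at hle
    have hfin := (lt_of_le_of_lt hle hkl.lt_top).ne
    obtain ⟨hk1, hk2⟩ := ENNReal.add_ne_top.1 hfin
    have hρ2 : ∀ i, Integrable (fun x : Fin n → ℝ => x i ^ 2) ρ := fun i => by
      rw [hρ, Measure.fst, Measure.map_map measurable_fst hφ,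
        integrable_map_measure ((measurable_pi_apply i).pow_const 2).aestronglyMeasurable
          (measurable_fst.comp hφ).aemeasurable]
      exact h2 i.succ
    have hκ2 : Integrable (fun q : (Fin n → ℝ) × ℝ => q.2 ^ 2) (ρ ⊗ₘ κ) := by
      rw [hdis, integrable_map_measure (by fun_prop) hφ.aemeasurable]
      exact h2 0
    obtain ⟨π₀, hfst, hsnd, hcost⟩ := ih ρ hk1 hρ2
    obtain ⟨π, hπ1, hπ2, hπc⟩ := exists_coupling_compProd (klDiv_ne_top_iff.1 hk2).1 hfst hsnd
      (c := fun z => ∑ i, ENNReal.ofReal ((z.1 i - z.2 i) ^ 2)) (by fun_prop)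
    refine ⟨π.map (Prod.map ψ ψ), ?_, ?_, ?_⟩
    · rw [(fst_map_prodMap π hψ).1, hπ1, hdis, Measure.map_map hψ hφ, hψφ, Measure.map_id]
    · rw [(fst_map_prodMap π hψ).2, hπ2, map_piFinSucc_gaussian]
    · rw [lintegral_map (by fun_prop) (hψ.prodMap hψ)]
      have : ∀ z : ((Fin n → ℝ) × ℝ) × ((Fin n → ℝ) × ℝ),
          ∑ i, ENNReal.ofReal (((Prod.map ψ ψ z).1 i - (Prod.map ψ ψ z).2 i) ^ 2) =
          (∑ i, ENNReal.ofReal ((z.1.1 i - z.2.1 i) ^ 2)) +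
            ENNReal.ofReal ((z.1.2 - z.2.2) ^ 2) := fun z => by
        rw [Fin.sum_univ_succ, add_comm]
        rfl
      simp only [this]
      rw [hπc]
      calc _ ≤ 2 * klDiv ρ (Measure.pi fun _ : Fin n => γ₁) + 2 * klDiv (ρ ⊗ₘ κ) (ρ.prod γ₁) :=
            add_le_add hcost (lintegral_sq_sub_gaussTransport_le hk2 hκ2)
        _ ≤ _ := by
            rw [← mul_add]
            gcongr

/-- Talagrand's transport inequality for the standard Gaussian measure. -/
theorem exists_coupling_stdGaussian {n : ℕ} (μ : Measure (EuclideanSpace ℝ (Fin n)))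
    [IsProbabilityMeasure μ] (hkl : klDiv μ (stdGaussian (EuclideanSpace ℝ (Fin n))) ≠ ⊤)
    (h2 : Integrable (fun x => ‖x‖ ^ 2) μ) :
    ∃ π : Measure (EuclideanSpace ℝ (Fin n) × EuclideanSpace ℝ (Fin n)),
      π.fst = μ ∧ π.snd = stdGaussian (EuclideanSpace ℝ (Fin n)) ∧
      ∫⁻ z, ENNReal.ofReal (‖z.1 - z.2‖ ^ 2) ∂π ≤
        2 * klDiv μ (stdGaussian (EuclideanSpace ℝ (Fin n))) := by
  let φ : EuclideanSpace ℝ (Fin n) → (Fin n → ℝ) := WithLp.ofLp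
  let ψ : (Fin n → ℝ) → EuclideanSpace ℝ (Fin n) := WithLp.toLp 2
  have hφ : Measurable φ := by fun_prop
  have hψ : Measurable ψ := by fun_prop
  have hν : (Measure.pi fun _ : Fin n => γ₁).map ψ = stdGaussian (EuclideanSpace ℝ (Fin n)) :=
    map_pi_eq_stdGaussian
  have hν' : (stdGaussian (EuclideanSpace ℝ (Fin n))).map φ = Measure.pi fun _ : Fin n => γ₁ := by
    rw [← hν, Measure.map_map hφ hψ]
    exact Measure.map_id
  have hle : klDiv (μ.map φ) (Measure.pi fun _ : Fin n => γ₁) ≤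
      klDiv μ (stdGaussian (EuclideanSpace ℝ (Fin n))) := by
    rw [← hν']
    exact klDiv_map_le _ _ hφ
  have := Measure.isProbabilityMeasure_map (μ := μ) hφ.aemeasurable
  obtain ⟨π, h1, h2, h3⟩ := exists_coupling_pi n (μ.map φ) (hle.trans_lt hkl.lt_top).ne fun i => by
    rw [integrable_map_measure ((measurable_pi_apply i).pow_const 2).aestronglyMeasurable
      hφ.aemeasurable]
    refine h2.mono' (by fun_prop) (ae_of_all _ fun x => ?_)
    simp only [Function.comp_apply, norm_pow]
    gcongr
    exact PiLp.norm_apply_le x i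
  refine ⟨π.map (Prod.map ψ ψ), ?_, ?_, ?_⟩
  · rw [(fst_map_prodMap π hψ).1, h1, Measure.map_map hψ hφ]
    exact Measure.map_id
  · rw [(fst_map_prodMap π hψ).2, h2, hν]
  · rw [lintegral_map (by fun_prop) (hψ.prodMap hψ)]
    refine le_trans (le_of_eq (lintegral_congr fun z => ?_)) (h3.trans (by gcongr))
    rw [← ENNReal.ofReal_sum_of_nonneg fun i _ => sq_nonneg _, EuclideanSpace.norm_sq_eq]
    simp [ψ]

end Talagrand

/-! ### Entropy, Fisher information and transport distance combined. -/

section Deficit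

local notation "𝔼" n => EuclideanSpace ℝ (Fin n)

variable {n : ℕ} {p : (𝔼 n) → ℝ}

lemma lawOf_eq_withDensity_stdGaussian (hp : Continuous p) :
    lawOf p = (stdGaussian (𝔼 n)).withDensity
      fun x => ENNReal.ofReal (p x / gaussDensity n x) := by
  have hq : Continuous (gaussDensity n) := continuous_gaussDensity
  have hm : Measurable fun x => ENNReal.ofReal (gaussDensity n x) := by fun_prop
  have hm' : Measurable fun x => ENNReal.ofReal (p x / gaussDensity n x) :=
    (hp.measurable.div hq.measurable).ennreal_ofReal
  rw [stdGaussian_eq_withDensity, ← withDensity_mul _ hm hm', lawOf]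
  congr 1
  ext x
  simp only [Pi.mul_apply]
  rw [← ENNReal.ofReal_mul (gaussDensity_pos x).le, mul_div_cancel₀ _ (gaussDensity_pos x).ne']

/-- The relative entropy of a Fisher density with respect to the standard Gaussian. -/
lemma IsFisherDensity.klDiv_stdGaussian (h : IsFisherDensity p) (h1 : ∫ x, p x = 1) :
    klDiv (lawOf p) (stdGaussian (𝔼 n)) ≠ ⊤ ∧
    2 * (klDiv (lawOf p) (stdGaussian (𝔼 n))).toReal =
      2 * (∫ x, p x * Real.log (p x)) + n * Real.log (2 * Real.pi) + ∫ x, ‖x‖ ^ 2 * p x := by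
  have hp := h.contDiff.continuous
  have := h.isProbabilityMeasure_lawOf h1
  have hlaw := lawOf_eq_withDensity_stdGaussian hp
  have hac : lawOf p ≪ stdGaussian (𝔼 n) := hlaw ▸ withDensity_absolutelyContinuous _ _
  have hm : Measurable fun x => ENNReal.ofReal (p x / gaussDensity n x) :=
    (hp.measurable.div continuous_gaussDensity.measurable).ennreal_ofReal
  have hr : (lawOf p).rnDeriv (stdGaussian (𝔼 n)) =ᵐ[stdGaussian (𝔼 n)]
      fun x => ENNReal.ofReal (p x / gaussDensity n x) := by
    rw [hlaw]
    exact Measure.rnDeriv_withDensity _ hm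
  have hpos : ∀ x, 0 ≤ p x / gaussDensity n x := fun x =>
    div_nonneg (h.nonneg x) (gaussDensity_pos x).le
  have hk : klDiv (lawOf p) (stdGaussian (𝔼 n)) =
      ∫⁻ x, ENNReal.ofReal (klFun (p x / gaussDensity n x)) ∂(stdGaussian (𝔼 n)) := by
    rw [klDiv_eq_lintegral_klFun_of_ac hac]
    refine lintegral_congr_ae ?_
    filter_upwards [hr] with x hx
    rw [hx, ENNReal.toReal_ofReal (hpos x)]
  have hq : Integrable (gaussDensity n) := by
    simpa using integrable_stdGaussian_iff.1 (integrable_const (1 : ℝ))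
  have hq1 : ∫ x, gaussDensity n x = 1 := by
    simpa using (integral_stdGaussian_eq (n := n) fun _ => (1 : ℝ)).symm
  have hl := (h.lsi h1).1
  have i1 : Integrable fun x => p x * Real.log (p x) + n / 2 * Real.log (2 * Real.pi) * p x :=
    hl.add (h.integrable.const_mul _)
  have i2 : Integrable fun x => p x * Real.log (p x) + n / 2 * Real.log (2 * Real.pi) * p x +
      1 / 2 * (‖x‖ ^ 2 * p x) := i1.add (h.moment.const_mul _)
  have i3 : Integrable fun x => p x * Real.log (p x) + n / 2 * Real.log (2 * Real.pi) * p x +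
      1 / 2 * (‖x‖ ^ 2 * p x) + gaussDensity n x := i2.add hq
  have hi : Integrable (fun x => klFun (p x / gaussDensity n x)) (stdGaussian (𝔼 n)) := by
    rw [integrable_stdGaussian_iff]
    simp only [klFun_div_gaussDensity]
    exact i3.sub h.integrable
  have hk0 : ∀ x, 0 ≤ klFun (p x / gaussDensity n x) := fun x => klFun_nonneg (hpos x)
  rw [← ofReal_integral_eq_lintegral_ofReal hi (ae_of_all _ hk0)] at hk
  refine ⟨hk ▸ ENNReal.ofReal_ne_top, ?_⟩
  rw [hk, ENNReal.toReal_ofReal (integral_nonneg hk0), integral_stdGaussian_eq]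
  simp only [klFun_div_gaussDensity]
  rw [integral_sub i3 h.integrable, integral_add i2 hq, integral_add i1 (h.moment.const_mul _),
    integral_add hl (h.integrable.const_mul _), integral_const_mul, integral_const_mul, h1, hq1]
  ring

lemma relFisherInfo_gaussDensity (h0 : ∀ x, 0 ≤ p x) :
    relFisherInfo p (gaussDensity n) =
      ∫⁻ x, ENNReal.ofReal (‖gradient p x + p x • x‖ ^ 2 / p x) := by
  refine lintegral_congr fun x => ?_
  congr 1
  have hq : (gaussDensity n x)⁻¹ • gradient (gaussDensity n) x = -x := by
    rw [gradient_gaussDensity, smul_neg, smul_smul, inv_mul_cancel₀ (gaussDensity_pos x).ne',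
      one_smul]
  rcases (h0 x).eq_or_lt with h | h
  · simp [← h]
  · have e : (p x)⁻¹ • gradient p x - (gaussDensity n x)⁻¹ • gradient (gaussDensity n) x =
        (p x)⁻¹ • (gradient p x + p x • x) := by
      rw [hq, sub_neg_eq_add, smul_add, smul_smul, inv_mul_cancel₀ h.ne', one_smul]
    rw [e, norm_smul, mul_pow, Real.norm_of_nonneg (inv_nonneg.2 h.le)]
    field_simp

lemma measurable_norm_sq_div (hp : Continuous p) {F : (𝔼 n) → 𝔼 n} (hF : Continuous F) :
    Measurable fun x => ‖F x‖ ^ 2 / p x :=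
  (hF.norm.pow 2).measurable.div hp.measurable

lemma norm_sq_div_nonneg (h0 : ∀ x, 0 ≤ p x) (F : (𝔼 n) → 𝔼 n) (x : 𝔼 n) :
    0 ≤ ‖F x‖ ^ 2 / p x := div_nonneg (sq_nonneg _) (h0 x)

lemma integrable_of_relFisherInfo_ne_top (hp : ContDiff ℝ 1 p) (h0 : ∀ x, 0 ≤ p x)
    (hI : relFisherInfo p (gaussDensity n) ≠ ⊤) :
    Integrable fun x => ‖gradient p x + p x • x‖ ^ 2 / p x := by
  have hF : Continuous fun x => gradient p x + p x • x :=
    (continuous_gradient hp).add (hp.continuous.smul continuous_id)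
  refine ⟨(measurable_norm_sq_div hp.continuous hF).aestronglyMeasurable, ?_⟩
  rw [hasFiniteIntegral_iff_ofReal (ae_of_all _ (norm_sq_div_nonneg h0 _)),
    ← relFisherInfo_gaussDensity h0]
  exact hI.lt_top

lemma IsFisherDensity.relFisherInfo_toReal (h : IsFisherDensity p) (h1 : ∫ x, p x = 1) :
    (relFisherInfo p (gaussDensity n)).toReal =
      (∫ x, ‖gradient p x‖ ^ 2 / p x) - 2 * n + ∫ x, ‖x‖ ^ 2 * p x := by
  rw [relFisherInfo_gaussDensity h.nonneg, ← ofReal_integral_eq_lintegral_ofReal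
    h.integrable_relFisher (ae_of_all _ (norm_sq_div_nonneg h.nonneg _)),
    ENNReal.toReal_ofReal (integral_nonneg (norm_sq_div_nonneg h.nonneg _)), h.integral_relFisher,
    h1, mul_one]

lemma IsFisherDensity.fisherInfo_eq (h : IsFisherDensity p) :
    fisherInfo p = ENNReal.ofReal (∫ x, ‖gradient p x‖ ^ 2 / p x) :=
  (ofReal_integral_eq_lintegral_ofReal h.fisher
    (ae_of_all _ (norm_sq_div_nonneg h.nonneg _))).symm

/-- If it vanished, ∇p would be zero almost everywhere, against ∫ ∇p · x = -n. -/
lemma IsFisherDensity.fisher_pos (h : IsFisherDensity p) (h1 : ∫ x, p x = 1) (hn : 1 ≤ n) :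
    0 < ∫ x, ‖gradient p x‖ ^ 2 / p x := by
  refine (integral_nonneg (norm_sq_div_nonneg h.nonneg _)).lt_of_ne fun h0 => ?_
  have hae := (integral_eq_zero_iff_of_nonneg (norm_sq_div_nonneg h.nonneg _) h.fisher).1 h0.symm
  have hz : ∫ x, inner ℝ (gradient p x) x = 0 := by
    refine integral_eq_zero_of_ae ?_
    filter_upwards [hae] with x hx
    have hg : gradient p x = 0 := by
      rcases div_eq_zero_iff.1 hx with hx | hx
      · simpa using hx
      · exact gradient_eq_zero_of_nonneg h.nonneg hx
    simp [hg]
  rw [h.integral_inner_gradient, h1, mul_one, neg_eq_zero, Nat.cast_eq_zero] at hz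
  omega

lemma Δ_nonneg {t : ℝ} (ht : -1 < t) : 0 ≤ Δ t := by
  have := Real.log_le_sub_one_of_pos (x := 1 + t) (by linarith)
  rw [Δ]
  linarith

/-- The deficit in the Gaussian logarithmic Sobolev inequality controls the deviation of the Fisher
information from that of the Gaussian. -/
lemma IsFisherDensity.deficit_ge (h : IsFisherDensity p) (h1 : ∫ x, p x = 1) (hn : 1 ≤ n) :
    n * Δ ((∫ x, ‖gradient p x‖ ^ 2 / p x) / n - 1) ≤
      ((∫ x, ‖gradient p x‖ ^ 2 / p x) - 2 * n + ∫ x, ‖x‖ ^ 2 * p x) -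
      2 * (klDiv (lawOf p) (stdGaussian (𝔼 n))).toReal := by
  have hJ := h.fisher_pos h1 hn
  have hn' : (0 : ℝ) < n := by exact_mod_cast hn
  -- v = n/J minimizes vJ - n log v.
  have hv := (h.euclidean_lsi (by rw [h1]; exact one_pos) (div_pos hn' hJ)).2
  rw [(h.klDiv_stdGaussian h1).2]
  rw [h1, Real.log_one, div_mul_cancel₀ _ hJ.ne', Real.log_mul (by positivity) (by positivity),
    Real.log_div hn'.ne' hJ.ne'] at hv
  rw [Δ, add_sub_cancel, Real.log_div hJ.ne' hn'.ne']
  have e : (n : ℝ) * ((∫ x, ‖gradient p x‖ ^ 2 / p x) / n) = ∫ x, ‖gradient p x‖ ^ 2 / p x :=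
    mul_div_cancel₀ _ hn'.ne'
  linarith

/-- The noise is parametrized by u = σ²/τ², that is σ² = u/(1 - u) and τ² = 1/(1 - u). The remaining
parameter minimizes v(J + n/σ²) - n log v, hence v = n/(J + n/σ²). -/
lemma IsFisherDensity.klDiv_le_of_coupling (h : IsFisherDensity p) (h1 : ∫ x, p x = 1) (hn : 1 ≤ n)
    {π : Measure ((𝔼 n) × 𝔼 n)} (hfst : π.fst = lawOf p) (hsnd : π.snd = stdGaussian (𝔼 n))
    {u : ℝ} (hu : u ∈ Set.Ioo (0 : ℝ) 1) :
    2 * (klDiv (lawOf p) (stdGaussian (𝔼 n))).toReal ≤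
      (∫ z, ‖z.1 - z.2‖ ^ 2 ∂π) * (1 / u - 1) + u * ((∫ x, ‖x‖ ^ 2 * p x) - n) +
        n * Real.log (1 + u * ((∫ x, ‖gradient p x‖ ^ 2 / p x) / n - 1)) := by
  obtain ⟨hu0, hu1⟩ := hu
  have hJ := h.fisher_pos h1 hn
  have hn' : (0 : ℝ) < n := by exact_mod_cast hn
  rw [(h.klDiv_stdGaussian h1).2]
  set J := ∫ x, ‖gradient p x‖ ^ 2 / p x
  set a := ∫ x, ‖x‖ ^ 2 * p x
  set C := ∫ z, ‖z.1 - z.2‖ ^ 2 ∂π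
  have hw : 0 < 1 - u := sub_pos.2 hu1
  have hd : 0 < n * (1 - u) + u * J := by positivity
  have hσ2 : √(u / (1 - u)) ^ 2 = u / (1 - u) := Real.sq_sqrt (by positivity)
  have hτ2 : √(1 / (1 - u)) ^ 2 = 1 / (1 - u) := Real.sq_sqrt (by positivity)
  have hv : 0 < n * u / (n * (1 - u) + u * J) := by positivity
  have key := h.entropy_le_of_coupling h1 hfst hsnd (σ := √(u / (1 - u))) (τ := √(1 / (1 - u)))
    (by positivity) (by positivity) (by rw [hσ2, hτ2]; field_simp; ring) hv
  rw [hσ2, hτ2, Real.log_sqrt (by positivity), Real.log_sqrt (by positivity),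
    Real.log_div one_ne_zero hw.ne', Real.log_div hu0.ne' hw.ne', Real.log_one,
    Real.log_mul (by positivity) hv.ne', Real.log_div (by positivity) hd.ne',
    Real.log_mul hn'.ne' hu0.ne'] at key
  have e1 : 1 + u * (J / n - 1) = (n * (1 - u) + u * J) / n := by field_simp; ring
  rw [e1, Real.log_div hd.ne' hn'.ne']
  have e2 : a / (1 / (1 - u)) = a - u * a := by field_simp
  have e3 : C / (u / (1 - u)) = C * (1 / u - 1) := by field_simp
  have e4 : u / (1 - u) / (1 / (1 - u)) = u := by field_simp
  have e5 : n * u / (n * (1 - u) + u * J) * J +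
      n * (n * u / (n * (1 - u) + u * J) / (u / (1 - u))) = n := by
    field_simp
    ring
  rw [e2, e3, e4] at key
  change 2 * ∫ x, p x * Real.log (p x) ≤ _ at key
  linarith

lemma exists_coupling_of_W2_lt {μ ν : Measure (𝔼 n)} {r : ℝ} (hr : 0 ≤ r)
    (h : W2 μ ν < ENNReal.ofReal r) :
    ∃ π : Measure ((𝔼 n) × 𝔼 n), π.fst = μ ∧ π.snd = ν ∧ ∫ z, ‖z.1 - z.2‖ ^ 2 ∂π ≤ r ^ 2 := by
  simp only [W2, iInf_lt_iff] at h
  obtain ⟨π, ⟨h1, h2⟩, h3⟩ := h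
  refine ⟨π, h1, h2, ?_⟩
  rw [integral_eq_lintegral_of_nonneg_ae (ae_of_all _ fun z => sq_nonneg _)
    (Continuous.aestronglyMeasurable (by fun_prop))]
  refine ENNReal.toReal_le_of_le_ofReal (sq_nonneg r) ?_
  have h4 := ENNReal.rpow_le_rpow h3.le (z := 2) zero_le_two
  rw [← ENNReal.rpow_mul, ENNReal.ofReal_rpow_of_nonneg hr zero_le_two] at h4
  simpa using h4

/-- Interpolated transport bound on the relative entropy. -/
lemma IsFisherDensity.klDiv_le_W2 (h : IsFisherDensity p) (h1 : ∫ x, p x = 1) (hn : 1 ≤ n)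
    (hW : W2 (lawOf p) (stdGaussian (𝔼 n)) ≠ ⊤) {u : ℝ} (hu : u ∈ Set.Ioo (0 : ℝ) 1) :
    2 * (klDiv (lawOf p) (stdGaussian (𝔼 n))).toReal ≤
      (W2 (lawOf p) (stdGaussian (𝔼 n))).toReal ^ 2 * (1 / u - 1) +
        u * ((∫ x, ‖x‖ ^ 2 * p x) - n) +
        n * Real.log (1 + u * ((∫ x, ‖gradient p x‖ ^ 2 / p x) / n - 1)) := by
  set W := (W2 (lawOf p) (stdGaussian (𝔼 n))).toReal with hWd
  have hW0 : 0 ≤ W := ENNReal.toReal_nonneg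
  have hu' : 0 ≤ 1 / u - 1 := sub_nonneg.2 (one_le_one_div hu.1 hu.2.le)
  -- No optimal coupling is needed: every r > W is beaten by some coupling, and the bound is
  -- continuous in r.
  have hr : ∀ r ∈ Set.Ioi W, 2 * (klDiv (lawOf p) (stdGaussian (𝔼 n))).toReal ≤
      r ^ 2 * (1 / u - 1) + u * ((∫ x, ‖x‖ ^ 2 * p x) - n) +
        n * Real.log (1 + u * ((∫ x, ‖gradient p x‖ ^ 2 / p x) / n - 1)) := fun r hr => by
    have hr0 : 0 < r := hW0.trans_lt hr
    obtain ⟨π, h2, h3, h4⟩ := exists_coupling_of_W2_lt hr0.le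
      ((ENNReal.lt_ofReal_iff_toReal_lt hW).2 hr)
    refine (h.klDiv_le_of_coupling h1 hn h2 h3 hu).trans ?_
    gcongr
  have hc : Tendsto (fun r : ℝ => r ^ 2 * (1 / u - 1) + u * ((∫ x, ‖x‖ ^ 2 * p x) - n) +
        n * Real.log (1 + u * ((∫ x, ‖gradient p x‖ ^ 2 / p x) / n - 1))) (𝓝[>] W)
      (𝓝 (W ^ 2 * (1 / u - 1) + u * ((∫ x, ‖x‖ ^ 2 * p x) - n) +
        n * Real.log (1 + u * ((∫ x, ‖gradient p x‖ ^ 2 / p x) / n - 1)))) :=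
    (Continuous.tendsto (by fun_prop) W).mono_left nhdsWithin_le_nhds
  exact ge_of_tendsto hc (eventually_mem_nhdsWithin.mono hr)

/-- The quadratic transport inequality for the standard Gaussian measure. -/
lemma IsFisherDensity.W2_sq_le (h : IsFisherDensity p) (h1 : ∫ x, p x = 1) :
    W2 (lawOf p) (stdGaussian (𝔼 n)) ≠ ⊤ ∧
    (W2 (lawOf p) (stdGaussian (𝔼 n))).toReal ^ 2 ≤
      2 * (klDiv (lawOf p) (stdGaussian (𝔼 n))).toReal := by
  have := h.isProbabilityMeasure_lawOf h1
  have hk := (h.klDiv_stdGaussian h1).1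
  obtain ⟨π, h2, h3, h4⟩ := exists_coupling_stdGaussian (lawOf p) hk h.integrable_norm_sq
  have hk' : 2 * klDiv (lawOf p) (stdGaussian (𝔼 n)) ≠ ⊤ := ENNReal.mul_ne_top (by simp) hk
  have hle : W2 (lawOf p) (stdGaussian (𝔼 n)) ≤
      (2 * klDiv (lawOf p) (stdGaussian (𝔼 n))) ^ (1 / 2 : ℝ) :=
    (iInf₂_le π ⟨h2, h3⟩).trans (ENNReal.rpow_le_rpow h4 (by norm_num))
  have hfin : (2 * klDiv (lawOf p) (stdGaussian (𝔼 n))) ^ (1 / 2 : ℝ) ≠ ⊤ :=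
    ENNReal.rpow_ne_top_of_nonneg (by norm_num) hk'
  refine ⟨ne_top_of_le_ne_top hfin hle, ?_⟩
  have h5 := ENNReal.toReal_mono hfin hle
  rw [← ENNReal.toReal_rpow, ← Real.sqrt_eq_rpow, ENNReal.toReal_mul, ENNReal.toReal_ofNat] at h5
  calc _ ≤ √(2 * (klDiv (lawOf p) (stdGaussian (𝔼 n))).toReal) ^ 2 := by gcongr
    _ = _ := Real.sq_sqrt (by positivity)

/-- If the Wasserstein distance to the Gaussian vanishes, so does the relative entropy. -/
lemma IsFisherDensity.klDiv_le_zero_of_W2 (h : IsFisherDensity p) (h1 : ∫ x, p x = 1) (hn : 1 ≤ n)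
    (hW : (W2 (lawOf p) (stdGaussian (𝔼 n))).toReal = 0) :
    2 * (klDiv (lawOf p) (stdGaussian (𝔼 n))).toReal ≤ 0 := by
  have hle : ∀ u ∈ Set.Ioo (0 : ℝ) 1, 2 * (klDiv (lawOf p) (stdGaussian (𝔼 n))).toReal ≤
      u * ((∫ x, ‖x‖ ^ 2 * p x) - n) +
        n * Real.log (1 + u * ((∫ x, ‖gradient p x‖ ^ 2 / p x) / n - 1)) := fun u hu => by
    have := h.klDiv_le_W2 h1 hn (h.W2_sq_le h1).1 hu
    rw [hW] at this
    simpa using this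
  set b := (∫ x, ‖x‖ ^ 2 * p x) - n
  set t := (∫ x, ‖gradient p x‖ ^ 2 / p x) / n - 1
  -- With W = 0 the term that is singular at u = 0 is absent, and the rest tends to 0.
  have hc : ContinuousAt (fun u : ℝ => u * b + n * Real.log (1 + u * t)) 0 := by
    have : ContinuousAt (fun u : ℝ => Real.log (1 + u * t)) 0 :=
      ContinuousAt.log (by fun_prop) (by simp)
    fun_prop
  have hc' : Tendsto (fun u : ℝ => u * b + n * Real.log (1 + u * t)) (𝓝[>] 0) (𝓝 0) := by
    have := hc.tendsto.mono_left (nhdsWithin_le_nhds (s := Set.Ioi 0))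
    simpa using this
  exact ge_of_tendsto hc' (eventually_of_mem (Ioo_mem_nhdsGT one_pos) hle)

end Deficit

/-! ### The choice of the interpolation parameter. -/

section Deficit

/-- The algebra behind the refined inequality, from its interpolation form. -/
lemma refined_deficit {n : ℕ} (hn : 1 ≤ n) {I D J a W : ℝ} (hJ : 0 < J) (hW0 : 0 ≤ W)
    (hD0 : 0 ≤ D) (hI : I = J - 2 * n + a) (hWD : W ^ 2 ≤ 2 * D)
    (hdef : n * Δ (J / n - 1) ≤ I - 2 * D) (hzero : W = 0 → 2 * D ≤ 0)
    (hint : ∀ u ∈ Set.Ioo (0 : ℝ) 1, 2 * D ≤ W ^ 2 * (1 / u - 1) + u * (a - n) +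
      n * Real.log (1 + u * (J / n - 1))) :
    -1 < J / n - 1 ∧ -1 < W / √I * (J / n - 1) ∧
      (√I - W) ^ 2 + n * Δ (W / √I * (J / n - 1)) ≤ I - 2 * D := by
  have hn' : (0 : ℝ) < n := by exact_mod_cast hn
  have ht : -1 < J / n - 1 := by linarith [div_pos hJ hn']
  have hDI : 2 * D ≤ I := by linarith [mul_nonneg hn'.le (Δ_nonneg ht)]
  have hI0 : 0 ≤ I := by linarith
  have hsq : √I ^ 2 = I := Real.sq_sqrt hI0
  -- Talagrand's inequality followed by the logarithmic Sobolev inequality; this keeps W/√I in [0,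
  -- 1].
  have hWI : W ≤ √I := Real.le_sqrt_of_sq_le (hWD.trans hDI)
  have hc0 : 0 ≤ W / √I := div_nonneg hW0 (Real.sqrt_nonneg I)
  have hc1 : W / √I ≤ 1 := div_le_one_of_le₀ hWI (Real.sqrt_nonneg I)
  refine ⟨ht, ?_, ?_⟩
  · rcases le_total 0 (J / n - 1) with h | h
    · linarith [mul_nonneg hc0 h]
    · linarith [mul_le_mul_of_nonpos_right hc1 h]
  -- The case W = 0, which also covers I = 0: the claim reduces to D ≤ 0.
  rcases hW0.eq_or_lt with hW | hW
  · rw [← hW]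
    have := hzero hW.symm
    simp only [sub_zero, zero_div, zero_mul, Δ, add_zero, Real.log_one, mul_zero, hsq]
    linarith
  have hs : 0 < √I := hW.trans_le hWI
  -- At W = √I the parameter would be 1, outside the open interval, but the square vanishes and the
  -- first inequality is the claim.
  rcases hWI.eq_or_lt with hWI | hWI
  · rw [hWI, div_self hs.ne', one_mul, sub_self]
    simpa using hdef
  -- This u minimizes W²/u + uI. Both terms become W√I, and I - 2W√I + W² is the square in the
  -- conclusion.
  have hu := hint (W / √I) ⟨div_pos hW hs, (div_lt_one hs).2 hWI⟩
  have e1 : W ^ 2 * (1 / (W / √I) - 1) = W * √I - W ^ 2 := by field_simp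
  have e2 : W * √I = W / √I * (J - 2 * n + a) := by
    rw [← hI, ← hsq, Real.sqrt_sq hs.le]; field_simp
  have e3 : n * (W / √I * (J / n - 1)) = W / √I * (J - n) := by field_simp
  rw [e1] at hu
  have e4 : (√I - W) ^ 2 = I - 2 * (W * √I) + W ^ 2 := by linear_combination hsq
  rw [Δ, mul_sub, e3, e4]
  linarith

end Deficit

end GaussLSI

theorem theorem1p1 {n : ℕ} (hn : 1 ≤ n)
    {Ω : Type*} [MeasurableSpace Ω] (P : MeasureTheory.Measure Ω)
    [MeasureTheory.IsProbabilityMeasure P]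
    (X : Ω → EuclideanSpace ℝ (Fin n)) (hX : AEMeasurable X P)
    (p : EuclideanSpace ℝ (Fin n) → ℝ)
    (hp_smooth : ContDiff ℝ ((⊤ : ℕ∞) : WithTop ℕ∞) p)
    (hp_nonneg : ∀ x, 0 ≤ p x)
    (hp_density : P.map X = MeasureTheory.volume.withDensity (fun x => ENNReal.ofReal (p x)))
    (hI : GaussLSI.relFisherInfo p (GaussLSI.gaussDensity n) ≠ ⊤) :
    let γ := ProbabilityTheory.stdGaussian (EuclideanSpace ℝ (Fin n))
    -- the relative Fisher information `I(X|Z)`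
    let I : ℝ := (GaussLSI.relFisherInfo p (GaussLSI.gaussDensity n)).toReal
    -- the relative entropy `D(X|Z)`
    let D : ℝ := (InformationTheory.klDiv (P.map X) γ).toReal
    -- the Fisher information `I(X)`
    let I₀ : ℝ := (GaussLSI.fisherInfo p).toReal
    -- the distance `W₂(X, Z)`
    let W : ℝ := (GaussLSI.W2 (P.map X) γ).toReal
    -- all quantities are finite, and the arguments of `Δ` lie in its domain
    (InformationTheory.klDiv (P.map X) γ ≠ ⊤ ∧ GaussLSI.fisherInfo p ≠ ⊤ ∧
      GaussLSI.W2 (P.map X) γ ≠ ⊤ ∧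
      -1 < I₀ / n - 1 ∧ -1 < W / √I * (I₀ / n - 1)) ∧
    I - 2 * D ≥ n * GaussLSI.Δ (I₀ / n - 1) ∧
    I - 2 * D ≥ (√I - W) ^ 2 + n * GaussLSI.Δ (W / √I * (I₀ / n - 1)) := by
  intro γ I D I₀ W
  have hp2 : ContDiff ℝ 2 p := contDiff_infty.1 hp_smooth 2
  have hlaw : P.map X = GaussLSI.lawOf p := hp_density
  have hprob : IsProbabilityMeasure (GaussLSI.lawOf p) :=
    hlaw ▸ Measure.isProbabilityMeasure_map hX
  have hpi : Integrable p := by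
    simpa using (GaussLSI.integrable_lawOf_iff hp2.continuous hp_nonneg).1
      (integrable_const (1 : ℝ))
  have h1 : ∫ x, p x = 1 := by
    simpa using (GaussLSI.integral_lawOf hp2.continuous hp_nonneg fun _ => (1 : ℝ)).symm
  have h : GaussLSI.IsFisherDensity p :=
    GaussLSI.isFisherDensity_of_relFisher hp2 hp_nonneg hpi
      (GaussLSI.integrable_of_relFisherInfo_ne_top (hp2.of_le one_le_two) hp_nonneg hI)
  have hI₀ : I₀ = ∫ x, ‖gradient p x‖ ^ 2 / p x := by
    change (GaussLSI.fisherInfo p).toReal = _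
    rw [h.fisherInfo_eq, ENNReal.toReal_ofReal (h.fisher_pos h1 hn).le]
  have hIv : I = I₀ - 2 * n + ∫ x, ‖x‖ ^ 2 * p x := hI₀ ▸ h.relFisherInfo_toReal h1
  have hW := h.W2_sq_le h1
  have hint := fun u hu => h.klDiv_le_W2 h1 hn hW.1 (u := u) hu
  have hzero := h.klDiv_le_zero_of_W2 h1 hn
  have hdef := h.deficit_ge h1 hn
  have hkl := (h.klDiv_stdGaussian h1).1
  have hfin : GaussLSI.fisherInfo p ≠ ⊤ := h.fisherInfo_eq ▸ ENNReal.ofReal_ne_top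
  have hJ := h.fisher_pos h1 hn
  rw [← hI₀] at hdef hJ
  simp only [← hI₀] at hint
  rw [← hIv] at hdef
  rw [← hlaw] at hW hint hzero hdef hkl
  obtain ⟨ht, hct, href⟩ := GaussLSI.refined_deficit hn (I := I) (D := D) (W := W) hJ
    ENNReal.toReal_nonneg ENNReal.toReal_nonneg hIv hW.2 hdef hzero hint
  exact ⟨⟨hkl, hfin, hW.1, ht, hct⟩, hdef, href⟩
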